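/- Let $n\ge 3$, $p>1$, $d\ge1$ be integers and $r=pd$. Let $R$ be a commutative ring containing a primitive $p$th root of unity $\varepsilon$, let $q,Q_1,\dots,Q_d\in R^\times$ and let $\mathbf b=(b_1,\dots,b_p)$ be a sequence of non-negative integers with $b_1+\dots+b_p=n$. Put $b_i^j=b_i+\dots+b_j$ for $i\le j$ and $b_i^j=0$ for $i>j$. For $m,k\ge 0$ and $P_1,\dots,P_k\in R$ let $\mathcal H_{k,m}(P_1,\dots,P_k)$ be the Ariki–Koike algebra: the unital associative $R$-algebra with generators $T_0,\dots,T_{m-1}$ and relations $(T_0-P_1)\cdots(T_0-P_k)=0$, $(T_i-q)(T_i+1)=0$ for $1\le i<m$, $T_0T_1T_0T_1=T_1T_0T_1T_0$, $T_{i+1}T_iT_{i+1}=T_iT_{i+1}T_i$ for $1\le i\le m-2$, $T_iT_j=T_jT_i$ for $0\le i<j-1\le m-2$ (for $m=0$ it is $R$). Put $L_1=T_0$, $L_{i+1}=q^{-1}T_iL_iT_i$, and, for $w$ in the symmetric group $\mathfrak S_m$ with reduced expression $w=s_{i_1}\cdots s_{i_l}$, $s_i=(i,i+1)$, put $T_w=T_{i_1}\cdots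 T_{i_l}$ and $\ell(w)=l$. The canonical trace form of $\mathcal H_{k,m}(P_1,\dots,P_k)$ is the $R$-linear map to $R$ which sends $L_1^{a_1}\cdots L_m^{a_m}T_xT_y$, for $0\le a_i<k$ and $x,y\in\mathfrak S_m$, to $q^{\ell(x)}$ if $a_1=\dots=a_m=0$ and $x=y^{-1}$, and to $0$ otherwise. Let $\mathcal H_{r,n}=\mathcal H_{r,n}(\varepsilon Q_1,\dots,\varepsilon Q_d,\dots,\varepsilon^pQ_1,\dots,\varepsilon^pQ_d)$ and $\mathcal H_{d,\mathbf b}=\bigotimes_{t=1}^p\mathcal H_{d,b_t}(\varepsilon^tQ_1,\dots,\varepsilon^tQ_d)$, let $\mathrm{Tr}$ be the canonical trace form of $\mathcal H_{r,n}$, and let $\mathrm{Tr}_{\mathbf b}$ be the tensor product of the canonical trace forms of the factors of $\mathcal H_{d,\mathbf b}$. For non-negative integers $a,c,k$ with $a+c+k\le n$ let $w_{a,c}^{\langle k\rangle}=(s_{a+c+k-1}\cdots s_{k+2}s_{k+1})^c\in\mathfrak S_n$ (the identity if $a=0$ or $c=0$), $w_{a,c}=w_{a,c}^{\langle0\rangle}$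 and $T_{a,c}=T_{w_{a,c}}$. In $\mathcal H_{r,n}$ put $$\mathcal L^{(i,j)}_{1,m}=\prod_{k=1}^{m}\prod_{t=i}^{j}\prod_{u=1}^d(L_k-\varepsilon^tQ_u),\qquad \mathcal L^{(i)}_{1,m}=\mathcal L^{(i,i)}_{1,m},$$ $$v_{\mathbf b}=\mathcal L^{(1,p-1)}_{1,b_p}T_{b_p,b_1^{p-1}}\,\mathcal L^{(1,p-2)}_{1,b_{p-1}}T_{b_{p-1},b_1^{p-2}}\cdots\mathcal L^{(1,1)}_{1,b_2}T_{b_2,b_1^1}\;\mathcal L^{(2)}_{1,b_1^1}\mathcal L^{(3)}_{1,b_1^2}\cdots\mathcal L^{(p)}_{1,b_1^{p-1}},$$ $$w_{\mathbf b}=w^{\langle b_1^{p-2}\rangle}_{b_{p-1},b_p^p}\cdots w^{\langle b_1^1\rangle}_{b_2,b_3^p}\,w_{b_1,b_2^p},\qquad T_{\mathbf b}=T_{w_{\mathbf b}}.$$ For $h\in\mathcal H_{d,\mathbf b}$ put $h\cdot v_{\mathbf b}=\widehat\Theta_{\mathbf b}(h)v_{\mathbf b}$, where $\widehat\Theta_{\mathbf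 b}:\mathcal H_{d,\mathbf b}\to\mathcal H_{r,n}$ is the $R$-linear map which sends $\bigotimes_{t=1}^p L_1^{a_{t,1}}\cdots L_{b_t}^{a_{t,b_t}}T_{x_t}$, for $0\le a_{t,j}<d$ and $x_t\in\mathfrak S_{b_t}$, to $M_pM_{p-1}\cdots M_1$, where $M_t=L_{c_t+1}^{a_{t,1}}\cdots L_{c_t+b_t}^{a_{t,b_t}}T_{x_t^{\langle c_t\rangle}}$, $c_t=b_{t+1}^p$, and $x\mapsto x^{\langle c\rangle}$ is the homomorphism $s_i\mapsto s_{i+c}$. Then the linear maps $\mathrm{Tr}$, $\mathrm{Tr}_{\mathbf b}$ and $\widehat\Theta_{\mathbf b}$ exist and are uniquely determined by these formulas, and $$\mathrm{Tr}(h\cdot v_{\mathbf b}T_{\mathbf b})=\mathrm{Tr}_{\mathbf b}(h)\,\mathrm{Tr}(v_{\mathbf b}T_{\mathbf b})\qquad\text{for all }h\in\mathcal H_{d,\mathbf b}.$$ Moreover, with $\alpha(\mathbf b)=\sum_{i=1}^p i\,b_i$, $$\mathrm{Tr}(v_{\mathbf b}T_{\mathbf b})=(-1)^{dn(p-1)}\,q^{\ell(w_{\mathbf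 b})}\,\varepsilon^{\frac12rn(p-1)-d\alpha(\mathbf b)}\,(Q_1\cdots Q_d)^{n(p-1)}.$$ -/

import Mathlib

open scoped TensorProduct

namespace CycHecke

/-! ### Symmetric groups: simple transpositions, length, reduced words

Indices are `1`-based, as usual: `s n i = (i, i+1)` for `1 ≤ i < n`, where the letter `k` of
`{1, …, n}` is the element `k - 1` of `Fin n`.  Permutations enter only through words in the
simple transpositions. -/

/-- The simple transposition `s_i = (i, i+1)` of the symmetric group on `n` letters
(meaningful for `1 ≤ i < n`). -/
def s (n i : ℕ) : Equiv.Perm (Fin n) :=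
  if h : i < n then Equiv.swap ⟨i - 1, by omega⟩ ⟨i, h⟩ else 1

/-- `l = [i₁, …, i_k]` is an expression `w = s_{i₁} ⋯ s_{i_k}` with `1 ≤ i_j < n`. -/
def IsWord {n : ℕ} (w : Equiv.Perm (Fin n)) (l : List ℕ) : Prop :=
  (∀ i ∈ l, 1 ≤ i ∧ i < n) ∧ (l.map (s n)).prod = w

/-- The Coxeter length: the minimal length of an expression of `w`. -/
noncomputable def len {n : ℕ} (w : Equiv.Perm (Fin n)) : ℕ :=
  sInf {k | ∃ l : List ℕ, IsWord w l ∧ l.length = k}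

theorem exists_isWord {n : ℕ} (w : Equiv.Perm (Fin n)) : ∃ l : List ℕ, IsWord w l := by
  cases n with
  | zero => exact ⟨[], by simp, Subsingleton.elim _ _⟩
  | succ m =>
    have hw : w ∈ Submonoid.closure
        (Set.range fun i : Fin m => Equiv.swap i.castSucc i.succ) := by
      rw [Equiv.Perm.mclosure_swap_castSucc_succ]; trivial
    induction hw using Submonoid.closure_induction with
    | mem x hx =>
      obtain ⟨i, rfl⟩ := hx
      refine ⟨[i.val + 1], by simp, ?_⟩
      have hi : (i : ℕ) + 1 < m + 1 := by omega
      simp only [List.map_cons, List.map_nil, List.prod_cons, List.prod_nil, mul_one, s,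
        dif_pos hi]
      congr 1
    | one => exact ⟨[], by simp, by simp⟩
    | mul x y _ _ hx hy =>
      obtain ⟨l, hl, rfl⟩ := hx
      obtain ⟨k, hk, rfl⟩ := hy
      refine ⟨l ++ k, ?_, by simp⟩
      intro i hi
      rcases List.mem_append.1 hi with h | h
      · exact hl i h
      · exact hk i h

theorem exists_reduced {n : ℕ} (w : Equiv.Perm (Fin n)) :
    ∃ l : List ℕ, IsWord w l ∧ l.length = len w := by
  obtain ⟨l, hl⟩ := exists_isWord w
  exact Nat.sInf_mem (s := {k | ∃ l : List ℕ, IsWord w l ∧ l.length = k}) ⟨l.length, l, hl, rfl⟩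

/-- A reduced expression of `w`. -/
noncomputable def reducedWord {n : ℕ} (w : Equiv.Perm (Fin n)) : List ℕ :=
  (exists_reduced w).choose

/-- The permutation `w^⟨c⟩`, for `w` in the symmetric group on `m` letters: the image of `w` under
`s_i ↦ s_{i+c}`, i.e. `w` acting on the letters `c+1, …, c+m` of `{1, …, n}`
(meaningful for `c + m ≤ n`). -/
noncomputable def shift {m : ℕ} (n c : ℕ) (w : Equiv.Perm (Fin m)) : Equiv.Perm (Fin n) :=
  if h : c + m ≤ n then
    w.viaEmbedding ((Fin.natAddEmb c).trans (Fin.castLEEmb h))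
  else 1

/-- `w_{a,b}^⟨k⟩ = (s_{a+b+k-1} ⋯ s_{k+1})^b` in the symmetric group on `n` letters. -/
def wab (n a b k : ℕ) : Equiv.Perm (Fin n) :=
  (((List.range' (k + 1) (a + b - 1)).reverse.map (s n)).prod) ^ b

/-! ### Ariki–Koike algebras -/

section Algebra

variable {R : Type*} [CommRing R]

/-- The defining relations of the Ariki–Koike algebra with generators `T_0, …, T_{n-1}` and
parameters `q, Q_1, …, Q_r`. -/
inductive Rel (n : ℕ) {r : ℕ} (q : Rˣ) (Q : Fin r → R) :
    FreeAlgebra R (Fin n) → FreeAlgebra R (Fin n) → Prop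
  | cyclotomic (h : 0 < n) :
      Rel n q Q
        (List.ofFn fun k : Fin r =>
          FreeAlgebra.ι R (⟨0, h⟩ : Fin n) - algebraMap R (FreeAlgebra R (Fin n)) (Q k)).prod
        0
  | quadratic (i : Fin n) (hi : 1 ≤ i.val) :
      Rel n q Q
        ((FreeAlgebra.ι R i - algebraMap R (FreeAlgebra R (Fin n)) (q : R)) *
          (FreeAlgebra.ι R i + 1))
        0
  | braid_four (h : 1 < n) :
      Rel n q Q
        (FreeAlgebra.ι R (⟨0, by omega⟩ : Fin n) * FreeAlgebra.ι R (⟨1, h⟩ : Fin n) *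
          FreeAlgebra.ι R (⟨0, by omega⟩ : Fin n) * FreeAlgebra.ι R (⟨1, h⟩ : Fin n))
        (FreeAlgebra.ι R (⟨1, h⟩ : Fin n) * FreeAlgebra.ι R (⟨0, by omega⟩ : Fin n) *
          FreeAlgebra.ι R (⟨1, h⟩ : Fin n) * FreeAlgebra.ι R (⟨0, by omega⟩ : Fin n))
  | braid_three (i j : Fin n) (hi : 1 ≤ i.val) (hij : i.val + 1 = j.val) :
      Rel n q Q
        (FreeAlgebra.ι R j * FreeAlgebra.ι R i * FreeAlgebra.ι R j)
        (FreeAlgebra.ι R i * FreeAlgebra.ι R j * FreeAlgebra.ι R i)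
  | comm (i j : Fin n) (hij : i.val + 1 < j.val) :
      Rel n q Q
        (FreeAlgebra.ι R i * FreeAlgebra.ι R j)
        (FreeAlgebra.ι R j * FreeAlgebra.ι R i)

/-- The Ariki–Koike algebra `H_{r,n}(q, Q_1, …, Q_r)` over `R`; for `n = 0` it is `R`. -/
def AK (n : ℕ) {r : ℕ} (q : Rˣ) (Q : Fin r → R) : Type _ := RingQuot (Rel n q Q)

noncomputable instance (n : ℕ) {r : ℕ} (q : Rˣ) (Q : Fin r → R) : Ring (AK n q Q) :=
  inferInstanceAs (Ring (RingQuot (Rel n q Q)))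

noncomputable instance (n : ℕ) {r : ℕ} (q : Rˣ) (Q : Fin r → R) : Algebra R (AK n q Q) :=
  inferInstanceAs (Algebra R (RingQuot (Rel n q Q)))

variable {n r : ℕ} {q : Rˣ} {Q : Fin r → R}

/-- The generator `T_i` (meaningful for `0 ≤ i < n`). -/
noncomputable def T (i : ℕ) : AK n q Q :=
  if h : i < n then RingQuot.mkAlgHom R (Rel n q Q) (FreeAlgebra.ι R ⟨i, h⟩) else 1

/-- `T_w = T_{i₁} ⋯ T_{i_k}` for a reduced expression `w = s_{i₁} ⋯ s_{i_k}`
(the braid relations make it independent of the reduced expression). -/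
noncomputable def Tw (w : Equiv.Perm (Fin n)) : AK n q Q :=
  ((reducedWord w).map fun i => (T i : AK n q Q)).prod

/-- The Jucys–Murphy elements: `L_1 = T_0`, `L_{k+1} = q⁻¹ T_k L_k T_k`
(`1`-based; the value at `0` is a dummy). -/
noncomputable def L : ℕ → AK n q Q
  | 0 => 1
  | 1 => T 0
  | k + 2 => ((q⁻¹ : Rˣ) : R) • (T (k + 1) * L (k + 1) * T (k + 1))

/-- The monomial `L_{c+1}^{a_1} ⋯ L_{c+m}^{a_m}`. -/
noncomputable def Lmon {m : ℕ} (c : ℕ) (a : Fin m → ℕ) : AK n q Q :=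
  (List.ofFn fun j : Fin m => (L (c + j.val + 1) : AK n q Q) ^ a j).prod

open Classical in
/-- `τ` is the canonical trace form on the Ariki–Koike algebra: the `R`-linear map with
`τ(L_1^{a_1} ⋯ L_n^{a_n} T_x T_y) = q^{ℓ(x)}` if all `a_i = 0` and `x = y⁻¹`, and `0` otherwise,
for all `0 ≤ a_i < r` and all permutations `x, y`. -/
def IsCanonicalTrace (τ : AK n q Q →ₗ[R] R) : Prop :=
  ∀ (a : Fin n → ℕ), (∀ j, a j < r) → ∀ x y : Equiv.Perm (Fin n),
    τ (Lmon 0 a * Tw x * Tw y) =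
      if (∀ j, a j = 0) ∧ x = y⁻¹ then (q : R) ^ len x else 0

end Algebra

/-! ### Compositions -/

/-- The `k`-th part `b_k` (`1 ≤ k ≤ p`) of the sequence `b = (b_1, …, b_p)`. -/
def part {p : ℕ} (b : Fin p → ℕ) (k : ℕ) : ℕ :=
  if h : 1 ≤ k ∧ k ≤ p then b ⟨k - 1, by omega⟩ else 0

/-- `b_i^j = b_i + ⋯ + b_j`, which is `0` if `i > j`. -/
def psum {p : ℕ} (b : Fin p → ℕ) (i j : ℕ) : ℕ := ∑ k ∈ Finset.Icc i j, part b k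

/-- `w_b = w^⟨b_1^{p-2}⟩_{b_{p-1}, b_p^p} ⋯ w^⟨b_1^1⟩_{b_2, b_3^p} w_{b_1, b_2^p}`. -/
def wb (n : ℕ) {p : ℕ} (b : Fin p → ℕ) : Equiv.Perm (Fin n) :=
  ((List.range' 1 (p - 1)).reverse.map fun k =>
    wab n (part b k) (psum b (k + 1) p) (psum b 1 (k - 1))).prod

/-! ### The algebra `H_{r,n}` with `r = pd`, the element `v_b`, and the algebra `H_{d,b}` -/

section Main

variable {R : Type*} [CommRing R]

/-- `(εQ_1, …, εQ_d, ε²Q_1, …, ε²Q_d, …, ε^pQ_1, …, ε^pQ_d)`. -/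
def Qeps (p : ℕ) {d : ℕ} (ε : Rˣ) (Q : Fin d → Rˣ) : Fin (p * d) → R := fun k =>
  ((ε ^ ((finProdFinEquiv.symm k).1.val + 1) * Q (finProdFinEquiv.symm k).2 : Rˣ) : R)

/-- The Ariki–Koike algebra `H_{r,n}`, `r = pd`, with parameters `q` and
`εQ ∨ ε²Q ∨ ⋯ ∨ ε^pQ`. -/
abbrev H (p n : ℕ) {d : ℕ} (ε q : Rˣ) (Q : Fin d → Rˣ) : Type _ := AK n q (Qeps p ε Q)

/-- The Ariki–Koike algebra `H_{d,m}(ε^t Q)`. -/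
abbrev Hfac (m t : ℕ) {d : ℕ} (ε q : Rˣ) (Q : Fin d → Rˣ) : Type _ :=
  AK m q (fun i : Fin d => ((ε ^ t * Q i : Rˣ) : R))

/-- `H_{d,b} = H_{d,b_1}(εQ) ⊗ H_{d,b_2}(ε²Q) ⊗ ⋯ ⊗ H_{d,b_p}(ε^pQ)`
(the index `t : Fin p` stands for the factor `t + 1`). -/
abbrev Hb {p d : ℕ} (b : Fin p → ℕ) (ε q : Rˣ) (Q : Fin d → Rˣ) : Type _ :=
  ⨂[R] t : Fin p, Hfac (b t) (t.val + 1) ε q Q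

open Classical in
/-- `τ` is the canonical trace form on `H_{d,b}`: on pure tensors of elements
`L_1^{a_1} ⋯ L_m^{a_m} T_x T_y` (exponents `< d`) it is the product of the values of the canonical
trace forms of the factors. -/
def IsCanonicalTraceB {p d : ℕ} {b : Fin p → ℕ} {ε q : Rˣ} {Q : Fin d → Rˣ}
    (τ : Hb b ε q Q →ₗ[R] R) : Prop :=
  ∀ (a : ∀ t : Fin p, Fin (b t) → ℕ), (∀ t j, a t j < d) →
    ∀ x y : ∀ t : Fin p, Equiv.Perm (Fin (b t)),
      τ (PiTensorProduct.tprod R fun t : Fin p =>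
          (Lmon 0 (a t) * Tw (x t) * Tw (y t) : Hfac (b t) (t.val + 1) ε q Q)) =
        if ∀ t, (∀ j, a t j = 0) ∧ x t = (y t)⁻¹ then (q : R) ^ ∑ t, len (x t) else 0

/-- The number `b_{t+1}^p` of letters that precede the letters of the `t`-th block when the blocks
of sizes `b_1, …, b_p` are placed in reverse order (`t : Fin p` stands for the block `t + 1`). -/
def offset {p : ℕ} (b : Fin p → ℕ) (t : Fin p) : ℕ := psum b (t.val + 2) p

/-- `Θ` is the map `Θ̂_b : H_{d,b} → H_{r,n}` giving the left action of `H_{d,b}` on `v_b H_{r,n}`: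
the `R`-linear map sending
`⊗_t L_1^{a_{t,1}} ⋯ L_{b_t}^{a_{t,b_t}} T_{x_t}`, with exponents `< d`, to the product, over
`t = p, p-1, …, 1` from left to right, of
`L_{c_t+1}^{a_{t,1}} ⋯ L_{c_t+b_t}^{a_{t,b_t}} T_{x_t^⟨c_t⟩}`, where `c_t = b_{t+1}^p`. -/
def IsThetaHat {p d : ℕ} (n : ℕ) {b : Fin p → ℕ} {ε q : Rˣ} {Q : Fin d → Rˣ}
    (Θ : Hb b ε q Q →ₗ[R] H p n ε q Q) : Prop :=
  ∀ (a : ∀ t : Fin p, Fin (b t) → ℕ), (∀ t j, a t j < d) →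
    ∀ x : ∀ t : Fin p, Equiv.Perm (Fin (b t)),
      Θ (PiTensorProduct.tprod R fun t : Fin p =>
          (Lmon 0 (a t) * Tw (x t) : Hfac (b t) (t.val + 1) ε q Q)) =
        ((List.ofFn fun t : Fin p =>
          (Lmon (offset b t) (a t) * Tw (shift n (offset b t) (x t)) : H p n ε q Q)).reverse).prod

variable {p n d : ℕ} (ε q : Rˣ) (Q : Fin d → Rˣ)

/-- `ℒ^{(t)}_k = ∏_{i=1}^d (L_k - ε^t Q_i)`. -/
noncomputable def LL1 (t k : ℕ) : H p n ε q Q :=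
  (List.ofFn fun i : Fin d =>
    (L k : H p n ε q Q) - algebraMap R (H p n ε q Q) ((ε ^ t * Q i : Rˣ) : R)).prod

/-- `ℒ^{(i,j)}_{l,m} = ∏_{l ≤ k ≤ m} ∏_{i ≤ t ≤ j} ℒ^{(t)}_k`, for `i ≤ j`
(the factors commute; an empty product is `1`). -/
noncomputable def LL (i j l m : ℕ) : H p n ε q Q :=
  ((List.range' l (m + 1 - l)).map fun k =>
    ((List.range' i (j + 1 - i)).map fun t => (LL1 ε q Q t k : H p n ε q Q)).prod).prod

/-- `v_b = (∏_{k=p-1,…,1} ℒ^{(1,k)}_{1,b_{k+1}} T_{b_{k+1}, b_1^k}) · ∏_{k=2,…,p} ℒ^{(k)}_{1,b_1^{k-1}}`,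
the first product having decreasing `k` from left to right; here `T_{a,c} = T_{w_{a,c}}`. -/
noncomputable def vb (b : Fin p → ℕ) : H p n ε q Q :=
  ((List.range' 1 (p - 1)).reverse.map fun k =>
      (LL ε q Q 1 k 1 (part b (k + 1)) * Tw (wab n (part b (k + 1)) (psum b 1 k) 0) :
        H p n ε q Q)).prod *
    ((List.range' 2 (p - 1)).map fun k =>
      (LL ε q Q k k 1 (psum b 1 (k - 1)) : H p n ε q Q)).prod

/-- `T_b = T_{w_b}`. -/
noncomputable def Tb (b : Fin p → ℕ) : H p n ε q Q := Tw (wb n b)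

/-- `α(b) = ∑_{i=1}^p i b_i`. -/
def alpha (b : Fin p → ℕ) : ℕ := ∑ t : Fin p, (t.val + 1) * b t

end Main

end CycHecke

open scoped TensorProduct
namespace CycHecke

/-! ### Descents, inversions and reduced words of permutations -/

section Perm

variable {n : ℕ}

/-! Existence and uniqueness of the three linear maps rest on the standard basis theorem: the
elements L^ν T_x with all exponents below r form a basis of the Ariki–Koike algebra. They span
because their span is stable under left multiplication by the generators, thanks to the Bernstein
relations between T_i and the L_k (`bernstein`, `T_mul_mem_stdSpan`). Independence comes from a
model. On polynomials with coefficients in the regular representation of the Iwahori–Hecke algebra,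
T_i acts by the Bernstein formula (`affT`) and T_0 by multiplication by the first variable modulo a
monic polynomial of degree r (`redX`). On polynomials with exponents below r the defining relations
hold (`exists_rep`), and L^ν T_x sends the constant 1 to the basis vector indexed by ν and x. The
canonical trace is the coefficient of that vector at ν = 0, x = 1.

The trace identity follows by adding one block at a time. Let w interchange the first m letters with
the following a letters. The key formula `trace_blockSwap` is Tr(A g(L_{a+1},…,L_{a+m}) T_w B
T_{w⁻¹}) = q^{ℓ(w)} Tr(A) Tr(g(L_1,…,L_m) B), where A is in the algebra generated by T_0,…,T_{a-1},
B in the one generated by T_0,…,T_{m-1}, and g has exponents below r. Moving polynomials in the L_k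
through T_w creates only errors with T_u, ℓ(u) < ℓ(w); these have trace zero because w is shortest
in its double coset 𝔖_a w 𝔖_m (`IsBlockSwap.le_len_mul_mul`).

Both v_b and w_b are recursive in the number t of blocks: with w = w_{b_{t+1}, b_1^t}, the new v is
ℒ^{(1,t)}_{1,b_{t+1}} T_w · (old v) · ℒ^{(t+1)}_{1,b_1^t} (`vpre_succ`), and the new permutation is
the old one times w⁻¹ (`wpre_succ`). After inserting the extra left factor ℒ^{(t+1,p)}_{1,b_1^t},
the key formula closes an induction on t (`trace_prefix`). Each step splits off a trace supported on
the letters of one block, where every parameter group ε^k Q occurs except the block's own. The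
degree in each variable is then at most (p-1)d + (d-1) < r, so the trace just reads a constant
coefficient: it is 0 unless the component of h is 1, and otherwise it is a power of ∏_{k≠t} ∏_i
(-ε^k Q_i). Multiplying over the blocks and using ε^p = 1 gives the stated value (`prod_blocks`). -/

theorem s_eq {i : ℕ} (h : i < n) : s n i = Equiv.swap ⟨i - 1, by omega⟩ ⟨i, h⟩ := dif_pos h

@[simp] theorem s_mul_self (i : ℕ) : s n i * s n i = 1 := by
  unfold s; split_ifs <;> simp

@[simp] theorem s_mul_cancel (i : ℕ) (w : Equiv.Perm (Fin n)) : s n i * (s n i * w) = w := by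
  rw [← mul_assoc, s_mul_self, one_mul]

@[simp] theorem s_inv (i : ℕ) : (s n i)⁻¹ = s n i := inv_eq_of_mul_eq_one_left (s_mul_self i)

theorem s_val {i : ℕ} (h : i < n) (x : Fin n) :
    (s n i x : ℕ) = if x.val = i - 1 then i else if x.val = i then i - 1 else x.val := by
  rw [s_eq h, Equiv.swap_apply_def]
  simp only [Fin.ext_iff]
  split_ifs <;> simp_all

/-- `i` is an ascent of `w`, that is `w⁻¹(i) < w⁻¹(i+1)` for the letters `1, …, n`. -/
def Asc (w : Equiv.Perm (Fin n)) (i : ℕ) : Prop :=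
  ∃ h : i < n, w⁻¹ ⟨i - 1, by omega⟩ < w⁻¹ ⟨i, h⟩

/-- The set of inversions. -/
def inversions (w : Equiv.Perm (Fin n)) : Finset (Fin n × Fin n) :=
  Finset.univ.filter fun x => x.1 < x.2 ∧ w x.2 < w x.1

/-- Exchanging the values i and i+1 alters the relative order of a single pair of positions, the two
where w takes these values. At an ascent this pair becomes an inversion and nothing else changes. -/
theorem card_inversions_of_asc {w : Equiv.Perm (Fin n)} {i : ℕ} (h1 : 1 ≤ i) (hw : Asc w i) :
    (inversions (s n i * w)).card = (inversions w).card + 1 := by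
  obtain ⟨h, hw⟩ := hw
  have key : inversions (s n i * w) =
      insert (w⁻¹ ⟨i - 1, by omega⟩, w⁻¹ ⟨i, h⟩) (inversions w) := by
    ext ⟨x, y⟩
    simp only [inversions, Finset.mem_filter, Finset.mem_univ, true_and, Finset.mem_insert,
      Prod.mk.injEq, Equiv.Perm.mul_apply, Fin.lt_def, s_val h, Equiv.Perm.eq_inv_iff_eq,
      Fin.ext_iff]
    rw [Fin.lt_def] at hw
    have hx := fun x => w.eq_inv_iff_eq (x := x) (y := ⟨i - 1, by omega⟩)
    have hx' := fun x => w.eq_inv_iff_eq (x := x) (y := ⟨i, h⟩)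
    have hxy : (w x : ℕ) = w y ↔ (x : ℕ) = y := by
      rw [← Fin.ext_iff, ← Fin.ext_iff, w.injective.eq_iff]
    -- With both positions abstracted and injectivity of w recorded as equivalences, what remains is
    -- linear arithmetic.
    generalize w⁻¹ ⟨i - 1, by omega⟩ = P at *
    generalize w⁻¹ ⟨i, h⟩ = Q at *
    have h1x := hx x
    have h2x := hx' x
    have h1y := hx y
    have h2y := hx' y
    simp only [Fin.ext_iff] at h1x h2x h1y h2y
    split_ifs <;> omega
  rw [key, Finset.card_insert_of_notMem]
  have e := fun y => (w.eq_inv_iff_eq (y := y)).1 rfl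
  simp only [inversions, Finset.mem_filter, Finset.mem_univ, true_and, not_and, not_lt,
    e, Fin.le_def]
  omega

theorem asc_s_mul {w : Equiv.Perm (Fin n)} {i : ℕ} (h1 : 1 ≤ i) (h : i < n) :
    Asc (s n i * w) i ↔ ¬ Asc w i := by
  have e1 : s n i ⟨i - 1, by omega⟩ = ⟨i, h⟩ := by
    apply Fin.ext; rw [s_val h]; simp
  have e2 : s n i ⟨i, h⟩ = ⟨i - 1, by omega⟩ := by
    apply Fin.ext; rw [s_val h]; simp
  have ne : w⁻¹ ⟨i - 1, by omega⟩ ≠ w⁻¹ ⟨i, h⟩ := fun e => by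
    have := congrArg Fin.val (w⁻¹.injective e); simp at this; omega
  simp only [Asc, h, exists_true_left, mul_inv_rev, s_inv, Equiv.Perm.mul_apply, e1, e2, not_lt]
  exact ⟨le_of_lt, fun h => lt_of_le_of_ne h ne.symm⟩

theorem card_inversions_of_not_asc {w : Equiv.Perm (Fin n)} {i : ℕ} (h1 : 1 ≤ i) (h : i < n)
    (hw : ¬ Asc w i) : (inversions w).card = (inversions (s n i * w)).card + 1 := by
  rw [← card_inversions_of_asc h1 ((asc_s_mul h1 h).2 hw), s_mul_cancel]

/-- Without descents w⁻¹ is strictly increasing, and the identity is the only order automorphism of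
a finite chain. -/
theorem eq_one_of_forall_asc {w : Equiv.Perm (Fin n)} (hw : ∀ i, 1 ≤ i → i < n → Asc w i) :
    w = 1 := by
  have hm : StrictMono (w⁻¹ : Equiv.Perm (Fin n)) := by
    cases n with
    | zero => exact fun x => x.elim0
    | succ m =>
      rw [Fin.strictMono_iff_lt_succ]
      intro i
      obtain ⟨_, h⟩ := hw (i.val + 1) (by omega) (by omega)
      exact h
  have : w⁻¹ = 1 := by
    ext x
    have := congrArg (fun e : Fin n ≃o Fin n => e x)
      (Subsingleton.elim (hm.orderIsoOfSurjective _ (w⁻¹).surjective) (OrderIso.refl _))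
    simpa using congrArg Fin.val this
  simpa using this

theorem IsWord.cons {w : Equiv.Perm (Fin n)} {l : List ℕ} {i : ℕ} (h1 : 1 ≤ i) (h : i < n)
    (hl : IsWord w l) : IsWord (s n i * w) (i :: l) := by
  refine ⟨?_, by simp [hl.2]⟩
  simp only [List.mem_cons, forall_eq_or_imp]
  exact ⟨⟨h1, h⟩, hl.1⟩

theorem card_inversions_one : (inversions (1 : Equiv.Perm (Fin n))).card = 0 := by
  simp only [inversions, Finset.card_eq_zero, Equiv.Perm.one_apply]
  refine Finset.filter_eq_empty_iff.2 fun x _ h => ?_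
  exact absurd h.1 (not_lt.2 h.2.le)

theorem card_inversions_le {w : Equiv.Perm (Fin n)} {l : List ℕ} (hl : IsWord w l) :
    (inversions w).card ≤ l.length := by
  induction l generalizing w with
  | nil => obtain ⟨_, rfl⟩ := hl; simp [card_inversions_one]
  | cons i l ih =>
    obtain ⟨hi, hw⟩ := hl
    simp only [List.mem_cons, forall_eq_or_imp] at hi
    have := ih ⟨hi.2, rfl⟩
    simp only [List.map_cons, List.prod_cons] at hw
    subst hw
    simp only [List.length_cons]
    by_cases ha : Asc (l.map (s n)).prod i
    · rw [card_inversions_of_asc hi.1.1 ha]; omega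
    · have := card_inversions_of_not_asc hi.1.1 hi.1.2 ha; omega

theorem exists_word_length (N : ℕ) (w : Equiv.Perm (Fin n)) (hN : (inversions w).card = N) :
    ∃ l, IsWord w l ∧ l.length = N := by
  induction N generalizing w with
  | zero =>
    refine ⟨[], ⟨by simp, ?_⟩, rfl⟩
    refine (eq_one_of_forall_asc fun i h1 h => ?_).symm
    by_contra hw
    have := card_inversions_of_not_asc h1 h hw; omega
  | succ N ih =>
    by_cases hw : ∀ i, 1 ≤ i → i < n → Asc w i
    · rw [eq_one_of_forall_asc hw, card_inversions_one] at hN; omega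
    · push Not at hw
      obtain ⟨i, h1, h, hw⟩ := hw
      have := card_inversions_of_not_asc h1 h hw
      obtain ⟨l, hl, hlen⟩ := ih (s n i * w) (by omega)
      exact ⟨i :: l, by simpa using hl.cons h1 h, by simp [hlen]⟩

/-- A letter changes the number of inversions by exactly one, which bounds the length below;
stripping descents until none is left produces a word attaining the bound. -/
theorem len_eq_card (w : Equiv.Perm (Fin n)) : len w = (inversions w).card := by
  apply le_antisymm
  · obtain ⟨l, hl⟩ := exists_word_length _ w rfl
    exact Nat.sInf_le ⟨l, hl⟩
  · obtain ⟨l, hl, hlen⟩ := exists_reduced w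
    rw [← hlen]; exact card_inversions_le hl

theorem len_le_of_isWord {w : Equiv.Perm (Fin n)} {l : List ℕ} (hl : IsWord w l) :
    len w ≤ l.length := by rw [len_eq_card]; exact card_inversions_le hl

theorem len_of_asc {w : Equiv.Perm (Fin n)} {i : ℕ} (h1 : 1 ≤ i) (hw : Asc w i) :
    len (s n i * w) = len w + 1 := by
  rw [len_eq_card, len_eq_card, card_inversions_of_asc h1 hw]

theorem len_of_not_asc {w : Equiv.Perm (Fin n)} {i : ℕ} (h1 : 1 ≤ i) (h : i < n)
    (hw : ¬ Asc w i) : len w = len (s n i * w) + 1 := by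
  rw [len_eq_card, len_eq_card, card_inversions_of_not_asc h1 h hw]

@[simp] theorem len_one : len (1 : Equiv.Perm (Fin n)) = 0 := by
  rw [len_eq_card, card_inversions_one]

theorem eq_one_of_len {w : Equiv.Perm (Fin n)} (h : len w = 0) : w = 1 :=
  eq_one_of_forall_asc fun i h1 hi => by
    by_contra hw
    have := len_of_not_asc h1 hi hw; omega

theorem len_s_mul_le (w : Equiv.Perm (Fin n)) {i : ℕ} (h1 : 1 ≤ i) (h : i < n) :
    len (s n i * w) ≤ len w + 1 := by
  by_cases hw : Asc w i
  · exact (len_of_asc h1 hw).le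
  · have := len_of_not_asc h1 h hw; omega

/-- Induction along a reduced word read from the left. Most later facts about T_w are proved with
it, since T_i T_w is again a basis element at an ascent. -/
theorem perm_induction {P : Equiv.Perm (Fin n) → Prop} (one : P 1)
    (mul : ∀ w i, 1 ≤ i → i < n → Asc w i → P w → P (s n i * w)) (w : Equiv.Perm (Fin n)) :
    P w := by
  induction hN : len w generalizing w with
  | zero => rwa [eq_one_of_len hN]
  | succ N ih =>
    by_cases hw : ∀ i, 1 ≤ i → i < n → Asc w i
    · rwa [eq_one_of_forall_asc hw]
    · push Not at hw
      obtain ⟨i, h1, h, hw⟩ := hw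
      have := len_of_not_asc h1 h hw
      have h2 := mul (s n i * w) i h1 h ((asc_s_mul h1 h).2 hw) (ih _ (by omega))
      rwa [s_mul_cancel] at h2

theorem isWord_reducedWord (w : Equiv.Perm (Fin n)) : IsWord w (reducedWord w) :=
  (exists_reduced w).choose_spec.1

theorem length_reducedWord (w : Equiv.Perm (Fin n)) : (reducedWord w).length = len w :=
  (exists_reduced w).choose_spec.2

theorem IsWord.reverse {w : Equiv.Perm (Fin n)} {l : List ℕ} (hl : IsWord w l) :
    IsWord w⁻¹ l.reverse := by
  refine ⟨fun i hi => hl.1 i (List.mem_reverse.1 hi), ?_⟩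
  rw [← hl.2, List.prod_inv_reverse, List.map_reverse]
  simp [Function.comp_def]

@[simp] theorem len_inv (w : Equiv.Perm (Fin n)) : len w⁻¹ = len w := by
  have key : ∀ w : Equiv.Perm (Fin n), len w⁻¹ ≤ len w := fun w => by
    rw [← length_reducedWord w, ← List.length_reverse]
    exact len_le_of_isWord (isWord_reducedWord w).reverse
  exact le_antisymm (key w) (by simpa using key w⁻¹)

theorem IsWord.append {x y : Equiv.Perm (Fin n)} {l k : List ℕ} (hl : IsWord x l)
    (hk : IsWord y k) : IsWord (x * y) (l ++ k) := by
  refine ⟨fun i hi => ?_, by simp [hl.2, hk.2]⟩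
  rcases List.mem_append.1 hi with h | h
  exacts [hl.1 i h, hk.1 i h]

theorem asc_s_mul_of_ne {w : Equiv.Perm (Fin n)} {i j : ℕ} (h1 : 1 ≤ i) (hi : i < n)
    (h2 : 1 ≤ j) (hj : j < n) (hij : i + 1 < j ∨ j + 1 < i) : Asc (s n i * w) j ↔ Asc w j := by
  have e1 : s n i ⟨j - 1, by omega⟩ = ⟨j - 1, by omega⟩ := by
    apply Fin.ext; rw [s_val hi]; simp only; split_ifs <;> omega
  have e2 : s n i ⟨j, hj⟩ = ⟨j, hj⟩ := by
    apply Fin.ext; rw [s_val hi]; simp only; split_ifs <;> omega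
  simp only [Asc, hj, exists_true_left, mul_inv_rev, s_inv, Equiv.Perm.mul_apply, e1, e2]

theorem s_comm {i j : ℕ} (h1 : 1 ≤ i) (hi : i < n) (h2 : 1 ≤ j) (hj : j < n)
    (hij : i + 1 < j ∨ j + 1 < i) : s n i * s n j = s n j * s n i := by
  ext x
  simp only [Equiv.Perm.mul_apply, s_val hi, s_val hj]
  split_ifs <;> omega

theorem s_braid {i : ℕ} (h1 : 1 ≤ i) (hi : i + 1 < n) :
    s n i * s n (i + 1) * s n i = s n (i + 1) * s n i * s n (i + 1) := by
  have hi' : i < n := by omega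
  have key : ∀ a b c : Fin n, a ≠ b → b ≠ c → a ≠ c →
      Equiv.swap a b * Equiv.swap b c * Equiv.swap a b =
        Equiv.swap b c * Equiv.swap a b * Equiv.swap b c := fun a b c hab hbc hac => by
    have e2 := Equiv.swap_mul_swap_mul_swap hbc.symm hac.symm
    rw [Equiv.swap_mul_swap_mul_swap hab hac, Equiv.swap_comm c a, ← e2, Equiv.swap_comm b a,
      Equiv.swap_comm c b]
  rw [s_eq hi, s_eq hi']
  refine key _ _ _ ?_ ?_ ?_ <;> simp only [ne_eq, Fin.mk.injEq] <;> omega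

/-- The elements of a sequence in a monoid satisfy the braid relations of `s_1, …, s_{n-1}`. -/
structure Braided {M : Type*} [Monoid M] (n : ℕ) (f : ℕ → M) : Prop where
  comm : ∀ i j, 1 ≤ i → i + 1 < j → j < n → f i * f j = f j * f i
  braid : ∀ i, 1 ≤ i → i + 1 < n → f i * f (i + 1) * f i = f (i + 1) * f i * f (i + 1)

/-- If i and i+1 are both descents, the letters i, i+1, i+2 occur in reversed order, so the longest
element of the subgroup generated by s_i and s_{i+1} splits off on the left with lengths adding.
This is the braid case of Matsumoto's theorem. -/
theorem exists_not_asc_pair {w : Equiv.Perm (Fin n)} {i : ℕ} (h1 : 1 ≤ i) (hi : i + 1 < n)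
    (ha : ¬ Asc w i) (hb : ¬ Asc w (i + 1)) :
    len w = len (s n i * (s n (i + 1) * (s n i * w))) + 3 := by
  have hi' : i < n := by omega
  have e1 : s n i ⟨i - 1, by omega⟩ = ⟨i, hi'⟩ := by
    apply Fin.ext; rw [s_val hi']; simp
  have e2 : s n i ⟨i, hi'⟩ = ⟨i - 1, by omega⟩ := by
    apply Fin.ext; rw [s_val hi']; simp
  have e3 : s n i ⟨i + 1, hi⟩ = ⟨i + 1, hi⟩ := by
    apply Fin.ext; rw [s_val hi']; simp only; split_ifs <;> omega
  have e4 : s n (i + 1) ⟨i - 1, by omega⟩ = ⟨i - 1, by omega⟩ := by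
    apply Fin.ext; rw [s_val hi]; simp only; split_ifs <;> omega
  have e5 : s n (i + 1) ⟨i, hi'⟩ = ⟨i + 1, hi⟩ := by
    apply Fin.ext; rw [s_val hi]; simp
  have ne : w⁻¹ ⟨i - 1, by omega⟩ ≠ w⁻¹ ⟨i, hi'⟩ := fun e => by
    have := congrArg Fin.val (w⁻¹.injective e); simp at this; omega
  simp only [Asc, hi, hi', exists_true_left, not_lt, Nat.add_sub_cancel] at ha hb
  have d2 : ¬ Asc (s n i * w) (i + 1) := by
    simp only [Asc, hi, exists_true_left, mul_inv_rev, s_inv, Equiv.Perm.mul_apply,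
      Nat.add_sub_cancel, e2, e3, not_lt]
    exact hb.trans ha
  have d3 : ¬ Asc (s n (i + 1) * (s n i * w)) i := by
    simp only [Asc, hi', exists_true_left, mul_inv_rev, s_inv, Equiv.Perm.mul_apply,
      e4, e5, e1, e3, not_lt]
    exact hb
  rw [len_of_not_asc h1 hi' (w := w) (by simpa [Asc, hi'] using ha),
    len_of_not_asc (by omega) hi d2, len_of_not_asc h1 hi' d3]

theorem not_asc_of_cons {w : Equiv.Perm (Fin n)} {i : ℕ} {l : List ℕ}
    (hl : IsWord w (i :: l)) (hlen : (i :: l).length = len w) :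
    (1 ≤ i ∧ i < n) ∧ IsWord (s n i * w) l ∧ l.length = len (s n i * w) ∧ ¬ Asc w i := by
  obtain ⟨hi, hw⟩ := hl
  simp only [List.mem_cons, forall_eq_or_imp] at hi
  simp only [List.map_cons, List.prod_cons] at hw
  have hl' : IsWord (s n i * w) l := ⟨hi.2, by rw [← hw, s_mul_cancel]⟩
  have h1 := len_le_of_isWord hl'
  simp only [List.length_cons] at hlen
  have ha : ¬ Asc w i := fun ha => by
    have := len_of_asc hi.1.1 ha; omega
  exact ⟨hi.1, hl', by have := len_of_not_asc hi.1.1 hi.1.2 ha; omega, ha⟩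

/-- Matsumoto's theorem for the symmetric group. -/
theorem Braided.prod_eq {M : Type*} [Monoid M] {f : ℕ → M} (hf : Braided n f)
    {w : Equiv.Perm (Fin n)} {l k : List ℕ} (hl : IsWord w l) (hk : IsWord w k)
    (hl' : l.length = len w) (hk' : k.length = len w) : (l.map f).prod = (k.map f).prod := by
  induction hN : len w using Nat.strong_induction_on generalizing w l k with
  | _ N ih =>
  subst hN
  match l, k, hl', hk' with
  | [], [], _, _ => rfl
  | [], j :: k, hl', hk' => simp only [List.length_cons, List.length_nil] at *; omega
  | i :: l, [], hl', hk' => simp only [List.length_cons, List.length_nil] at *; omega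
  | i :: l, j :: k, hl', hk' =>
    obtain ⟨⟨h1, hi⟩, hwl, hll, ha⟩ := not_asc_of_cons hl hl'
    obtain ⟨⟨h2, hj⟩, hwk, hkl, hb⟩ := not_asc_of_cons hk hk'
    simp only [List.map_cons, List.prod_cons]
    have li := len_of_not_asc h1 hi ha
    have lj := len_of_not_asc h2 hj hb
    -- Different first letters that commute: both tails are replaced, by induction, with words
    -- ending in one common reduced word z of s_j s_i w, after which only the first two letters
    -- differ.
    have far : ∀ i j (l k : List ℕ), 1 ≤ i → i < n → 1 ≤ j → j < n → (i + 1 < j ∨ j + 1 < i) →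
        f i * f j = f j * f i →
        ¬ Asc w i → ¬ Asc w j → IsWord (s n i * w) l → IsWord (s n j * w) k →
        l.length = len (s n i * w) → k.length = len (s n j * w) →
        f i * (l.map f).prod = f j * (k.map f).prod := by
      intro i j l k h1 hi h2 hj hij hc ha hb hwl hwk hll hkl
      have li := len_of_not_asc h1 hi ha
      have lj := len_of_not_asc h2 hj hb
      have lij := len_of_not_asc h2 hj (w := s n i * w)
        (by rwa [asc_s_mul_of_ne h1 hi h2 hj hij])
      obtain ⟨z, hz, hzl⟩ := exists_reduced (s n j * (s n i * w))
      have hz1 := hz.cons h2 hj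
      rw [s_mul_cancel] at hz1
      have hz2 := hz.cons h1 hi
      rw [← mul_assoc, ← mul_assoc, mul_assoc (s n i), ← s_comm h1 hi h2 hj hij, ← mul_assoc,
        s_mul_self, one_mul] at hz2
      rw [ih _ (by omega) hwl hz1 hll (by simp; omega) rfl,
        ih _ (by omega) hwk hz2 hkl (by simp; omega) rfl]
      simp only [List.map_cons, List.prod_cons, ← mul_assoc, hc]
    -- Adjacent first letters: the same comparison, with three letters exchanged by the braid
    -- relation before the common word z.
    have near : ∀ i (l k : List ℕ), 1 ≤ i → i + 1 < n →
        ¬ Asc w i → ¬ Asc w (i + 1) → IsWord (s n i * w) l → IsWord (s n (i + 1) * w) k →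
        l.length = len (s n i * w) → k.length = len (s n (i + 1) * w) →
        f i * (l.map f).prod = f (i + 1) * (k.map f).prod := by
      intro i l k h1 hj ha hb hwl hwk hll hkl
      have hi : i < n := by omega
      have li := len_of_not_asc h1 hi ha
      have lj := len_of_not_asc (by omega) hj hb
      have l3 := exists_not_asc_pair h1 hj ha hb
      obtain ⟨z, hz, hzl⟩ := exists_reduced (s n i * (s n (i + 1) * (s n i * w)))
      have hz1 := (hz.cons h1 hi).cons (i := i + 1) (by omega) hj
      rw [s_mul_cancel, s_mul_cancel] at hz1
      have e : s n i * (s n (i + 1) * (s n i * w)) =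
          s n (i + 1) * (s n i * (s n (i + 1) * w)) := by
        simpa only [mul_assoc] using congrArg (· * w) (s_braid h1 hj)
      have hz2 := ((e ▸ hz).cons (i := i + 1) (by omega) hj).cons h1 hi
      rw [s_mul_cancel, s_mul_cancel] at hz2
      rw [ih _ (by omega) hwl hz1 hll (by simp; omega) rfl,
        ih _ (by omega) hwk hz2 hkl (by simp; omega) rfl]
      simp only [List.map_cons, List.prod_cons, ← mul_assoc, hf.braid i h1 hj]
    rcases lt_trichotomy i j with hij | rfl | hij
    · rcases eq_or_lt_of_le (Nat.succ_le_of_lt hij) with h | h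
      · subst h; exact near i l k h1 hj ha hb hwl hwk hll hkl
      · exact far i j l k h1 hi h2 hj (Or.inl h) (hf.comm i j h1 h hj) ha hb hwl hwk hll hkl
    · rw [ih _ (by omega) hwl hwk hll hkl rfl]
    · rcases eq_or_lt_of_le (Nat.succ_le_of_lt hij) with h | h
      · subst h; exact (near j k l h2 hi hb ha hwk hwl hkl hll).symm
      · exact far i j l k h1 hi h2 hj (Or.inr h) (hf.comm j i h2 h hi).symm ha hb hwl hwk hll hkl

end Perm

end CycHecke

open scoped TensorProduct
namespace CycHecke

/-! ### Relations in Ariki–Koike algebras -/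

section Relations

variable {R : Type*} [CommRing R] {n r : ℕ} {q : Rˣ} {Q : Fin r → R}

/-- The quotient map from the free algebra. -/
noncomputable def mkAK (n : ℕ) (q : Rˣ) (Q : Fin r → R) : FreeAlgebra R (Fin n) →ₐ[R] AK n q Q :=
  RingQuot.mkAlgHom R (Rel n q Q)

theorem T_eq {i : ℕ} (h : i < n) : (T i : AK n q Q) = mkAK n q Q (FreeAlgebra.ι R ⟨i, h⟩) :=
  dif_pos h

theorem mkAK_rel {x y : FreeAlgebra R (Fin n)} (h : Rel n q Q x y) :
    mkAK n q Q x = mkAK n q Q y := RingQuot.mkAlgHom_rel R h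

theorem T_cyclotomic (h : 0 < n) :
    (List.ofFn fun k => (T 0 : AK n q Q) - algebraMap R _ (Q k)).prod = 0 := by
  have := mkAK_rel (Rel.cyclotomic (q := q) (Q := Q) h)
  rw [map_zero, map_list_prod, List.map_ofFn] at this
  rw [← this]
  congr 2
  funext k
  simp [T_eq h]

theorem T_mul_self {i : ℕ} (h1 : 1 ≤ i) (h : i < n) :
    (T i * T i : AK n q Q) = ((q : R) - 1) • T i + (q : R) • 1 := by
  have := mkAK_rel (Rel.quadratic (q := q) (Q := Q) ⟨i, h⟩ h1)
  rw [map_zero, map_mul, map_sub, map_add, map_one, AlgHom.commutes, ← T_eq h] at this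
  rw [← sub_eq_zero, ← this, Algebra.algebraMap_eq_smul_one]
  simp only [sub_mul, mul_add, mul_one, smul_mul_assoc, one_mul, sub_smul, one_smul]
  abel

theorem T_braid_four (h : 1 < n) :
    (T 0 * T 1 * T 0 * T 1 : AK n q Q) = T 1 * T 0 * T 1 * T 0 := by
  simpa only [map_mul, ← T_eq] using mkAK_rel (Rel.braid_four (q := q) (Q := Q) h)

theorem T_comm {i j : ℕ} (hij : i + 1 < j) (hj : j < n) :
    (T i * T j : AK n q Q) = T j * T i := by
  have hi : i < n := by omega
  simpa only [map_mul, ← T_eq] using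
    mkAK_rel (Rel.comm (q := q) (Q := Q) ⟨i, hi⟩ ⟨j, hj⟩ hij)

theorem T_braid {i : ℕ} (h1 : 1 ≤ i) (hi : i + 1 < n) :
    (T i * T (i + 1) * T i : AK n q Q) = T (i + 1) * T i * T (i + 1) := by
  have hi' : i < n := by omega
  simpa only [map_mul, ← T_eq] using
    (mkAK_rel (Rel.braid_three (q := q) (Q := Q) ⟨i, hi'⟩ ⟨i + 1, hi⟩ h1 rfl)).symm

theorem braided_T : Braided n (T : ℕ → AK n q Q) :=
  ⟨fun _ _ _ hij hj => T_comm hij hj, fun _ h1 hi => T_braid h1 hi⟩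

theorem Tw_eq_prod {w : Equiv.Perm (Fin n)} {l : List ℕ} (hl : IsWord w l)
    (hl' : l.length = len w) : (Tw w : AK n q Q) = (l.map T).prod :=
  braided_T.prod_eq (isWord_reducedWord w) hl (length_reducedWord w) hl'

@[simp] theorem Tw_one : (Tw 1 : AK n q Q) = 1 :=
  Tw_eq_prod (l := []) ⟨by simp, rfl⟩ (by simp)

theorem Tw_mul {x y : Equiv.Perm (Fin n)} (h : len (x * y) = len x + len y) :
    (Tw (x * y) : AK n q Q) = Tw x * Tw y := by
  rw [Tw_eq_prod ((isWord_reducedWord x).append (isWord_reducedWord y))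
    (by rw [List.length_append, length_reducedWord, length_reducedWord, h])]
  simp [Tw]

theorem isWord_s {i : ℕ} (h1 : 1 ≤ i) (h : i < n) : IsWord (s n i) [i] := by
  refine ⟨by simp [h1, h], by simp⟩

theorem asc_one {i : ℕ} (h1 : 1 ≤ i) (h : i < n) : Asc (1 : Equiv.Perm (Fin n)) i :=
  ⟨h, by simp [Fin.lt_def]; omega⟩

theorem len_s {i : ℕ} (h1 : 1 ≤ i) (h : i < n) : len (s n i) = 1 := by
  simpa using len_of_asc h1 (asc_one h1 h)

theorem Tw_s {i : ℕ} (h1 : 1 ≤ i) (h : i < n) : (Tw (s n i) : AK n q Q) = T i := by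
  rw [Tw_eq_prod (isWord_s h1 h) (by simp [len_s h1 h])]; simp

theorem T_mul_Tw_of_asc {w : Equiv.Perm (Fin n)} {i : ℕ} (h1 : 1 ≤ i) (h : i < n)
    (hw : Asc w i) : (T i * Tw w : AK n q Q) = Tw (s n i * w) := by
  rw [Tw_mul (by rw [len_of_asc h1 hw, len_s h1 h, add_comm]), Tw_s h1 h]

theorem T_mul_Tw_of_not_asc {w : Equiv.Perm (Fin n)} {i : ℕ} (h1 : 1 ≤ i) (h : i < n)
    (hw : ¬ Asc w i) :
    (T i * Tw w : AK n q Q) = (q : R) • Tw (s n i * w) + ((q : R) - 1) • Tw w := by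
  have e : (Tw w : AK n q Q) = T i * Tw (s n i * w) := by
    rw [T_mul_Tw_of_asc h1 h ((asc_s_mul h1 h).2 hw), s_mul_cancel]
  conv_lhs => rw [e, ← mul_assoc, T_mul_self h1 h]
  rw [add_mul, smul_mul_assoc, smul_mul_assoc, one_mul, ← e, add_comm]

theorem Tw_mul_T_of_len {w : Equiv.Perm (Fin n)} {i : ℕ} (h1 : 1 ≤ i) (h : i < n)
    (hw : len (w * s n i) = len w + 1) : (Tw w * T i : AK n q Q) = Tw (w * s n i) := by
  rw [Tw_mul (by rw [hw, len_s h1 h]), Tw_s h1 h]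

/-! ### Jucys–Murphy elements -/

theorem unit_smul_cancel {A : Type*} [AddCommGroup A] [Module R A] {x y : A}
    (h : (q : R) • x = (q : R) • y) : x = y := by
  simpa [smul_smul] using congrArg (((q⁻¹ : Rˣ) : R) • ·) h

theorem L_succ {k : ℕ} (hk : 1 ≤ k) :
    (L (k + 1) : AK n q Q) = ((q⁻¹ : Rˣ) : R) • (T k * L k * T k) := by
  obtain ⟨k, rfl⟩ := Nat.exists_eq_add_of_le' hk
  rfl

theorem L_one : (L 1 : AK n q Q) = T 0 := rfl

theorem T_L_T {k : ℕ} (hk : 1 ≤ k) :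
    (T k * L k * T k : AK n q Q) = (q : R) • L (k + 1) := by
  rw [L_succ hk, smul_smul]; simp

theorem T_comm' {i j : ℕ} (hij : i + 1 < j ∨ j + 1 < i) (hi : i < n) (hj : j < n) :
    Commute (T i : AK n q Q) (T j) := by
  rcases hij with h | h
  exacts [T_comm h hj, (T_comm h hi).symm]

theorem T_comm_L_of_lt {i k : ℕ} (hk : 1 ≤ k) (hi : k < i) (h : i < n) :
    Commute (T i : AK n q Q) (L k) := by
  induction k, hk using Nat.le_induction with
  | base => exact T_comm' (Or.inr (by omega)) h (by omega)
  | succ k hk ih =>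
    rw [L_succ hk]
    have h1 : Commute (T i : AK n q Q) (T k) := T_comm' (Or.inr (by omega)) h (by omega)
    exact ((h1.mul_right (ih (by omega))).mul_right h1).smul_right _

/-- All the content is in k = i+2. For i = 0 this is the braid relation of length four. For i ≥ 1,
expand L_{i+2} twice: the length-three braid relation turns T_i into T_{i+1}, which passes L_i, and
then back into T_i. -/
theorem T_comm_L_of_gt {i k : ℕ} (hi : i + 1 < k) (hk : k ≤ n) :
    Commute (T i : AK n q Q) (L k) := by
  induction k, hi using Nat.le_induction with
  | base =>
    show Commute _ (L (i + 2))
    rw [L_succ (by omega)]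
    refine Commute.smul_right ?_ _
    rcases Nat.eq_zero_or_pos i with rfl | h1
    · have := T_braid_four (q := q) (Q := Q) (n := n) (by omega)
      show _ * _ = _ * _
      simpa only [zero_add, L_one, mul_assoc] using this
    · rw [L_succ h1]
      simp only [mul_smul_comm, smul_mul_assoc]
      refine Commute.smul_right ?_ _
      have b := T_braid (q := q) (Q := Q) h1 (by omega : i + 1 < n)
      have c := (T_comm_L_of_lt (q := q) (Q := Q) h1 (by omega) (by omega : i + 1 < n)).eq
      show _ * _ = _ * _
      calc T i * (T (i + 1) * (T i * L i * T i) * T (i + 1))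
          = (T i * T (i + 1) * T i) * L i * T i * T (i + 1) := by simp only [mul_assoc]
        _ = T (i + 1) * T i * (T (i + 1) * L i) * T i * T (i + 1) := by
          rw [b]; simp only [mul_assoc]
        _ = T (i + 1) * T i * L i * (T (i + 1) * T i * T (i + 1)) := by
          rw [c]; simp only [mul_assoc]
        _ = _ := by rw [← b]; simp only [mul_assoc]
  | succ k hk' ih =>
    have hk' : i + 1 < k := hk'
    rw [L_succ (by omega)]
    have h1 : Commute (T i : AK n q Q) (T k) := T_comm' (Or.inl (by omega)) (by omega) (by omega)
    exact ((h1.mul_right (ih (by omega))).mul_right h1).smul_right _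

theorem L_comm_of_T {k m : ℕ} (hm : 1 ≤ m) {x : AK n q Q} (h : ∀ i < m, Commute (T i) x)
    (hk : 1 ≤ k) (hkm : k ≤ m) : Commute (L k) x := by
  induction k, hk using Nat.le_induction with
  | base => exact h 0 (by omega)
  | succ k hk ih =>
    rw [L_succ hk]
    have := h k (by omega)
    exact ((this.mul_left (ih (by omega))).mul_left this).smul_left _

/-- For j < k, the element L_j is built from T_0,…,T_{j-1}, and each of these commutes with L_k. -/
theorem L_comm {j k : ℕ} (hj : 1 ≤ j) (hjn : j ≤ n) (hk : 1 ≤ k) (hkn : k ≤ n) :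
    Commute (L j : AK n q Q) (L k) := by
  rcases lt_trichotomy j k with h | rfl | h
  · exact L_comm_of_T hj (fun i hi => T_comm_L_of_gt (by omega) hkn) hj le_rfl
  · exact Commute.refl _
  · exact (L_comm_of_T hk (fun i hi => T_comm_L_of_gt (by omega) hjn) hk le_rfl).symm

theorem T_comm_L {i k : ℕ} (hi : i < n) (h1 : 1 ≤ k) (hk : k ≤ n) (h : k ≠ i) (h' : k ≠ i + 1) :
    Commute (T i : AK n q Q) (L k) := by
  rcases lt_or_gt_of_ne h with h | h
  · exact T_comm_L_of_lt h1 h hi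
  · exact T_comm_L_of_gt (by omega) hk

/-- Multiply T_i L_i T_i = q L_{i+1} by T_i and use the quadratic relation; q can be cancelled.
Together with the next lemma these are the Bernstein relations. -/
theorem T_mul_L {i : ℕ} (h1 : 1 ≤ i) (hi : i < n) :
    (T i * L i : AK n q Q) = L (i + 1) * T i - ((q : R) - 1) • L (i + 1) := by
  refine unit_smul_cancel (q := q) ?_
  have e := T_L_T (q := q) (Q := Q) (n := n) h1
  have := congrArg (· * T i) e
  simp only [mul_assoc] at this
  rw [T_mul_self h1 hi] at this
  simp only [mul_add, mul_smul_comm, mul_one, smul_mul_assoc, ← mul_assoc] at this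
  rw [e] at this
  rw [smul_sub, ← this, smul_comm (q : R) ((q : R) - 1)]
  abel

theorem T_mul_L_succ {i : ℕ} (h1 : 1 ≤ i) (hi : i < n) :
    (T i * L (i + 1) : AK n q Q) = L i * T i + ((q : R) - 1) • L (i + 1) := by
  refine unit_smul_cancel (q := q) ?_
  rw [← mul_smul_comm, ← T_L_T h1, mul_assoc (T i), ← mul_assoc (T i) (T i), T_mul_self h1 hi,
    add_mul, smul_mul_assoc, smul_mul_assoc, one_mul, ← mul_assoc, T_L_T h1, smul_add, add_comm,
    smul_comm]

end Relations

end CycHecke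

open scoped TensorProduct
namespace CycHecke

/-! ### Polynomials in the Jucys–Murphy elements -/

section JucysMurphy

variable {R : Type*} [CommRing R] {n r : ℕ} {q : Rˣ} {Q : Fin r → R}

/-- The correction is c·y times the divided difference (x^a y^b - x^b y^a)/(x - y). Writing it as a
difference of two sums avoids a case distinction on the order of a and b. -/
theorem bernstein_pow {A : Type*} [Ring A] [Algebra R A] {t x y : A} {c : R}
    (hxy : Commute x y) (hx : t * x = y * t - c • y) (hy : t * y = x * t + c • y) (a b : ℕ) :
    t * (x ^ a * y ^ b) = x ^ b * y ^ a * t -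
      c • (∑ j ∈ Finset.range a, x ^ j * y ^ (a + b - j) -
        ∑ j ∈ Finset.range b, x ^ j * y ^ (a + b - j)) := by
  induction a with
  | zero =>
    induction b with
    | zero => simp
    | succ b ih =>
      simp only [pow_zero, one_mul, zero_add, mul_one, Finset.range_zero, Finset.sum_empty,
        zero_sub, smul_neg, sub_neg_eq_add] at ih ⊢
      rw [pow_succ', ← mul_assoc, hy, add_mul, mul_assoc, ih, Finset.sum_range_succ', mul_add,
        mul_smul_comm, Finset.mul_sum, pow_succ', ← mul_assoc, smul_mul_assoc, smul_add,
        pow_zero, one_mul, Nat.sub_zero, pow_succ', add_assoc]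
      congr 3
      refine Finset.sum_congr rfl fun j hj => ?_
      rw [← mul_assoc, ← pow_succ', Nat.add_sub_add_right]
  | succ a ih =>
    rw [pow_succ', mul_assoc, ← mul_assoc, hx, sub_mul, mul_assoc, ih, Finset.sum_range_succ,
      mul_sub, mul_smul_comm, mul_sub, Finset.mul_sum, Finset.mul_sum]
    have e1 : ∀ i k, y * (x ^ i * y ^ k) = x ^ i * y ^ (k + 1) := fun i k => by
      rw [← mul_assoc, (hxy.symm.pow_right i).eq, mul_assoc, pow_succ']
    have e2 : ∀ m ≤ a + b, ∑ i ∈ Finset.range m, y * (x ^ i * y ^ (a + b - i)) =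
        ∑ i ∈ Finset.range m, x ^ i * y ^ (a + 1 + b - i) := fun m hm =>
      Finset.sum_congr rfl fun i hi => by
        rw [Finset.mem_range] at hi
        rw [e1]; congr 2; omega
    rw [e2 a (by omega), e2 b (by omega), smul_mul_assoc, e1, ← mul_assoc y, e1,
      show a + 1 + b - a = b + 1 by omega]
    simp only [smul_sub, smul_add]
    abel

/-- Polynomials can be evaluated at commuting elements of an algebra. -/
theorem exists_aeval_of_commute {σ A : Type*} [Ring A] [Algebra R A] (f : σ → A)
    (hf : ∀ i j, f i * f j = f j * f i) :
    ∃ φ : MvPolynomial σ R →ₐ[R] A, ∀ i, φ (MvPolynomial.X i) = f i := by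
  have hc : ∀ a ∈ Set.range f, ∀ b ∈ Set.range f, a * b = b * a := by
    rintro _ ⟨i, rfl⟩ _ ⟨j, rfl⟩; exact hf i j
  let _ : CommRing (Algebra.adjoin R (Set.range f)) :=
    { (inferInstance : Ring (Algebra.adjoin R (Set.range f))) with
      mul_comm := (Algebra.isMulCommutative_adjoin R hc).is_comm.comm }
  exact ⟨(Algebra.adjoin R (Set.range f)).val.comp
    (MvPolynomial.aeval fun i => ⟨f i, Algebra.subset_adjoin ⟨i, rfl⟩⟩), fun i => by simp⟩

/-- Evaluation of polynomials at the Jucys–Murphy elements. -/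
noncomputable def evL : MvPolynomial (Fin n) R →ₐ[R] AK n q Q :=
  (exists_aeval_of_commute (fun j : Fin n => (L (j + 1) : AK n q Q))
    fun j k => L_comm (by omega) (by omega) (by omega) (by omega)).choose

@[simp] theorem evL_X (j : Fin n) : evL (MvPolynomial.X j) = (L (j + 1) : AK n q Q) :=
  (exists_aeval_of_commute (fun j : Fin n => (L (j + 1) : AK n q Q))
    fun j k => L_comm (by omega) (by omega) (by omega) (by omega)).choose_spec j

/-- The monomial with given exponents. -/
noncomputable def mon (R : Type*) [CommRing R] (ν : Fin n → ℕ) : MvPolynomial (Fin n) R :=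
  ∏ j, MvPolynomial.X j ^ ν j

theorem Lmon_eq {m c : ℕ} (h : c + m ≤ n) (a : Fin m → ℕ) :
    (Lmon c a : AK n q Q) =
      evL (∏ j : Fin m, MvPolynomial.X ⟨c + j, by omega⟩ ^ a j) := by
  rw [Lmon, ← List.prod_ofFn, map_list_prod, List.map_ofFn]
  congr 2
  funext j
  simp

theorem Lmon_zero_eq (ν : Fin n → ℕ) : (Lmon 0 ν : AK n q Q) = evL (mon R ν) := by
  rw [Lmon_eq (by omega)]
  simp [mon]

theorem mon_update (ν : Fin n → ℕ) (a b : Fin n) (hab : a ≠ b) (j k : ℕ) :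
    mon R (Function.update (Function.update ν a j) b k) =
      (MvPolynomial.X a ^ j * MvPolynomial.X b ^ k) *
        ∏ l ∈ {a, b}ᶜ, MvPolynomial.X l ^ ν l := by
  rw [mon, ← Finset.prod_mul_prod_compl {a, b}, Finset.prod_pair hab]
  congr 1
  · simp [Function.update_of_ne hab]
  · refine Finset.prod_congr rfl fun l hl => ?_
    simp only [Finset.mem_compl, Finset.mem_insert, Finset.mem_singleton, not_or] at hl
    rw [Function.update_of_ne hl.2, Function.update_of_ne hl.1]

theorem mon_eq_pair (ν : Fin n → ℕ) (a b : Fin n) (hab : a ≠ b) :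
    mon R ν = (MvPolynomial.X a ^ ν a * MvPolynomial.X b ^ ν b) *
        ∏ l ∈ {a, b}ᶜ, MvPolynomial.X l ^ ν l := by
  rw [← mon_update ν a b hab]; simp

theorem T_comm_evL_prod {i : ℕ} (hi : i < n) (s : Finset (Fin n)) (ν : Fin n → ℕ)
    (hs : ∀ l ∈ s, l.val + 1 ≠ i ∧ l.val ≠ i) :
    Commute (T i : AK n q Q) (evL (∏ l ∈ s, MvPolynomial.X l ^ ν l)) := by
  induction s using Finset.induction_on with
  | empty => simp
  | insert l s hl ih =>
    rw [Finset.prod_insert hl, map_mul, map_pow, evL_X]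
    refine Commute.mul_right (Commute.pow_right ?_ _)
      (ih fun l h => hs l (Finset.mem_insert_of_mem h))
    have := hs l (Finset.mem_insert_self _ _)
    exact T_comm_L hi (by omega) (by omega) (by omega) (by omega)

/-- The exponent vectors with entries `< r` that vanish from position `a` on. -/
def box (n r a : ℕ) : Set (Fin n → ℕ) := {ν | (∀ j, ν j < r) ∧ ∀ j : Fin n, a ≤ j → ν j = 0}

/-- The exponents `ν`, with those at the letters `i, i+1` replaced by `j` and by
the number that keeps the sum. -/
def redistribute (ν : Fin n → ℕ) (a b : Fin n) (j : ℕ) : Fin n → ℕ :=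
  Function.update (Function.update ν a j) b (ν a + ν b - j)

theorem T_mul_evL_mon {i : ℕ} (h1 : 1 ≤ i) (hi : i < n) (ν : Fin n → ℕ) (a b : Fin n)
    (ha : a = ⟨i - 1, by omega⟩) (hb : b = ⟨i, hi⟩) :
    (T i * evL (mon R ν) : AK n q Q) = evL (mon R (ν ∘ s n i)) * T i -
      ((q : R) - 1) • (∑ j ∈ Finset.range (ν a), evL (mon R (redistribute ν a b j)) -
        ∑ j ∈ Finset.range (ν b), evL (mon R (redistribute ν a b j))) := by
  have hab : a ≠ b := by subst ha hb; simp; omega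
  have e : ν ∘ s n i = Function.update (Function.update ν a (ν b)) b (ν a) := by
    funext l
    rw [s_eq hi, ← ha, ← hb, Function.comp_apply, Equiv.swap_apply_def]
    by_cases hla : l = a
    · subst hla; simp [hab]
    · by_cases hlb : l = b
      · subst hlb; simp [hla]
      · simp [hla, hlb]
  rw [e, mon_update _ _ _ hab, mon_eq_pair ν a b hab]
  simp only [redistribute, mon_update _ _ _ hab]
  have hc := T_comm_evL_prod (q := q) (Q := Q) hi {a, b}ᶜ ν (fun l hl => by
    subst ha hb
    simp only [Finset.mem_compl, Finset.mem_insert, Finset.mem_singleton, not_or,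
      Fin.ext_iff] at hl
    omega)
  simp only [map_mul, map_pow, evL_X]
  have ha' : a.val + 1 = i := by subst ha; simp; omega
  have hb' : b.val + 1 = i + 1 := by subst hb; simp
  rw [ha', hb', ← mul_assoc, bernstein_pow (L_comm h1 (by omega) (by omega) (by omega))
    (T_mul_L h1 hi) (T_mul_L_succ h1 hi), sub_mul, mul_assoc _ (T i), hc.eq, ← mul_assoc,
    smul_mul_assoc, sub_mul, Finset.sum_mul, Finset.sum_mul]

/-- For j between the two old exponents, the complementary exponent ν a + ν b - j lies between them
as well, so no bound is exceeded. -/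
theorem redistribute_mem_box {r a' : ℕ} {ν : Fin n → ℕ} (hν : ν ∈ box n r a') {a b : Fin n}
    (ha : a.val < a') (hb : b.val < a') {j : ℕ}
    (hj : (ν a ≤ j ∧ j ≤ ν b) ∨ (ν b ≤ j ∧ j ≤ ν a)) : redistribute ν a b j ∈ box n r a' := by
  have h1 := hν.1 a
  have h2 := hν.1 b
  have e : ∀ l, redistribute ν a b j l = if l = b then ν a + ν b - j else if l = a then j else ν l :=
    fun l => by simp [redistribute, Function.update_apply]
  refine ⟨fun l => ?_, fun l hl => ?_⟩
  · rw [e]; split_ifs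
    · omega
    · omega
    · exact hν.1 l
  · rw [e, if_neg (by rintro rfl; omega), if_neg (by rintro rfl; omega)]
    exact hν.2 l hl

theorem comp_s_mem_box {r a i : ℕ} {ν : Fin n → ℕ} (hν : ν ∈ box n r a) (h1 : 1 ≤ i) (hi : i < a)
    (ha : a ≤ n) : ν ∘ s n i ∈ box n r a := by
  refine ⟨fun j => hν.1 _, fun j hj => hν.2 _ ?_⟩
  rw [s_val (by omega)]
  split_ifs <;> omega

/-- After cancellation only exponents j between the two original ones survive in the correction.
Commuting T_i past a monomial therefore never raises exponents beyond the bound, which makes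
truncation compatible with T_i for i ≥ 1. -/
theorem bernstein {a i K : ℕ} (h1 : 1 ≤ i) (hi : i < a) (ha : a ≤ n) {ν : Fin n → ℕ}
    (hν : ν ∈ box n K a) : ∃ Z ∈ Submodule.span R ((fun μ => evL (mon R μ)) '' box n K a),
      (T i * evL (mon R ν) : AK n q Q) = evL (mon R (ν ∘ s n i)) * T i + Z := by
  refine ⟨_, ?_, by rw [T_mul_evL_mon h1 (by omega) ν _ _ rfl rfl, sub_eq_add_neg]⟩
  refine Submodule.neg_mem _ (Submodule.smul_mem _ _ ?_)
  rcases le_total (ν ⟨i - 1, by omega⟩) (ν ⟨i, by omega⟩) with h | h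
  · rw [← neg_sub, ← Finset.sum_Ico_eq_sub _ h]
    refine Submodule.neg_mem _ (Submodule.sum_mem _ fun j hj => Submodule.subset_span ⟨_, ?_, rfl⟩)
    rw [Finset.mem_Ico] at hj
    exact redistribute_mem_box hν (by simp; omega) hi (Or.inl ⟨hj.1, hj.2.le⟩)
  · rw [← Finset.sum_Ico_eq_sub _ h]
    refine Submodule.sum_mem _ fun j hj => Submodule.subset_span ⟨_, ?_, rfl⟩
    rw [Finset.mem_Ico] at hj
    exact redistribute_mem_box hν (by simp; omega) hi (Or.inr ⟨hj.1, hj.2.le⟩)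

theorem bernstein' {a i K : ℕ} (h1 : 1 ≤ i) (hi : i < a) (ha : a ≤ n) {ν : Fin n → ℕ}
    (hν : ν ∈ box n K a) : ∃ Z ∈ Submodule.span R ((fun μ => evL (mon R μ)) '' box n K a),
      (evL (mon R ν) * T i : AK n q Q) = T i * evL (mon R (ν ∘ s n i)) + Z := by
  obtain ⟨Z, hZ, e⟩ := bernstein (q := q) (Q := Q) h1 hi ha (comp_s_mem_box hν h1 hi ha)
  refine ⟨-Z, Submodule.neg_mem _ hZ, ?_⟩
  have : (ν ∘ s n i) ∘ s n i = ν := by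
    rw [Function.comp_assoc, ← Equiv.Perm.coe_mul, s_mul_self]; rfl
  rw [e, this, add_neg_cancel_right]

/-! ### The subalgebra generated by `T_0, …, T_{a-1}` and its spanning set -/

/-- The permutations fixing all letters beyond the first `a`. -/
def fixing (n a : ℕ) : Set (Equiv.Perm (Fin n)) := {x | ∀ j : Fin n, a ≤ j → x j = j}

theorem s_mul_mem_fixing {a i : ℕ} (h1 : 1 ≤ i) (hi : i < a) (ha : a ≤ n)
    {x : Equiv.Perm (Fin n)} (hx : x ∈ fixing n a) : s n i * x ∈ fixing n a := by
  intro j hj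
  rw [Equiv.Perm.mul_apply, hx j hj, Fin.ext_iff, s_val (by omega)]
  split_ifs <;> omega

theorem one_mem_fixing (n a : ℕ) : 1 ∈ fixing n a := fun _ _ => rfl

/-- The span of the elements `L_1^{ν_1} ⋯ L_a^{ν_a} T_x` with exponents `< r` and `x` a permutation
of the first `a` letters. -/
noncomputable def stdSpan (n : ℕ) {r : ℕ} (q : Rˣ) (Q : Fin r → R) (a : ℕ) :
    Submodule R (AK n q Q) :=
  Submodule.span R {y | ∃ ν ∈ box n r a, ∃ x ∈ fixing n a, y = evL (mon R ν) * Tw x}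

theorem T_mul_Tw_mem {i : ℕ} (h1 : 1 ≤ i) (hi : i < n) (x : Equiv.Perm (Fin n)) :
    (T i * Tw x : AK n q Q) ∈ Submodule.span R {Tw (s n i * x), Tw x} := by
  by_cases hx : Asc x i
  · rw [T_mul_Tw_of_asc h1 hi hx]; exact Submodule.subset_span (by simp)
  · rw [T_mul_Tw_of_not_asc h1 hi hx]
    exact Submodule.add_mem _ (Submodule.smul_mem _ _ (Submodule.subset_span (by simp)))
      (Submodule.smul_mem _ _ (Submodule.subset_span (by simp)))

/-- The coefficients of the polynomial `(X - Q_1) ⋯ (X - Q_r)`. -/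
noncomputable def cycCoeff (Q : Fin r → R) (k : ℕ) : R :=
  (∏ j, (Polynomial.X - Polynomial.C (Q j))).coeff k

theorem prod_sub_eq (Q : Fin r → R) {A : Type*} [Ring A] [Algebra R A] (x : A) :
    (List.ofFn fun k => x - algebraMap R A (Q k)).prod =
      x ^ r + ∑ k ∈ Finset.range r, cycCoeff Q k • x ^ k := by
  -- The product of the linear factors has degree r only over a nontrivial ring; over the zero ring
  -- the identity is empty.
  rcases subsingleton_or_nontrivial R with hR | hR
  · exact (Module.subsingleton R A).elim _ _
  set f : Polynomial R := ∏ j, (Polynomial.X - Polynomial.C (Q j)) with hf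
  have hm : f.Monic := Polynomial.monic_prod_of_monic _ _ fun k _ => Polynomial.monic_X_sub_C _
  have hd : f.natDegree = r := by
    rw [hf, Polynomial.natDegree_prod_of_monic _ _ fun k _ => Polynomial.monic_X_sub_C _]
    simp
  have h0 : (List.ofFn fun k => x - algebraMap R A (Q k)).prod = Polynomial.aeval x f := by
    rw [hf, ← List.prod_ofFn, map_list_prod, List.map_ofFn]
    congr 2
    funext k
    simp
  rw [h0, hm.as_sum, hd]
  simp only [map_add, map_pow, Polynomial.aeval_X, map_sum, map_mul, Polynomial.aeval_C]
  congr 1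
  exact Finset.sum_congr rfl fun k _ => (Algebra.smul_def _ _).symm

theorem T_zero_pow (h : 0 < n) : ∃ c : ℕ → R,
    (T 0 ^ r : AK n q Q) = ∑ k ∈ Finset.range r, c k • T 0 ^ k := by
  refine ⟨fun k => - cycCoeff Q k, ?_⟩
  have h0 := T_cyclotomic (q := q) (Q := Q) h
  rw [prod_sub_eq] at h0
  rw [eq_neg_of_add_eq_zero_left h0, ← Finset.sum_neg_distrib]
  exact Finset.sum_congr rfl fun k _ => (neg_smul _ _).symm

theorem span_mon_mul_Tw_mem {a : ℕ} {x : Equiv.Perm (Fin n)} (hx : x ∈ fixing n a) {Z : AK n q Q}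
    (hZ : Z ∈ Submodule.span R ((fun μ => evL (mon R μ)) '' box n r a)) :
    Z * Tw x ∈ stdSpan n q Q a := by
  induction hZ using Submodule.span_induction with
  | zero => rw [zero_mul]; exact Submodule.zero_mem _
  | add u v _ _ hu hv => rw [add_mul]; exact Submodule.add_mem _ hu hv
  | smul c u _ hu => rw [smul_mul_assoc]; exact Submodule.smul_mem _ _ hu
  | mem u hu => obtain ⟨μ, hμ, rfl⟩ := hu; exact Submodule.subset_span ⟨μ, hμ, x, hx, rfl⟩

/-- T_0 = L_1 raises the first exponent, and the cyclotomic relation brings it back below r. For i ≥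
1 the Bernstein relation moves T_i past the monomial, where it is absorbed by T_x. -/
theorem T_mul_mem_stdSpan {a i : ℕ} (hi : i < a) (ha : a ≤ n) {y : AK n q Q}
    (hy : y ∈ stdSpan n q Q a) : T i * y ∈ stdSpan n q Q a := by
  rw [stdSpan] at hy
  induction hy using Submodule.span_induction with
  | zero => rw [mul_zero]; exact Submodule.zero_mem _
  | add x y _ _ hx hy => rw [mul_add]; exact Submodule.add_mem _ hx hy
  | smul c x _ hx => rw [mul_smul_comm]; exact Submodule.smul_mem _ _ hx
  | mem y hy =>
    obtain ⟨ν, hν, x, hx, rfl⟩ := hy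
    rcases Nat.eq_zero_or_pos i with rfl | h1
    · have h0 : 0 < n := by omega
      have key : ∀ k < r, (T 0 ^ k * evL (mon R (Function.update ν ⟨0, h0⟩ 0)) * Tw x : AK n q Q) ∈
          stdSpan n q Q a := fun k hk => by
        refine Submodule.subset_span ⟨Function.update ν ⟨0, h0⟩ k, ⟨fun j => ?_, fun j hj => ?_⟩,
          x, hx, ?_⟩
        · by_cases hj : j = ⟨0, h0⟩
          · subst hj; simpa using hk
          · rw [Function.update_of_ne hj]; exact hν.1 j
        · rw [Function.update_of_ne (by rintro rfl; simp at hj; omega)]; exact hν.2 j hj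
        · congr 1
          have : (T 0 : AK n q Q) = evL (MvPolynomial.X ⟨0, h0⟩) := by rw [evL_X]; rfl
          rw [this, ← map_pow, ← map_mul]
          congr 1
          rw [mon, mon, Fintype.prod_eq_mul_prod_compl ⟨0, h0⟩,
            Fintype.prod_eq_mul_prod_compl ⟨0, h0⟩]
          simp only [Function.update_self, pow_zero, one_mul]
          congr 1
          refine Finset.prod_congr rfl fun j hj => ?_
          rw [Function.update_of_ne (by simpa using hj), Function.update_of_ne (by simpa using hj)]
      have e : (evL (mon R ν) : AK n q Q) =
          T 0 ^ ν ⟨0, h0⟩ * evL (mon R (Function.update ν ⟨0, h0⟩ 0)) := by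
        have : (T 0 : AK n q Q) = evL (MvPolynomial.X ⟨0, h0⟩) := by rw [evL_X]; rfl
        rw [this, ← map_pow, ← map_mul]
        congr 1
        rw [mon, mon, Fintype.prod_eq_mul_prod_compl ⟨0, h0⟩,
          Fintype.prod_eq_mul_prod_compl ⟨0, h0⟩]
        simp only [Function.update_self, pow_zero, one_mul]
        congr 1
        refine Finset.prod_congr rfl fun j hj => ?_
        rw [Function.update_of_ne (by simpa using hj)]
      rw [e, ← mul_assoc, ← mul_assoc, ← pow_succ']
      rcases eq_or_lt_of_le (Nat.succ_le_of_lt (hν.1 ⟨0, h0⟩)) with h | h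
      · obtain ⟨c, hc⟩ := T_zero_pow (n := n) (q := q) (Q := Q) h0
        rw [show ν ⟨0, h0⟩ + 1 = r from h, hc, Finset.sum_mul, Finset.sum_mul]
        refine Submodule.sum_mem _ fun k hk => ?_
        rw [smul_mul_assoc, smul_mul_assoc]
        exact Submodule.smul_mem _ _ (key k (Finset.mem_range.1 hk))
      · exact key _ h
    · obtain ⟨Z, hZ, e⟩ := bernstein (q := q) (Q := Q) h1 hi ha hν
      rw [← mul_assoc, e, add_mul, mul_assoc]
      refine Submodule.add_mem _ ?_ ?_
      · have h2 := T_mul_Tw_mem (q := q) (Q := Q) h1 (by omega : i < n) x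
        rw [Submodule.mem_span_pair] at h2
        obtain ⟨c, d, h2⟩ := h2
        rw [← h2, mul_add, mul_smul_comm, mul_smul_comm]
        have hν' := comp_s_mem_box hν h1 hi ha
        exact Submodule.add_mem _
          (Submodule.smul_mem _ _ (Submodule.subset_span
            ⟨_, hν', _, s_mul_mem_fixing h1 hi ha hx, rfl⟩))
          (Submodule.smul_mem _ _ (Submodule.subset_span ⟨_, hν', _, hx, rfl⟩))
      · exact span_mon_mul_Tw_mem hx hZ

theorem one_mem_stdSpan (hr : 0 < r) (a : ℕ) : (1 : AK n q Q) ∈ stdSpan n q Q a :=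
  Submodule.subset_span ⟨0, ⟨fun _ => hr, fun _ _ => rfl⟩, 1, one_mem_fixing n a, by simp [mon]⟩

/-- The subalgebra generated by `T_0, …, T_{a-1}`. -/
noncomputable def subAK (n : ℕ) {r : ℕ} (q : Rˣ) (Q : Fin r → R) (a : ℕ) :
    Subalgebra R (AK n q Q) := Algebra.adjoin R (T '' Set.Iio a)

theorem mul_mem_stdSpan {a : ℕ} (ha : a ≤ n) {x y : AK n q Q} (hx : x ∈ subAK n q Q a)
    (hy : y ∈ stdSpan n q Q a) : x * y ∈ stdSpan n q Q a := by
  induction hx using Algebra.adjoin_induction generalizing y with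
  | mem x hx => obtain ⟨i, hi, rfl⟩ := hx; exact T_mul_mem_stdSpan hi ha hy
  | algebraMap c => rw [← Algebra.smul_def]; exact Submodule.smul_mem _ _ hy
  | add u v _ _ hu hv => rw [add_mul]; exact Submodule.add_mem _ (hu hy) (hv hy)
  | mul u v _ _ hu hv => rw [mul_assoc]; exact hu (hv hy)

theorem subAK_le_stdSpan (hr : 0 < r) {a : ℕ} (ha : a ≤ n) {x : AK n q Q}
    (hx : x ∈ subAK n q Q a) : x ∈ stdSpan n q Q a := by
  simpa using mul_mem_stdSpan ha hx (one_mem_stdSpan hr a)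

theorem subAK_eq_top : subAK n q Q n = ⊤ := by
  have : subAK n q Q n = (⊤ : Subalgebra R (FreeAlgebra R (Fin n))).map (mkAK n q Q) := by
    rw [← FreeAlgebra.adjoin_range_ι, AlgHom.map_adjoin, subAK, ← Set.range_comp]
    congr 1
    ext y
    simp only [Set.mem_image, Set.mem_Iio, Set.mem_range, Function.comp_apply]
    constructor
    · rintro ⟨i, hi, rfl⟩; exact ⟨⟨i, hi⟩, (T_eq hi).symm⟩
    · rintro ⟨i, rfl⟩; exact ⟨i, i.2, T_eq i.2⟩
  rw [this, Algebra.map_top, AlgHom.range_eq_top]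
  exact RingQuot.mkAlgHom_surjective R _

/-- Ariki–Koike: the standard elements span. -/
theorem span_std (hr : 0 < r) : Submodule.span R
    {y : AK n q Q | ∃ ν : Fin n → ℕ, (∀ j, ν j < r) ∧ ∃ x, y = Lmon 0 ν * Tw x} = ⊤ := by
  refine eq_top_iff.2 fun y _ => ?_
  have hy := subAK_le_stdSpan (q := q) (Q := Q) hr (le_refl n) (x := y) (by
    rw [subAK_eq_top]; trivial)
  refine Submodule.span_mono ?_ hy
  rintro _ ⟨ν, hν, x, -, rfl⟩
  exact ⟨ν, hν.1, x, by rw [Lmon_zero_eq]⟩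

end JucysMurphy

end CycHecke

open scoped TensorProduct
namespace CycHecke

/-! ### The regular representation of the Iwahori–Hecke algebra -/

section Regular

variable {R : Type*} [CommRing R] {n : ℕ} (q : Rˣ)

open Classical in
/-- The action of `T_i` on the free module on the permutations. -/
noncomputable def regT (n : ℕ) (i : ℕ) : Module.End R (Equiv.Perm (Fin n) →₀ R) :=
  Finsupp.lift _ R _ fun w =>
    if Asc w i then Finsupp.single (s n i * w) 1
    else (q : R) • Finsupp.single (s n i * w) 1 + ((q : R) - 1) • Finsupp.single w 1

variable {q}

theorem regT_of_asc {i : ℕ} {w : Equiv.Perm (Fin n)} (h : Asc w i) :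
    regT q n i (Finsupp.single w 1) = Finsupp.single (s n i * w) 1 := by
  rw [regT, Finsupp.lift_apply, Finsupp.sum_single_index (by simp), one_smul, if_pos h]

theorem regT_of_not_asc {i : ℕ} {w : Equiv.Perm (Fin n)} (h : ¬ Asc w i) :
    regT q n i (Finsupp.single w 1) =
      (q : R) • Finsupp.single (s n i * w) 1 + ((q : R) - 1) • Finsupp.single w 1 := by
  rw [regT, Finsupp.lift_apply, Finsupp.sum_single_index (by simp), one_smul, if_neg h]

theorem regT_mul_self {i : ℕ} (h1 : 1 ≤ i) (h : i < n) :
    regT q n i * regT q n i = ((q : R) - 1) • regT q n i + (q : R) • 1 := by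
  refine Finsupp.lhom_ext' fun w => LinearMap.ext_ring ?_
  simp only [LinearMap.comp_apply, Finsupp.lsingle_apply, Module.End.mul_apply,
    LinearMap.add_apply, LinearMap.smul_apply, Module.End.one_apply]
  by_cases hw : Asc w i
  · rw [regT_of_asc hw, regT_of_not_asc (by rwa [asc_s_mul h1 h, not_not]), s_mul_cancel, add_comm]
  · rw [regT_of_not_asc hw, map_add, map_smul, map_smul,
      regT_of_asc ((asc_s_mul h1 h).2 hw), s_mul_cancel, regT_of_not_asc hw, add_comm]

theorem regT_comm {i j : ℕ} (h1 : 1 ≤ i) (hij : i + 1 < j) (hj : j < n) :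
    regT q n i * regT q n j = (regT q n j * regT q n i : Module.End R _) := by
  have hi : i < n := by omega
  have h2 : 1 ≤ j := by omega
  refine Finsupp.lhom_ext' fun w => LinearMap.ext_ring ?_
  simp only [LinearMap.comp_apply, Finsupp.lsingle_apply, Module.End.mul_apply]
  have e1 := asc_s_mul_of_ne (w := w) h1 hi h2 hj (Or.inl hij)
  have e2 := asc_s_mul_of_ne (w := w) h2 hj h1 hi (Or.inr hij)
  have e3 : s n i * (s n j * w) = s n j * (s n i * w) := by
    rw [← mul_assoc, s_comm h1 hi h2 hj (Or.inl hij), mul_assoc]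
  by_cases hi' : Asc w i <;> by_cases hj' : Asc w j
  · rw [regT_of_asc hi', regT_of_asc hj', regT_of_asc (e1.2 hj'), regT_of_asc (e2.2 hi'), e3]
  · rw [regT_of_asc hi', regT_of_not_asc hj', regT_of_not_asc (e1.not.2 hj'), map_add, map_smul,
      map_smul, regT_of_asc (e2.2 hi'), regT_of_asc hi', e3]
  · rw [regT_of_not_asc hi', regT_of_asc hj', regT_of_not_asc (e2.not.2 hi'), map_add, map_smul,
      map_smul, regT_of_asc (e1.2 hj'), regT_of_asc hj', e3]
  · rw [regT_of_not_asc hi', regT_of_not_asc hj', map_add, map_smul, map_smul, map_add, map_smul,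
      map_smul, regT_of_not_asc (e2.not.2 hi'), regT_of_not_asc (e1.not.2 hj'),
      regT_of_not_asc hi', regT_of_not_asc hj', e3]
    module

/-- Bookkeeping for the three values w⁻¹(i), w⁻¹(i+1), w⁻¹(i+2): each ascent condition compares two
of them, and transitivity relates the comparisons. -/
theorem asc_braid {w : Equiv.Perm (Fin n)} {i : ℕ} (h1 : 1 ≤ i) (hi : i + 1 < n) :
    (Asc (s n i * w) (i + 1) ↔ Asc (s n (i + 1) * w) i) ∧
    (Asc (s n i * (s n (i + 1) * w)) (i + 1) ↔ Asc w i) ∧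
    (Asc (s n (i + 1) * (s n i * w)) i ↔ Asc w (i + 1)) ∧
    (Asc w i → Asc w (i + 1) → Asc (s n i * w) (i + 1)) ∧
    (¬ Asc w i → ¬ Asc w (i + 1) → ¬ Asc (s n i * w) (i + 1)) := by
  have hi' : i < n := by omega
  have e1 : s n i ⟨i - 1, by omega⟩ = ⟨i, hi'⟩ := by
    apply Fin.ext; rw [s_val hi']; simp
  have e2 : s n i ⟨i, hi'⟩ = ⟨i - 1, by omega⟩ := by
    apply Fin.ext; rw [s_val hi']; simp
  have e3 : s n i ⟨i + 1, hi⟩ = ⟨i + 1, hi⟩ := by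
    apply Fin.ext; rw [s_val hi']; simp only; split_ifs <;> omega
  have e4 : s n (i + 1) ⟨i - 1, by omega⟩ = ⟨i - 1, by omega⟩ := by
    apply Fin.ext; rw [s_val hi]; simp only; split_ifs <;> omega
  have e5 : s n (i + 1) ⟨i, hi'⟩ = ⟨i + 1, hi⟩ := by
    apply Fin.ext; rw [s_val hi]; simp
  have e6 : s n (i + 1) ⟨i + 1, hi⟩ = ⟨i, hi'⟩ := by
    apply Fin.ext; rw [s_val hi]; simp
  simp only [Asc, hi, hi', exists_true_left, mul_inv_rev, s_inv, Equiv.Perm.mul_apply,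
    Nat.add_sub_cancel, e1, e2, e3, e4, e5, e6, not_lt, true_and]
  exact ⟨fun h h' => h.trans h', fun h h' => h'.trans h⟩

theorem regT_braid {i : ℕ} (h1 : 1 ≤ i) (hi : i + 1 < n) :
    regT q n i * regT q n (i + 1) * regT q n i =
      (regT q n (i + 1) * regT q n i * regT q n (i + 1) : Module.End R _) := by
  have hi' : i < n := by omega
  refine Finsupp.lhom_ext' fun w => LinearMap.ext_ring ?_
  simp only [LinearMap.comp_apply, Finsupp.lsingle_apply, Module.End.mul_apply]
  obtain ⟨a1, a2, a3, a4, a5⟩ := asc_braid (w := w) h1 hi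
  have b1 := asc_s_mul (w := w) h1 hi'
  have b2 := asc_s_mul (w := w) (i := i + 1) (by omega) hi
  have e : s n i * (s n (i + 1) * (s n i * w)) = s n (i + 1) * (s n i * (s n (i + 1) * w)) := by
    simpa only [mul_assoc] using congrArg (· * w) (s_braid h1 hi)
  have as := fun (j : ℕ) (v : Equiv.Perm (Fin n)) => regT_of_asc (q := q) (i := j) (w := v)
  have na := fun (j : ℕ) (v : Equiv.Perm (Fin n)) => regT_of_not_asc (q := q) (i := j) (w := v)
  -- The three ascent conditions fix the relative order of three values. Two of the eight sign
  -- patterns violate transitivity; in the other six both sides are computed outright.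
  by_cases p1 : Asc w i <;> by_cases p2 : Asc w (i + 1) <;>
    by_cases p3 : Asc (s n i * w) (i + 1) <;>
    first
    | exact absurd (a4 p1 p2) p3
    | exact absurd p3 (a5 p1 p2)
    | (have p3' := p3
       have p1' := p1
       have p2' := p2
       rw [a1] at p3'
       rw [← a2] at p1'
       rw [← a3] at p2'
       simp only [p1, p2, p3, p3', p1', p2', as, na, map_add, map_smul, b1, b2, not_true,
         not_false_iff, s_mul_cancel, e]
       try module)

theorem braided_regT : Braided n (regT q n : ℕ → Module.End R (Equiv.Perm (Fin n) →₀ R)) :=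
  ⟨fun _ _ h1 hij hj => regT_comm h1 hij hj, fun _ h1 hi => regT_braid h1 hi⟩

/-- The action of `T_w` on the regular representation. -/
noncomputable def regTw (q : Rˣ) (w : Equiv.Perm (Fin n)) :
    Module.End R (Equiv.Perm (Fin n) →₀ R) := ((reducedWord w).map (regT q n)).prod

theorem regTw_one : regTw q (1 : Equiv.Perm (Fin n)) = 1 :=
  braided_regT.prod_eq (isWord_reducedWord 1) (k := []) ⟨by simp, rfl⟩ (length_reducedWord 1)
    (by simp)

theorem regTw_s_mul {w : Equiv.Perm (Fin n)} {i : ℕ} (h1 : 1 ≤ i) (h : i < n) (hw : Asc w i) :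
    regTw q (s n i * w) = regT q n i * regTw q w := by
  rw [regTw, braided_regT.prod_eq (isWord_reducedWord _) ((isWord_reducedWord w).cons h1 h)
    (length_reducedWord _) (by simp [length_reducedWord, len_of_asc h1 hw])]
  simp [regTw]

theorem regTw_single_one (w : Equiv.Perm (Fin n)) :
    regTw q w (Finsupp.single 1 1) = Finsupp.single w 1 := by
  induction w using perm_induction with
  | one => rw [regTw_one]; rfl
  | mul w i h1 h hw ih =>
    rw [regTw_s_mul h1 h hw, Module.End.mul_apply, ih, regT_of_asc hw]

-- The symmetrizing trace of the Iwahori–Hecke algebra: the coefficient of T_1 in T_x T_y. It will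
-- supply the power q^{ℓ(x)} in the canonical trace.
open Classical in
theorem regTw_single_apply_one (x y : Equiv.Perm (Fin n)) :
    regTw q x (Finsupp.single y 1) 1 = if x = y⁻¹ then (q : R) ^ len x else 0 := by
  -- Induction on x⁻¹ removes the last letter of x, the one that acts first on the basis vector y.
  generalize hx : x⁻¹ = z
  obtain rfl : x = z⁻¹ := by rw [← hx, inv_inv]
  clear hx
  simp only [inv_inj, len_inv]
  induction z using perm_induction generalizing y with
  | one => simp [regTw_one, Finsupp.single_apply, eq_comm]
  | mul z i h1 h hz ih =>
    have hword : IsWord (s n i * z)⁻¹ (reducedWord z⁻¹ ++ [i]) := by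
      rw [mul_inv_rev, s_inv]; exact (isWord_reducedWord z⁻¹).append (isWord_s h1 h)
    have e : regTw q (s n i * z)⁻¹ = (regTw q z⁻¹ * regT q n i : Module.End R _) := by
      rw [regTw, braided_regT.prod_eq (isWord_reducedWord _) hword (length_reducedWord _)
        (by rw [List.length_append, length_reducedWord, len_inv, len_inv, len_of_asc h1 hz]; rfl)]
      simp [regTw]
    rw [e, Module.End.mul_apply, len_of_asc h1 hz]
    by_cases hy : Asc y i
    · have h2 : s n i * z ≠ y := fun e => by
        rw [← e, asc_s_mul h1 h] at hy; exact hy hz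
      have h3 : z ≠ s n i * y := fun e => h2 (by rw [e, s_mul_cancel])
      rw [regT_of_asc hy, ih, if_neg h2, if_neg h3]
    · have h2 : z ≠ y := fun e => hy (e ▸ hz)
      have h3 : z = s n i * y ↔ s n i * z = y :=
        ⟨fun e => by rw [e, s_mul_cancel], fun e => by rw [← e, s_mul_cancel]⟩
      rw [regT_of_not_asc hy, map_add, map_smul, map_smul, Finsupp.add_apply, Finsupp.smul_apply,
        Finsupp.smul_apply, ih, ih, if_neg h2]
      simp only [h3]
      split_ifs <;> simp [pow_succ']

end Regular

end CycHecke

open scoped TensorProduct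
namespace CycHecke

/-! ### The affine Hecke action on polynomials with coefficients in a module -/

section Affine

variable {R : Type*} [CommRing R] {n : ℕ} {W : Type*} [AddCommGroup W] [Module R W]

/-- Multiplication by a variable on `W`-valued polynomials. -/
noncomputable def mulX (a : Fin n) : Module.End R ((Fin n → ℕ) →₀ W) :=
  Finsupp.lmapDomain W R (· + Pi.single a 1)

theorem mulX_single (a : Fin n) (ν : Fin n → ℕ) (h : W) :
    mulX (R := R) a (Finsupp.single ν h) = Finsupp.single (ν + Pi.single a 1) h := by
  simp [mulX]

theorem mulX_comm (a b : Fin n) : (mulX a * mulX b : Module.End R ((Fin n → ℕ) →₀ W)) =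
    mulX b * mulX a := by
  refine Finsupp.lhom_ext fun ν h => ?_
  simp only [Module.End.mul_apply, mulX_single, add_right_comm]

/-- The operator `T_i` for the adjacent letters `a, b`, in terms of its action `t` on `W`. -/
noncomputable def affT (c : R) (a b : Fin n) (t : Module.End R W) :
    Module.End R ((Fin n → ℕ) →₀ W) :=
  Finsupp.lsum R fun ν => (Finsupp.lsingle (ν ∘ Equiv.swap a b)).comp t -
    c • (∑ j ∈ Finset.range (ν a), Finsupp.lsingle (redistribute ν a b j) -
      ∑ j ∈ Finset.range (ν b), Finsupp.lsingle (redistribute ν a b j))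

theorem affT_single (c : R) (a b : Fin n) (t : Module.End R W) (ν : Fin n → ℕ) (h : W) :
    affT c a b t (Finsupp.single ν h) = Finsupp.single (ν ∘ Equiv.swap a b) (t h) -
      c • (∑ j ∈ Finset.range (ν a), Finsupp.single (redistribute ν a b j) h -
        ∑ j ∈ Finset.range (ν b), Finsupp.single (redistribute ν a b j) h) := by
  simp [affT, LinearMap.sum_apply]

theorem redistribute_add_left {ν : Fin n → ℕ} {a b : Fin n} (hab : a ≠ b) {j : ℕ}
    (hj : j ≤ ν a + ν b) :
    redistribute (ν + Pi.single a 1) a b j = redistribute ν a b j + Pi.single b 1 := by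
  funext l
  simp only [redistribute, Pi.add_apply, Pi.single_apply, Function.update_apply, if_true,
    if_neg hab, if_neg hab.symm]
  split_ifs <;> (simp_all; try omega)

theorem redistribute_add_right {ν : Fin n → ℕ} {a b : Fin n} (hab : a ≠ b) {j : ℕ}
    (hj : j ≤ ν a + ν b) :
    redistribute (ν + Pi.single b 1) a b j = redistribute ν a b j + Pi.single b 1 := by
  funext l
  simp only [redistribute, Pi.add_apply, Pi.single_apply, Function.update_apply, if_true,
    if_neg hab, if_neg hab.symm]
  split_ifs <;> (simp_all; try omega)

theorem redistribute_succ {ν : Fin n → ℕ} {a b : Fin n} (hab : a ≠ b) {j : ℕ}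
    (hj : j < ν a + ν b) :
    redistribute ν a b j + Pi.single a 1 = redistribute ν a b (j + 1) + Pi.single b 1 := by
  funext l
  simp only [redistribute, Pi.add_apply, Pi.single_apply, Function.update_apply, if_true,
    if_neg hab, if_neg hab.symm]
  split_ifs <;> (simp_all; try omega)

theorem redistribute_self {ν : Fin n → ℕ} {a b : Fin n} : redistribute ν a b (ν a) = ν := by
  simp [redistribute]

theorem redistribute_other {ν : Fin n → ℕ} {a b c : Fin n} (ha : c ≠ a) (hb : c ≠ b) (j : ℕ) :
    redistribute (ν + Pi.single c 1) a b j = redistribute ν a b j + Pi.single c 1 := by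
  funext l
  simp only [redistribute, Pi.add_apply, Pi.single_apply, Function.update_apply, if_neg ha.symm,
    if_neg hb.symm]
  split_ifs <;> simp_all

theorem single_comp_swap (a b c : Fin n) : (Pi.single c 1 : Fin n → ℕ) ∘ Equiv.swap a b =
    Pi.single (Equiv.swap a b c) 1 := by
  funext l
  simp only [Function.comp_apply, Pi.single_apply, Equiv.swap_apply_eq_iff]

theorem add_comp_swap (a b c : Fin n) (ν : Fin n → ℕ) : (ν + Pi.single c 1) ∘ Equiv.swap a b =
    ν ∘ Equiv.swap a b + Pi.single (Equiv.swap a b c) 1 := by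
  rw [← single_comp_swap]; rfl

/-- The formula for the operator was copied from `T_mul_evL_mon`, so it satisfies the Bernstein
relations with the variables whatever the action on W is. The relations among the operators
themselves are then deduced from those on W by `end_eq_zero`. -/
theorem affT_mulX_left (c : R) {a b : Fin n} (hab : a ≠ b) (t : Module.End R W) :
    affT c a b t * mulX a = mulX b * affT c a b t - c • mulX b := by
  refine Finsupp.lhom_ext fun ν h => ?_
  simp only [Module.End.mul_apply, mulX_single, LinearMap.sub_apply, LinearMap.smul_apply,
    affT_single, map_sub, map_smul, map_sum, add_comp_swap, Equiv.swap_apply_left]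
  have e1 : (ν + Pi.single a 1 : Fin n → ℕ) a = ν a + 1 := by simp
  have e2 : (ν + Pi.single a 1 : Fin n → ℕ) b = ν b := by simp [hab]
  rw [e1, e2, Finset.sum_range_succ]
  have e : ∀ m ≤ ν a + ν b + 1, ∑ j ∈ Finset.range m,
        Finsupp.single (redistribute (ν + Pi.single a 1) a b j) h =
      ∑ j ∈ Finset.range m, Finsupp.single (redistribute ν a b j + Pi.single b 1) h :=
    fun m hm => Finset.sum_congr rfl fun j hj => by
      rw [Finset.mem_range] at hj; rw [redistribute_add_left hab (by omega)]
  rw [e _ (by omega), e _ (by omega), redistribute_add_left hab (by omega), redistribute_self]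
  module

theorem affT_mulX_right (c : R) {a b : Fin n} (hab : a ≠ b) (t : Module.End R W) :
    affT c a b t * mulX b = mulX a * affT c a b t + c • mulX b := by
  refine Finsupp.lhom_ext fun ν h => ?_
  simp only [Module.End.mul_apply, mulX_single, LinearMap.add_apply, LinearMap.smul_apply,
    affT_single, map_sub, map_smul, map_sum, add_comp_swap, Equiv.swap_apply_right]
  have e1 : (ν + Pi.single b 1 : Fin n → ℕ) a = ν a := by simp [hab.symm]
  have e2 : (ν + Pi.single b 1 : Fin n → ℕ) b = ν b + 1 := by simp
  rw [e1, e2]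
  have e : ∀ m ≤ ν a + ν b + 1, ∑ j ∈ Finset.range m,
        Finsupp.single (redistribute (ν + Pi.single b 1) a b j) h =
      ∑ j ∈ Finset.range m, Finsupp.single (redistribute ν a b j + Pi.single b 1) h :=
    fun m hm => Finset.sum_congr rfl fun j hj => by
      rw [Finset.mem_range] at hj; rw [redistribute_add_right hab (by omega)]
  have e' : ∀ m ≤ ν a + ν b, ∑ j ∈ Finset.range m,
        Finsupp.single (redistribute ν a b j + Pi.single a 1) h =
      ∑ j ∈ Finset.range m, Finsupp.single (redistribute ν a b (j + 1) + Pi.single b 1) h :=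
    fun m hm => Finset.sum_congr rfl fun j hj => by
      rw [Finset.mem_range] at hj; rw [redistribute_succ hab (by omega)]
  rw [e _ (by omega), e _ (by omega), e' _ (by omega), e' _ (by omega)]
  have f := fun m => Finset.sum_range_succ' (fun j => (Finsupp.single (redistribute ν a b j +
    Pi.single b 1) h : (Fin n → ℕ) →₀ W)) m
  have g := fun m => Finset.sum_range_succ (fun j => (Finsupp.single (redistribute ν a b j +
    Pi.single b 1) h : (Fin n → ℕ) →₀ W)) m
  rw [eq_sub_of_add_eq (f (ν a)).symm, eq_sub_of_add_eq (f (ν b)).symm, g (ν a), g (ν b),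
    redistribute_self]
  module

theorem affT_mulX_other (c : R) {a b d : Fin n} (ha : d ≠ a) (hb : d ≠ b) (t : Module.End R W) :
    affT c a b t * mulX d = mulX d * affT c a b t := by
  refine Finsupp.lhom_ext fun ν h => ?_
  simp only [Module.End.mul_apply, mulX_single, affT_single, map_sub, map_smul, map_sum,
    add_comp_swap, Equiv.swap_apply_of_ne_of_ne ha hb, redistribute_other ha hb]
  simp [ha.symm, hb.symm]

theorem affT_single_zero (c : R) (a b : Fin n) (t : Module.End R W) (h : W) :
    affT c a b t (Finsupp.single 0 h) = Finsupp.single 0 (t h) := by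
  simp [affT_single]

/-- An operator vanishing on constants and commuting with the variables up to a permutation of
these is zero. -/
theorem end_eq_zero {B : Module.End R ((Fin n → ℕ) →₀ W)}
    (h0 : ∀ h, B (Finsupp.single 0 h) = 0) (hX : ∀ a, ∃ b, B * mulX a = mulX b * B) : B = 0 := by
  refine Finsupp.lhom_ext fun ν h => ?_
  rw [LinearMap.zero_apply]
  induction hN : ∑ j, ν j generalizing ν with
  | zero =>
    have : ν = 0 := by
      funext j
      simpa using (Finset.sum_eq_zero_iff.1 hN) j (Finset.mem_univ j)
    rw [this, h0]
  | succ N ih =>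
    obtain ⟨a, ha⟩ : ∃ a, ν a ≠ 0 := by
      by_contra hc
      push Not at hc
      simp [hc] at hN
    have e : ν = (ν - Pi.single a 1) + Pi.single a 1 := by
      funext l
      by_cases hl : l = a
      · subst hl; simp; omega
      · simp [hl]
    obtain ⟨b, hb⟩ := hX a
    have hs : ∑ j, (ν - Pi.single a 1 : Fin n → ℕ) j = N := by
      rw [e] at hN
      simp only [Pi.add_apply, Finset.sum_add_distrib] at hN
      simp only [Finset.sum_pi_single', Pi.single_apply] at hN ⊢
      simpa using hN
    rw [e, ← mulX_single (R := R), ← Module.End.mul_apply, hb, Module.End.mul_apply, ih _ hs,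
      map_zero]

end Affine

/-! ### Formal consequences of the Bernstein relations -/

section AffineRelations

variable {R : Type*} [CommRing R] {A : Type*} [Ring A] [Algebra R A]

/-- The defect of the quadratic relation commutes with x. Hence, in the polynomial model, the
relation need only be checked on constants. -/
theorem quad_comm_left {u x y : A} {c k : R} (hx : u * x = y * u - c • y)
    (hy : u * y = x * u + c • y) :
    (u * u - c • u - k • 1) * x = x * (u * u - c • u - k • 1) := by
  have hx' : ∀ z, u * (x * z) = y * (u * z) - c • (y * z) := fun z => by
    rw [← mul_assoc, hx, sub_mul, smul_mul_assoc, mul_assoc]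
  have hy' : ∀ z, u * (y * z) = x * (u * z) + c • (y * z) := fun z => by
    rw [← mul_assoc, hy, add_mul, smul_mul_assoc, mul_assoc]
  simp only [sub_mul, mul_sub, mul_add, smul_mul_assoc, mul_smul_comm, one_mul, mul_one,
    mul_assoc, hx, hy, hx', hy', smul_sub, smul_add]
  module

theorem quad_comm_right {u x y : A} {c k : R} (hx : u * x = y * u - c • y)
    (hy : u * y = x * u + c • y) :
    (u * u - c • u - k • 1) * y = y * (u * u - c • u - k • 1) := by
  have hx' : ∀ z, u * (x * z) = y * (u * z) - c • (y * z) := fun z => by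
    rw [← mul_assoc, hx, sub_mul, smul_mul_assoc, mul_assoc]
  have hy' : ∀ z, u * (y * z) = x * (u * z) + c • (y * z) := fun z => by
    rw [← mul_assoc, hy, add_mul, smul_mul_assoc, mul_assoc]
  simp only [sub_mul, mul_sub, mul_add, smul_mul_assoc, mul_smul_comm, one_mul, mul_one,
    mul_assoc, hx, hy, hx', hy', smul_sub, smul_add]
  module

/-- The defect of the braid relation passes through the three variables while reversing their order,
as the longest element of 𝔖_3 would. Again this leaves only constants to check. -/
theorem braid_comm {u v x y z : A} {c k : R} (hux : u * x = y * u - c • y)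
    (huy : u * y = x * u + c • y) (huz : u * z = z * u) (hvx : v * x = x * v)
    (hvy : v * y = z * v - c • z) (hvz : v * z = y * v + c • z)
    (hu : u * u = c • u + k • 1) (hv : v * v = c • v + k • 1) :
    (u * v * u - v * u * v) * x = z * (u * v * u - v * u * v) ∧
    (u * v * u - v * u * v) * y = y * (u * v * u - v * u * v) ∧
    (u * v * u - v * u * v) * z = x * (u * v * u - v * u * v) := by
  have hux' : ∀ w, u * (x * w) = y * (u * w) - c • (y * w) := fun w => by
    rw [← mul_assoc, hux, sub_mul, smul_mul_assoc, mul_assoc]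
  have huy' : ∀ w, u * (y * w) = x * (u * w) + c • (y * w) := fun w => by
    rw [← mul_assoc, huy, add_mul, smul_mul_assoc, mul_assoc]
  have huz' : ∀ w, u * (z * w) = z * (u * w) := fun w => by
    rw [← mul_assoc, huz, mul_assoc]
  have hvx' : ∀ w, v * (x * w) = x * (v * w) := fun w => by
    rw [← mul_assoc, hvx, mul_assoc]
  have hvy' : ∀ w, v * (y * w) = z * (v * w) - c • (z * w) := fun w => by
    rw [← mul_assoc, hvy, sub_mul, smul_mul_assoc, mul_assoc]
  have hvz' : ∀ w, v * (z * w) = y * (v * w) + c • (z * w) := fun w => by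
    rw [← mul_assoc, hvz, add_mul, smul_mul_assoc, mul_assoc]
  have hu' : ∀ w, u * (u * w) = c • (u * w) + k • w := fun w => by
    rw [← mul_assoc, hu, add_mul, smul_mul_assoc, smul_mul_assoc, one_mul]
  have hv' : ∀ w, v * (v * w) = c • (v * w) + k • w := fun w => by
    rw [← mul_assoc, hv, add_mul, smul_mul_assoc, smul_mul_assoc, one_mul]
  refine ⟨?_, ?_, ?_⟩ <;>
  · simp only [sub_mul, mul_sub, mul_add, smul_mul_assoc, mul_smul_comm, mul_one,
      mul_assoc, hux, huy, huz, hvx, hvy, hvz, hux', huy', huz', hvx', hvy', hvz', hu, hv, hu', hv',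
      smul_sub, smul_add]
    module

end AffineRelations

end CycHecke

open scoped TensorProduct
namespace CycHecke

/-! ### The cyclotomic action -/

section Cyclotomic

variable {R : Type*} [CommRing R] {n : ℕ} {W : Type*} [AddCommGroup W] [Module R W]

theorem eqOn_supported {S : Set (Fin n → ℕ)} {N : Type*} [AddCommGroup N] [Module R N]
    {F G : ((Fin n → ℕ) →₀ W) →ₗ[R] N}
    (h : ∀ ν ∈ S, ∀ x, F (Finsupp.single ν x) = G (Finsupp.single ν x))
    {m : (Fin n → ℕ) →₀ W} (hm : m ∈ Finsupp.supported W R S) : F m = G m := by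
  rw [← m.sum_single, Finsupp.sum, map_sum, map_sum]
  exact Finset.sum_congr rfl fun ν hν => h ν (hm hν) _

theorem mem_of_supported {S : Set (Fin n → ℕ)} {N : Type*} [AddCommGroup N] [Module R N]
    {F : ((Fin n → ℕ) →₀ W) →ₗ[R] N} {P : Submodule R N}
    (h : ∀ ν ∈ S, ∀ x, F (Finsupp.single ν x) ∈ P)
    {m : (Fin n → ℕ) →₀ W} (hm : m ∈ Finsupp.supported W R S) : F m ∈ P := by
  rw [← m.sum_single, Finsupp.sum, map_sum]
  exact Submodule.sum_mem _ fun ν hν => h ν (hm hν) _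

theorem single_mem {S : Set (Fin n → ℕ)} {ν : Fin n → ℕ} (hν : ν ∈ S) (h : W) :
    Finsupp.single ν h ∈ Finsupp.supported W R S := Finsupp.single_mem_supported R h hν

/-- Multiplication by the variable `o`, reduced modulo the monic polynomial of degree `r` with
lower coefficients `c`. -/
noncomputable def redX (o : Fin n) (r : ℕ) (c : ℕ → R) : Module.End R ((Fin n → ℕ) →₀ W) :=
  Finsupp.lsum R fun ν =>
    if ν o + 1 = r then - ∑ k ∈ Finset.range r, c k • Finsupp.lsingle (Function.update ν o k)
    else Finsupp.lsingle (ν + Pi.single o 1)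

variable {o : Fin n} {r : ℕ} {c : ℕ → R}

theorem redX_of_ne {ν : Fin n → ℕ} (hν : ν o + 1 ≠ r) (h : W) :
    redX o r c (Finsupp.single ν h) = Finsupp.single (ν + Pi.single o 1) h := by
  simp [redX, hν]

theorem redX_of_eq {ν : Fin n → ℕ} (hν : ν o + 1 = r) (h : W) :
    redX o r c (Finsupp.single ν h) =
      - ∑ k ∈ Finset.range r, c k • Finsupp.single (Function.update ν o k) h := by
  simp [redX, hν, LinearMap.sum_apply]

theorem update_add_single (ν : Fin n → ℕ) (a : Fin n) (k : ℕ) :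
    Function.update ν a k + Pi.single a 1 = Function.update ν a (k + 1) := by
  funext l
  by_cases hl : l = a
  · subst hl; simp
  · simp [hl]

theorem redX_pow_single (ν : Fin n → ℕ) (h : W) {k : ℕ} (hk : k < r) :
    (redX o r c ^ k) (Finsupp.single (Function.update ν o 0) h) =
      Finsupp.single (Function.update ν o k) h := by
  induction k with
  | zero => simp
  | succ k ih =>
    rw [pow_succ', Module.End.mul_apply, ih (by omega), redX_of_ne (by simp; omega),
      update_add_single]

theorem mulX_pow_single (a : Fin n) (ν : Fin n → ℕ) (h : W) (k : ℕ) :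
    (mulX (R := R) a ^ k) (Finsupp.single ν h) =
      Finsupp.single (Function.update ν a (ν a + k)) h := by
  induction k with
  | zero => simp
  | succ k ih =>
    rw [pow_succ', Module.End.mul_apply, ih, mulX_single, update_add_single, add_assoc]

theorem redX_mem_low {m : (Fin n → ℕ) →₀ W} (hm : m ∈ Finsupp.supported W R {ν | ν o < r}) :
    redX o r c m ∈ Finsupp.supported W R {ν : Fin n → ℕ | ν o < r} := by
  refine mem_of_supported (fun ν hν x => ?_) hm
  by_cases h : ν o + 1 = r
  · rw [redX_of_eq h]
    refine Submodule.neg_mem _ (Submodule.sum_mem _ fun k hk => Submodule.smul_mem _ _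
      (single_mem ?_ _))
    simpa using hk
  · rw [redX_of_ne h]
    refine single_mem ?_ _
    have : ν o < r := hν
    simp; omega

theorem redX_pow_mem_low {m : (Fin n → ℕ) →₀ W} (hm : m ∈ Finsupp.supported W R {ν | ν o < r})
    (k : ℕ) : (redX o r c ^ k) m ∈ Finsupp.supported W R {ν : Fin n → ℕ | ν o < r} := by
  induction k with
  | zero => simpa using hm
  | succ k ih => rw [pow_succ', Module.End.mul_apply]; exact redX_mem_low ih

/-- The value of the monic polynomial at an operator. -/
noncomputable def monicEval (r : ℕ) (c : ℕ → R) {N : Type*} [AddCommGroup N] [Module R N]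
    (x : Module.End R N) : Module.End R N := x ^ r + ∑ k ∈ Finset.range r, c k • x ^ k

/-- Cayley–Hamilton for a companion matrix: the polynomial in the operator kills the vector with
exponent 0, commutes with the operator, and the powers of the operator reach every exponent below r.
-/
theorem monicEval_redX {m : (Fin n → ℕ) →₀ W} (hm : m ∈ Finsupp.supported W R {ν | ν o < r}) :
    monicEval r c (redX o r c) m = 0 := by
  have : monicEval r c (redX o r c) m = (0 : Module.End R _) m := by
    refine eqOn_supported (fun ν hν x => ?_) hm
    have hν : ν o < r := hν
    have hc : Commute (monicEval r c (redX o r c)) (redX o r c ^ ν o : Module.End R (_ →₀ W)) :=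
      Commute.add_left ((Commute.refl _).pow_pow _ _) (Commute.sum_left _ _ _ fun k _ =>
        ((Commute.refl _).pow_pow _ _).smul_left _)
    have e := redX_pow_single (o := o) (c := c) ν x hν
    rw [Function.update_eq_self] at e
    rw [← e, ← Module.End.mul_apply, hc.eq, Module.End.mul_apply]
    have e0 : monicEval r c (redX o r c) (Finsupp.single (Function.update ν o 0) x) = 0 := by
      rw [monicEval, LinearMap.add_apply, LinearMap.sum_apply]
      obtain ⟨r', rfl⟩ : ∃ r', r = r' + 1 := ⟨r - 1, by omega⟩
      rw [pow_succ', Module.End.mul_apply, redX_pow_single ν x (by omega),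
        redX_of_eq (by simp), neg_add_eq_zero]
      refine Finset.sum_congr rfl fun k hk => ?_
      rw [LinearMap.smul_apply, redX_pow_single ν x (Finset.mem_range.1 hk), Function.update_idem]
    rw [e0, map_zero, LinearMap.zero_apply]
  rw [this, LinearMap.zero_apply]

/-- Reduction modulo the monic polynomial in the variable `o`. -/
noncomputable def redProj (o : Fin n) (r : ℕ) (c : ℕ → R) : Module.End R ((Fin n → ℕ) →₀ W) :=
  Finsupp.lsum R fun ν => (redX o r c ^ ν o).comp (Finsupp.lsingle (Function.update ν o 0))

theorem redProj_single (ν : Fin n → ℕ) (h : W) : redProj o r c (Finsupp.single ν h) =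
    (redX o r c ^ ν o) (Finsupp.single (Function.update ν o 0) h) := by
  simp [redProj]

theorem redProj_mulX : (redProj o r c * mulX o : Module.End R ((Fin n → ℕ) →₀ W)) =
    redX o r c * redProj o r c := by
  refine Finsupp.lhom_ext fun ν h => ?_
  rw [Module.End.mul_apply, mulX_single, redProj_single, Module.End.mul_apply, redProj_single,
    ← Module.End.mul_apply, ← pow_succ']
  congr 2
  · simp
  · funext l
    by_cases hl : l = o
    · subst hl; simp
    · simp [hl]

theorem redProj_mulX_pow (k : ℕ) (m : (Fin n → ℕ) →₀ W) :
    redProj o r c ((mulX (R := R) o ^ k) m) = (redX o r c ^ k) (redProj o r c m) := by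
  induction k with
  | zero => simp
  | succ k ih =>
    rw [pow_succ', Module.End.mul_apply, ← Module.End.mul_apply, redProj_mulX,
      Module.End.mul_apply, ih, pow_succ', Module.End.mul_apply]

theorem redProj_of_low {m : (Fin n → ℕ) →₀ W} (hm : m ∈ Finsupp.supported W R {ν | ν o < r}) :
    redProj o r c m = m := by
  have : redProj o r c m = (1 : Module.End R _) m := by
    refine eqOn_supported (fun ν hν x => ?_) hm
    rw [redProj_single, redX_pow_single ν x hν, Function.update_eq_self, Module.End.one_apply]
  rw [this, Module.End.one_apply]

theorem redProj_mem_low (hr : 0 < r) (m : (Fin n → ℕ) →₀ W) :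
    redProj o r c m ∈ Finsupp.supported W R {ν : Fin n → ℕ | ν o < r} := by
  refine mem_of_supported (S := Set.univ) (fun ν _ x => ?_) (by simp)
  rw [redProj_single]
  exact redX_pow_mem_low (single_mem (by simpa using hr) _) _

/-- Reduction intertwines honest with truncated multiplication, so it carries multiples of the monic
polynomial to values of that polynomial at `redX`, which vanish. -/
theorem redProj_monicEval (hr : 0 < r) (m : (Fin n → ℕ) →₀ W) :
    redProj o r c (monicEval r c (mulX o) m) = 0 := by
  rw [← monicEval_redX (o := o) (c := c) (redProj_mem_low (o := o) (c := c) hr m), monicEval, monicEval]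
  simp only [LinearMap.add_apply, LinearMap.sum_apply, LinearMap.smul_apply, map_add, map_sum,
    map_smul, redProj_mulX_pow]

theorem redX_eq_mulX_sub {ν : Fin n → ℕ} (hν : ν o + 1 = r) (h : W) :
    redX o r c (Finsupp.single ν h) = mulX (R := R) o (Finsupp.single ν h) -
      monicEval r c (mulX o) (Finsupp.single (Function.update ν o 0) h) := by
  rw [redX_of_eq hν, monicEval, LinearMap.add_apply, LinearMap.sum_apply, mulX_pow_single,
    mulX_single]
  simp only [LinearMap.smul_apply, mulX_pow_single, Function.update_idem, Function.update_self,
    zero_add]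
  have : ν + Pi.single o 1 = Function.update ν o r := by
    rw [← hν, ← update_add_single, Function.update_eq_self]
  rw [this]
  abel

/-- The defect kills constants by the quadratic relation on W and commutes with every variable, so
`end_eq_zero` applies. `affT_braid` and `affT_comm` follow the same scheme. -/
theorem affT_quad {a b : Fin n} (hab : a ≠ b) {t : Module.End R W} {k l : R}
    (ht : t * t = k • t + l • 1) :
    affT k a b t * affT k a b t = k • affT k a b t + l • 1 := by
  rw [← sub_eq_zero, ← sub_sub]
  refine end_eq_zero (fun h => ?_) fun d => ?_
  · simp only [LinearMap.sub_apply, LinearMap.smul_apply, Module.End.mul_apply,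
      Module.End.one_apply, affT_single_zero]
    rw [← Module.End.mul_apply, ht]
    simp [Finsupp.single_add]
  · by_cases hda : d = a
    · subst hda
      exact ⟨_, quad_comm_left (affT_mulX_left k hab t) (affT_mulX_right k hab t)⟩
    by_cases hdb : d = b
    · subst hdb
      exact ⟨_, quad_comm_right (affT_mulX_left k hab t) (affT_mulX_right k hab t)⟩
    · refine ⟨d, ?_⟩
      have e := affT_mulX_other k hda hdb t
      rw [sub_mul, sub_mul, mul_sub, mul_sub, smul_mul_assoc, mul_smul_comm, mul_assoc, e,
        ← mul_assoc, e]
      simp only [smul_mul_assoc, mul_smul_comm, one_mul, mul_one, mul_assoc]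

theorem affT_mulX_affT {a b : Fin n} (hab : a ≠ b) {t : Module.End R W} {k l : R}
    (ht : t * t = k • t + l • 1) :
    affT k a b t * mulX a * affT k a b t = l • mulX b := by
  rw [affT_mulX_left k hab, sub_mul, mul_assoc, affT_quad hab ht, mul_add, mul_smul_comm,
    mul_smul_comm, mul_one, smul_mul_assoc]
  abel

theorem affT_braid {a b d : Fin n} (hab : a ≠ b) (hbd : b ≠ d) (had : a ≠ d)
    {t u : Module.End R W} {k l : R} (ht : t * t = k • t + l • 1) (hu : u * u = k • u + l • 1)
    (htu : t * u * t = u * t * u) :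
    affT k a b t * affT k b d u * affT k a b t = affT k b d u * affT k a b t * affT k b d u := by
  rw [← sub_eq_zero]
  refine end_eq_zero (fun h => ?_) fun e => ?_
  · simp only [LinearMap.sub_apply, Module.End.mul_apply, affT_single_zero]
    have := congrArg (fun F : Module.End R W => F h) htu
    simp only [Module.End.mul_apply] at this
    rw [this, sub_self]
  · obtain ⟨h1, h2, h3⟩ := braid_comm (affT_mulX_left k hab t) (affT_mulX_right k hab t)
      (affT_mulX_other k had.symm hbd.symm t) (affT_mulX_other k hab had u)
      (affT_mulX_left k hbd u) (affT_mulX_right k hbd u) (affT_quad hab ht) (affT_quad hbd hu)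
    by_cases ha : e = a
    · subst ha; exact ⟨d, h1⟩
    by_cases hb : e = b
    · subst hb; exact ⟨e, h2⟩
    by_cases hd : e = d
    · subst hd; exact ⟨a, h3⟩
    · refine ⟨e, ?_⟩
      have e1 : ∀ w, affT k a b t * (mulX e * w) = mulX e * (affT k a b t * w) := fun w => by
        rw [← mul_assoc, affT_mulX_other k ha hb, mul_assoc]
      have e2 : ∀ w, affT k b d u * (mulX e * w) = mulX e * (affT k b d u * w) := fun w => by
        rw [← mul_assoc, affT_mulX_other k hb hd, mul_assoc]
      simp only [sub_mul, mul_sub, mul_assoc, affT_mulX_other k ha hb, affT_mulX_other k hb hd,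
        e1, e2]

theorem affT_comm {a b d e : Fin n} (hab : a ≠ b) (hde : d ≠ e) (had : a ≠ d) (hae : a ≠ e)
    (hbd : b ≠ d) (hbe : b ≠ e) {t u : Module.End R W} (k : R) (htu : t * u = u * t) :
    affT k a b t * affT k d e u = affT k d e u * affT k a b t := by
  rw [← sub_eq_zero]
  have l1 := affT_mulX_left k hab t
  have l2 := affT_mulX_right k hab t
  have l3 := affT_mulX_left k hde u
  have l4 := affT_mulX_right k hde u
  have o1 := fun x h h' => affT_mulX_other (d := x) (a := a) (b := b) k h h' t
  have o2 := fun x h h' => affT_mulX_other (d := x) (a := d) (b := e) k h h' u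
  have re : ∀ {x y z : Module.End R ((Fin n → ℕ) →₀ W)}, x * y = z → ∀ w, x * (y * w) = z * w :=
    fun h w => by rw [← mul_assoc, h]
  refine end_eq_zero (fun h => ?_) fun x => ?_
  · simp only [LinearMap.sub_apply, Module.End.mul_apply, affT_single_zero]
    rw [← Module.End.mul_apply, htu, Module.End.mul_apply, sub_self]
  · by_cases ha : x = a
    · subst ha
      refine ⟨b, ?_⟩
      simp only [sub_mul, mul_sub, mul_assoc, l1, re l1, o2 x had hae, re (o2 x had hae),
        o2 b hbd hbe, re (o2 b hbd hbe), smul_mul_assoc, mul_smul_comm]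
      module
    by_cases hb : x = b
    · subst hb
      refine ⟨a, ?_⟩
      simp only [sub_mul, mul_sub, mul_assoc, l2, re l2, o2 a had hae, re (o2 a had hae),
        o2 x hbd hbe, re (o2 x hbd hbe), smul_mul_assoc, mul_smul_comm, mul_add, add_mul]
      module
    by_cases hd : x = d
    · subst hd
      refine ⟨e, ?_⟩
      have p1 := o1 x had.symm hbd.symm
      have p2 := o1 e hae.symm hbe.symm
      simp only [sub_mul, mul_sub, mul_assoc, l3, re l3, p1, re p1,
        p2, re p2, smul_mul_assoc, mul_smul_comm]
      module
    by_cases he : x = e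
    · subst he
      refine ⟨d, ?_⟩
      have p1 := o1 d had.symm hbd.symm
      have p2 := o1 x hae.symm hbe.symm
      simp only [sub_mul, mul_sub, mul_assoc, l4, re l4, p1, re p1,
        p2, re p2, smul_mul_assoc, mul_smul_comm, mul_add, add_mul]
      module
    · refine ⟨x, ?_⟩
      have p1 := o1 x ha hb
      have p2 := o2 x hd he
      simp only [sub_mul, mul_sub, mul_assoc, p1, re p1, p2, re p2]

theorem comp_swap_mem_box {ν : Fin n → ℕ} (hν : ν ∈ box n r n) (a b : Fin n) :
    ν ∘ Equiv.swap a b ∈ box n r n := ⟨fun _ => hν.1 _, fun j hj => absurd hj (by omega)⟩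

theorem affT_mem {a b : Fin n} {t : Module.End R W} (k : R) {m : (Fin n → ℕ) →₀ W}
    (hm : m ∈ Finsupp.supported W R (box n r n)) :
    affT k a b t m ∈ Finsupp.supported W R (box n r n) := by
  refine mem_of_supported (fun ν hν x => ?_) hm
  rw [affT_single]
  refine Submodule.sub_mem _ (single_mem (comp_swap_mem_box hν a b) _) (Submodule.smul_mem _ _ ?_)
  rcases le_total (ν a) (ν b) with h | h
  · rw [← neg_sub, ← Finset.sum_Ico_eq_sub _ h]
    refine Submodule.neg_mem _ (Submodule.sum_mem _ fun j hj => single_mem ?_ _)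
    rw [Finset.mem_Ico] at hj
    exact redistribute_mem_box hν a.2 b.2 (Or.inl ⟨hj.1, hj.2.le⟩)
  · rw [← Finset.sum_Ico_eq_sub _ h]
    refine Submodule.sum_mem _ fun j hj => single_mem ?_ _
    rw [Finset.mem_Ico] at hj
    exact redistribute_mem_box hν a.2 b.2 (Or.inr ⟨hj.1, hj.2.le⟩)

theorem update_mem_box {ν : Fin n → ℕ} (hν : ν ∈ box n r n) (a : Fin n) {k : ℕ} (hk : k < r) :
    Function.update ν a k ∈ box n r n := by
  refine ⟨fun j => ?_, fun j hj => absurd hj (by omega)⟩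
  by_cases h : j = a
  · subst h; simpa
  · rw [Function.update_of_ne h]; exact hν.1 j

theorem redX_mem {m : (Fin n → ℕ) →₀ W} (hm : m ∈ Finsupp.supported W R (box n r n)) :
    redX o r c m ∈ Finsupp.supported W R (box n r n) := by
  refine mem_of_supported (fun ν hν x => ?_) hm
  by_cases h : ν o + 1 = r
  · rw [redX_of_eq h]
    exact Submodule.neg_mem _ (Submodule.sum_mem _ fun k hk => Submodule.smul_mem _ _
      (single_mem (update_mem_box hν o (Finset.mem_range.1 hk)) _))
  · rw [redX_of_ne h]
    have := update_mem_box hν o (k := ν o + 1) (by have := hν.1 o; omega)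
    rw [← update_add_single, Function.update_eq_self] at this
    exact single_mem this _

theorem redX_affT_comm {a b : Fin n} (ha : o ≠ a) (hb : o ≠ b) (t : Module.End R W) (k : R) :
    redX o r c * affT k a b t = affT k a b t * redX o r c := by
  refine Finsupp.lhom_ext fun ν h => ?_
  rw [Module.End.mul_apply, Module.End.mul_apply, affT_single]
  have e1 : (ν ∘ Equiv.swap a b) o = ν o := by
    simp [Equiv.swap_apply_of_ne_of_ne ha hb]
  have e2 : ∀ j, redistribute ν a b j o = ν o := fun j => by
    simp [redistribute, ha, hb]
  have e3 : ∀ k, Function.update (ν ∘ Equiv.swap a b) o k =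
      Function.update ν o k ∘ Equiv.swap a b := fun k => by
    funext l
    simp only [Function.comp_apply, Function.update_apply, Equiv.swap_apply_eq_iff,
      Equiv.swap_apply_of_ne_of_ne ha hb]
  have e4 : ∀ j k, Function.update (redistribute ν a b j) o k =
      redistribute (Function.update ν o k) a b j := fun j k => by
    simp only [redistribute, Function.update_of_ne ha.symm, Function.update_of_ne hb.symm]
    rw [Function.update_comm hb.symm, Function.update_comm ha.symm]
  by_cases hν : ν o + 1 = r
  · rw [redX_of_eq hν, map_sub, map_smul, map_sub, map_sum, map_sum, redX_of_eq (by rw [e1, hν])]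
    have e5 : ∀ j, redX o r c (Finsupp.single (redistribute ν a b j) h) = _ := fun j =>
      redX_of_eq (c := c) (by rw [e2, hν]) h
    simp only [e5, e3, e4, map_neg, map_sum, map_smul, affT_single, Function.update_of_ne ha.symm,
      Function.update_of_ne hb.symm, Finset.sum_neg_distrib, smul_sub, smul_neg, Finset.sum_sub_distrib,
      Finset.smul_sum]
    rw [Finset.sum_comm (s := Finset.range r), Finset.sum_comm (s := Finset.range r)]
    simp only [smul_comm (c _) k]
    abel
  · rw [redX_of_ne hν, map_sub, map_smul, map_sub, map_sum, map_sum, redX_of_ne (by rwa [e1])]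
    have e5 : ∀ j, redX o r c (Finsupp.single (redistribute ν a b j) h) = _ := fun j =>
      redX_of_ne (c := c) (by rwa [e2]) h
    simp only [e5, affT_single, add_comp_swap, Equiv.swap_apply_of_ne_of_ne ha hb,
      redistribute_other ha hb]
    simp [ha.symm, hb.symm]

end Cyclotomic

end CycHecke

open scoped TensorProduct
namespace CycHecke

/-! ### The Ariki–Koike algebra acts on truncated polynomials -/

section BraidFour

variable {R : Type*} [CommRing R] {n : ℕ} {W : Type*} [AddCommGroup W] [Module R W]
  {o b : Fin n} {r : ℕ} {c : ℕ → R} {t : Module.End R W} {k l : R}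

theorem box_subset_low : Finsupp.supported W R (box n r n) ≤
    Finsupp.supported W R {ν : Fin n → ℕ | ν o < r} :=
  Finsupp.supported_mono fun _ hν => hν.1 o

/-- Truncated and honest multiplication differ only at exponent r-1 in the variable o. The
correction terms of the operator stay below this exponent, so only the swapped leading term can be
affected, and only when ν b = r-1. The resulting error is X_b^a applied to a multiple of the monic
polynomial, with one vector m0 serving every a < r. -/
theorem redX_affT_mulX_pow (hob : o ≠ b) {ν : Fin n → ℕ} (hν : ν ∈ box n r n) (h0 : ν o = 0)
    (h : W) : ∃ m0 : (Fin n → ℕ) →₀ W, ∀ a < r,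
      redX o r c (affT k o b t ((mulX (R := R) o ^ a) (Finsupp.single ν h))) =
        mulX (R := R) o (affT k o b t ((mulX (R := R) o ^ a) (Finsupp.single ν h))) -
          monicEval r c (mulX o) ((mulX (R := R) b ^ a) m0) := by
  have hb := hν.1 b
  have e5 : ∀ (μ : Fin n → ℕ) j, j + 1 < r →
      redX o r c (Finsupp.single (redistribute μ o b j) h) =
        mulX (R := R) o (Finsupp.single (redistribute μ o b j) h) := fun μ j hj => by
    rw [redX_of_ne, mulX_single]
    simp [redistribute, hob]; omega
  have key : ∀ a < r, redX o r c (affT k o b t (Finsupp.single (Function.update ν o a) h)) -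
      mulX (R := R) o (affT k o b t (Finsupp.single (Function.update ν o a) h)) =
      redX o r c (Finsupp.single (Function.update ν o a ∘ Equiv.swap o b) (t h)) -
      mulX (R := R) o (Finsupp.single (Function.update ν o a ∘ Equiv.swap o b) (t h)) := by
    intro a ha
    rw [affT_single, Function.update_self, Function.update_of_ne hob.symm]
    simp only [map_sub, map_smul, map_sum]
    rw [Finset.sum_congr rfl fun j hj => e5 _ j (by rw [Finset.mem_range] at hj; omega),
      Finset.sum_congr (s₁ := Finset.range (ν b)) rfl fun j hj =>
        e5 _ j (by rw [Finset.mem_range] at hj; omega)]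
    abel
  by_cases hbr : ν b + 1 = r
  · refine ⟨Finsupp.single (Function.update ν b 0) (t h), fun a ha => ?_⟩
    rw [mulX_pow_single, h0, zero_add, eq_sub_iff_add_eq, ← eq_sub_iff_add_eq', ← neg_sub, key a ha,
      redX_eq_mulX_sub (by simp [hob.symm, hbr]), mulX_pow_single, Function.update_self, zero_add,
      Function.update_idem]
    have : Function.update (Function.update ν o a ∘ Equiv.swap o b) o 0 = Function.update ν b a := by
      funext x
      simp only [Function.update_apply, Function.comp_apply, Equiv.swap_apply_def]
      split_ifs <;> simp_all
    rw [this]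
    abel
  · refine ⟨0, fun a ha => ?_⟩
    rw [mulX_pow_single, h0, zero_add, map_zero, map_zero, ← sub_eq_zero, sub_zero, key a ha,
      redX_of_ne (by simpa [hob.symm] using hbr), mulX_single, sub_self]

/-- The Bernstein correction is a polynomial in x and y, so it commutes with anything that commutes
with both. -/
theorem exists_commuting_error {A : Type*} [Ring A] [Algebra R A] {u x y f : A} {k : R}
    (hxy : Commute x y) (hx : u * x = y * u - k • y) (hy : u * y = x * u + k • y)
    (hfx : Commute f x) (hfy : Commute f y) (a : ℕ) :
    ∃ z, Commute f z ∧ u * y ^ a = x ^ a * u + z := by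
  have := bernstein_pow hxy hx hy 0 a
  simp only [pow_zero, one_mul, mul_one] at this
  refine ⟨_, ?_, by rw [this, sub_eq_add_neg]⟩
  refine (Commute.smul_right (Commute.sub_right ?_ ?_) _).neg_right <;>
  exact Commute.sum_right _ _ _ fun j _ => (hfx.pow_right _).mul_right (hfy.pow_right _)

/-- For honest multiplication u x u = l·y, which commutes with x. The lemma says that replacing x by
its truncation z inside u z u spoils commutation with x^a only by a value of f, here the monic
polynomial in x. -/
theorem exists_error_apply {N : Type*} [AddCommGroup N] [Module R N]
    {u x y f z : Module.End R N} {k l : R} {m m0 : N}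
    (hxy : Commute x y) (hx : u * x = y * u - k • y) (hy : u * y = x * u + k • y)
    (hfx : Commute f x) (hfy : Commute f y) (hu : u * x * u = l • y) (hr : 0 < r)
    (hz : ∀ a < r, z (u ((x ^ a) m)) = x (u ((x ^ a) m)) - f ((y ^ a) m0)) {a : ℕ} (ha : a < r) :
    ∃ m1, (u * z * u) ((x ^ a) m) = (x ^ a) ((u * z * u) m) - f m1 := by
  obtain ⟨e, he, hue⟩ := exists_commuting_error hxy hx hy hfx hfy a
  have hY : ∀ a < r, (u * z * u) ((x ^ a) m) =
      (l • y * x ^ a) m - (u * (f * y ^ a)) m0 := fun a ha => by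
    rw [← hu]
    simp only [Module.End.mul_apply]
    rw [hz a ha, map_sub]
  refine ⟨e m0, ?_⟩
  have h1 := hY 0 hr
  simp only [pow_zero, Module.End.one_apply, mul_one] at h1
  rw [hY a ha, h1, map_sub, (hfy.pow_right a).eq, ← mul_assoc, hue, add_mul, ← he.eq,
    smul_mul_assoc, (hxy.pow_left a).symm.eq]
  simp only [LinearMap.add_apply, LinearMap.smul_apply, Module.End.mul_apply, map_smul]
  abel

theorem commute_monicEval {N : Type*} [AddCommGroup N] [Module R N] {x y : Module.End R N}
    (h : Commute x y) : Commute (monicEval r c x) y :=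
  Commute.add_left (h.pow_left _) (Commute.sum_left _ _ _ fun _ _ => (h.pow_left _).smul_left _)

theorem conj_mem {m : (Fin n → ℕ) →₀ W} (hm : m ∈ Finsupp.supported W R (box n r n)) :
    (affT k o b t * redX o r c * affT k o b t : Module.End R ((Fin n → ℕ) →₀ W)) m ∈
      Finsupp.supported W R (box n r n) := by
  rw [Module.End.mul_apply, Module.End.mul_apply]
  exact affT_mem k (redX_mem (affT_mem k hm))

/-- The element T_1 T_0 T_1 commutes with powers of the honest variable up to a multiple of the
monic polynomial. Both sides of the claim are already truncated, so projecting removes that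
multiple. -/
theorem braid_commute (hob : o ≠ b) (hr : 0 < r) (ht : t * t = k • t + l • 1) {ν : Fin n → ℕ}
    (hν : ν ∈ box n r n) (h0 : ν o = 0) (h : W) {a : ℕ} (ha : a < r) :
    (affT k o b t * redX o r c * affT k o b t : Module.End R ((Fin n → ℕ) →₀ W))
      ((redX o r c ^ a) (Finsupp.single ν h)) = (redX o r c ^ a)
      ((affT k o b t * redX o r c * affT k o b t : Module.End R ((Fin n → ℕ) →₀ W))
        (Finsupp.single ν h)) := by
  obtain ⟨m0, hm0⟩ := redX_affT_mulX_pow (c := c) (k := k) (t := t) hob hν h0 h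
  have e0 : Function.update ν o 0 = ν := by rw [← h0, Function.update_eq_self]
  have ea : (redX o r c ^ a) (Finsupp.single ν h) = (mulX (R := R) o ^ a) (Finsupp.single ν h) := by
    rw [mulX_pow_single, h0, zero_add]
    conv_lhs => rw [← e0]
    rw [redX_pow_single ν h ha]
  have hXX : Commute (mulX o : Module.End R ((Fin n → ℕ) →₀ W)) (mulX b) := mulX_comm o b
  obtain ⟨m1, main⟩ := exists_error_apply hXX (affT_mulX_left k hob t) (affT_mulX_right k hob t)
    (commute_monicEval (Commute.refl _)) (commute_monicEval hXX) (affT_mulX_affT hob ht) hr hm0 ha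
  have hmem : ∀ m ∈ Finsupp.supported W R (box n r n),
      (affT k o b t * redX o r c * affT k o b t : Module.End R ((Fin n → ℕ) →₀ W)) m ∈
      Finsupp.supported W R {ν : Fin n → ℕ | ν o < r} := fun m hm =>
    box_subset_low (conj_mem hm)
  have hb1 : Finsupp.single ν h ∈ Finsupp.supported W R (box n r n) := single_mem hν h
  have hb2 : (mulX (R := R) o ^ a) (Finsupp.single ν h) ∈ Finsupp.supported W R (box n r n) := by
    rw [mulX_pow_single, h0, zero_add]
    exact single_mem (update_mem_box hν o ha) h
  have h1 := hmem _ hb1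
  have h2 := hmem _ hb2
  clear hmem hm0
  rw [ea]
  generalize (affT k o b t * redX o r c * affT k o b t : Module.End R ((Fin n → ℕ) →₀ W)) = Y at *
  -- The left side of `main` is reduced, hence fixed by the projection; on the right the multiple of
  -- the monic polynomial dies and powers of the variable become powers of `redX`.
  have h3 := redProj_of_low (c := c) h2
  rw [main, map_sub, redProj_monicEval hr, sub_zero, redProj_mulX_pow, redProj_of_low h1] at h3
  rw [main, h3]

/-- The relation says that T_0 commutes with T_1 T_0 T_1. It is checked on powers of T_0 applied to
vectors without the variable o, where `braid_commute` is available. -/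
theorem redX_braid_four (hob : o ≠ b) (hr : 0 < r) (ht : t * t = k • t + l • 1)
    {m : (Fin n → ℕ) →₀ W} (hm : m ∈ Finsupp.supported W R (box n r n)) :
    (redX o r c * affT k o b t * redX o r c * affT k o b t : Module.End R ((Fin n → ℕ) →₀ W)) m =
      (affT k o b t * redX o r c * affT k o b t * redX o r c : Module.End R ((Fin n → ℕ) →₀ W)) m := by
  refine eqOn_supported (fun ν hν h => ?_) hm
  have h1 : ∀ a < r, _ := fun a ha =>
    braid_commute (c := c) hob hr ht (update_mem_box hν o hr) (by simp) h (a := a) ha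
  have hνr := hν.1 o
  have e : Finsupp.single ν h = (redX o r c ^ ν o) (Finsupp.single (Function.update ν o 0) h) := by
    rw [redX_pow_single ν h hνr, Function.update_eq_self]
  suffices key : (affT k o b t * redX o r c * affT k o b t : Module.End R ((Fin n → ℕ) →₀ W))
      ((redX o r c ^ (ν o + 1)) (Finsupp.single (Function.update ν o 0) h)) =
      (redX o r c ^ (ν o + 1)) ((affT k o b t * redX o r c * affT k o b t :
        Module.End R ((Fin n → ℕ) →₀ W)) (Finsupp.single (Function.update ν o 0) h)) by
    rw [pow_succ', Module.End.mul_apply (redX o r c), ← e, Module.End.mul_apply (redX o r c),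
      ← h1 _ hνr, ← e] at key
    simp only [Module.End.mul_apply] at key ⊢
    exact key.symm
  rcases eq_or_lt_of_le (Nat.succ_le_of_lt hνr) with h2 | h2
  -- At exponent r-1 one more factor leaves the range a < r of `braid_commute`; the r-th power is
  -- rewritten through lower ones by the monic polynomial, on both vectors.
  · have e0 : ∀ x ∈ Finsupp.supported W R {ν : Fin n → ℕ | ν o < r}, (redX o r c ^ r) x =
        - ∑ j ∈ Finset.range r, c j • (redX o r c ^ j) x := fun x hx => by
      have := monicEval_redX (c := c) hx
      rw [monicEval, LinearMap.add_apply, LinearMap.sum_apply] at this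
      exact eq_neg_of_add_eq_zero_left this
    have hb1 : Finsupp.single (Function.update ν o 0) h ∈ Finsupp.supported W R (box n r n) :=
      single_mem (update_mem_box hν o hr) h
    rw [show ν o + 1 = r from h2, e0 _ (box_subset_low hb1),
      e0 _ (box_subset_low (conj_mem hb1)), map_neg, map_sum]
    congr 1
    refine Finset.sum_congr rfl fun j hj => ?_
    rw [map_smul, h1 _ (Finset.mem_range.1 hj)]
  · rw [h1 _ h2]

end BraidFour

end CycHecke

open scoped TensorProduct
namespace CycHecke

/-! ### The standard basis theorem and the canonical trace -/

section Rep

variable {R : Type*} [CommRing R] {n r : ℕ} (q : Rˣ) (Q : Fin r → R)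

/-- The universal property of the Ariki–Koike algebra. -/
theorem exists_liftAK {A : Type*} [Ring A] [Algebra R A] (f : Fin n → A)
    (hcyc : ∀ h : 0 < n, f ⟨0, h⟩ ^ r + ∑ k ∈ Finset.range r, cycCoeff Q k • f ⟨0, h⟩ ^ k = 0)
    (hquad : ∀ i : Fin n, 1 ≤ i.val → f i * f i = ((q : R) - 1) • f i + (q : R) • 1)
    (hbr4 : ∀ h : 1 < n, f ⟨0, by omega⟩ * f ⟨1, h⟩ * f ⟨0, by omega⟩ * f ⟨1, h⟩ =
      f ⟨1, h⟩ * f ⟨0, by omega⟩ * f ⟨1, h⟩ * f ⟨0, by omega⟩)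
    (hbr3 : ∀ i j : Fin n, 1 ≤ i.val → i.val + 1 = j.val → f j * f i * f j = f i * f j * f i)
    (hcomm : ∀ i j : Fin n, i.val + 1 < j.val → f i * f j = f j * f i) :
    ∃ φ : AK n q Q →ₐ[R] A, ∀ i : Fin n, φ (T i) = f i := by
  have hrel : ∀ ⦃x y : FreeAlgebra R (Fin n)⦄, Rel n q Q x y →
      FreeAlgebra.lift R f x = FreeAlgebra.lift R f y := by
    intro x y hxy
    cases hxy with
    | cyclotomic h =>
      rw [map_zero, ← hcyc h, ← prod_sub_eq, map_list_prod, List.map_ofFn]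
      congr 2
      funext k
      simp
    | quadratic i hi =>
      simp only [map_zero, map_mul, map_sub, map_add, map_one, AlgHom.commutes,
        FreeAlgebra.lift_ι_apply]
      rw [sub_mul, mul_add, hquad i hi, Algebra.algebraMap_eq_smul_one, smul_mul_assoc, one_mul, mul_one]
      module
    | braid_four h => simpa using hbr4 h
    | braid_three i j hi hij => simpa using hbr3 i j hi hij
    | comm i j hij => simpa using hcomm i j hij
  refine ⟨RingQuot.liftAlgHom R ⟨FreeAlgebra.lift R f, hrel⟩, fun i => ?_⟩
  rw [T_eq i.2]
  exact (RingQuot.liftAlgHom_mkAlgHom_apply R _ hrel _).trans (FreeAlgebra.lift_ι_apply _ _)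

/-- The operator giving the action of `T_i`. -/
noncomputable def opT (i : Fin n) :
    Module.End R ((Fin n → ℕ) →₀ (Equiv.Perm (Fin n) →₀ R)) :=
  if i.val = 0 then redX i r (cycCoeff Q)
  else affT ((q : R) - 1) ⟨i - 1, by omega⟩ i (regT q n i)

theorem opT_zero (h : 0 < n) : opT q Q ⟨0, h⟩ = redX ⟨0, h⟩ r (cycCoeff Q) := if_pos rfl

theorem opT_pos {i : Fin n} (h : 1 ≤ i.val) :
    opT q Q i = affT ((q : R) - 1) ⟨i - 1, by omega⟩ i (regT q n i) := if_neg (by omega)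

/-- The submodule of polynomials with all exponents `< r`. -/
noncomputable abbrev truncated (R : Type*) [CommRing R] (n r : ℕ) :
    Submodule R ((Fin n → ℕ) →₀ (Equiv.Perm (Fin n) →₀ R)) :=
  Finsupp.supported _ R (box n r n)

noncomputable instance : AddCommGroup (truncated R n r) :=
  Module.addCommMonoidToAddCommGroup R

theorem opT_mem (i : Fin n) {m : (Fin n → ℕ) →₀ (Equiv.Perm (Fin n) →₀ R)}
    (hm : m ∈ truncated R n r) : opT q Q i m ∈ truncated R n r := by
  rcases Nat.eq_zero_or_pos i.val with h | h
  · rw [opT, if_pos h]; exact redX_mem hm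
  · rw [opT_pos q Q h]; exact affT_mem _ hm

/-- The operator giving the action of `T_i`, on the module of truncated polynomials. -/
noncomputable def resT (i : Fin n) : Module.End R (truncated R n r) :=
  (opT q Q i).restrict fun _ hm => opT_mem q Q i hm

theorem coe_resT (i : Fin n) (m : truncated R n r) :
    (resT q Q i m : (Fin n → ℕ) →₀ (Equiv.Perm (Fin n) →₀ R)) = opT q Q i m := rfl

/-- The cyclotomic relation and the braid relation of length four are established on truncated
polynomials only. The other relations already hold for the operators on all polynomials and are
restricted. -/
theorem exists_rep (hr : 0 < r) : ∃ φ : AK n q Q →ₐ[R] Module.End R (truncated R n r),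
    ∀ i : Fin n, φ (T i) = resT q Q i := by
  have ht : ∀ i : Fin n, 1 ≤ i.val → opT q Q i * opT q Q i =
      ((q : R) - 1) • opT q Q i + (q : R) • 1 := fun i hi => by
    rw [opT_pos q Q hi]
    exact affT_quad (by simp [Fin.ext_iff]; omega) (regT_mul_self hi i.2)
  refine exists_liftAK q Q (A := Module.End R (truncated R n r)) (resT q Q) (fun h => ?_) (fun i hi => ?_) (fun h => ?_)
    (fun i j hi hij => ?_) (fun i j hij => ?_) <;> refine LinearMap.ext fun m => Subtype.ext ?_
  · have e : ∀ k, ((resT q Q ⟨0, h⟩ ^ k) m : (Fin n → ℕ) →₀ (Equiv.Perm (Fin n) →₀ R)) =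
        (redX ⟨0, h⟩ r (cycCoeff Q) ^ k) (m : (Fin n → ℕ) →₀ (Equiv.Perm (Fin n) →₀ R)) := by
      intro k
      induction k with
      | zero => simp
      | succ k ih =>
        rw [pow_succ', Module.End.mul_apply, coe_resT, ih, opT_zero, pow_succ',
          Module.End.mul_apply]
    have := monicEval_redX (c := cycCoeff Q) (box_subset_low (o := ⟨0, h⟩) m.2)
    rw [monicEval, LinearMap.add_apply, LinearMap.sum_apply] at this
    rw [LinearMap.add_apply, LinearMap.sum_apply, Submodule.coe_add, Submodule.coe_sum, e]
    simp only [LinearMap.smul_apply, Submodule.coe_smul, e]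
    exact this
  · have := congrArg (fun F : Module.End R _ => F m.1) (ht i hi)
    exact this
  · simp only [Module.End.mul_apply, coe_resT, opT_zero, opT_pos q Q (i := ⟨1, h⟩) le_rfl]
    have := redX_braid_four (o := ⟨0, by omega⟩) (b := ⟨1, h⟩) (c := cycCoeff Q) (k := (q : R) - 1)
      (by simp) hr (regT_mul_self le_rfl h) m.2
    simpa only [Module.End.mul_apply] using this
  · have hj : 1 ≤ j.val := by omega
    simp only [Module.End.mul_apply, coe_resT, opT_pos q Q hi, opT_pos q Q hj]
    have hji : (⟨j - 1, by omega⟩ : Fin n) = i := Fin.ext (by simp; omega)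
    rw [hji]
    have hb := regT_braid (q := q) (R := R) hi (by omega : i.val + 1 < n)
    rw [hij] at hb
    have := affT_braid (a := ⟨i - 1, by omega⟩) (b := i) (d := j) (by simp [Fin.ext_iff]; omega)
      (by simp [Fin.ext_iff]; omega) (by simp [Fin.ext_iff]; omega) (k := (q : R) - 1)
      (regT_mul_self hi i.2) (regT_mul_self hj j.2) hb
    have := congrArg (fun F : Module.End R _ => F m.1) this
    simpa only [Module.End.mul_apply] using this.symm
  · have hj : 1 ≤ j.val := by omega
    simp only [Module.End.mul_apply, coe_resT]
    rcases Nat.eq_zero_or_pos i.val with h | h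
    · obtain ⟨i, hi⟩ := i
      obtain rfl : i = 0 := h
      rw [opT_zero, opT_pos q Q hj]
      have := redX_affT_comm (o := (⟨0, by omega⟩ : Fin n)) (r := r) (c := cycCoeff Q)
        (a := ⟨j - 1, by omega⟩) (b := j)
        (by simp [Fin.ext_iff] at hij ⊢; omega) (by simp [Fin.ext_iff] at hij ⊢; omega)
        (regT q n j) ((q : R) - 1)
      have := congrArg (fun F : Module.End R _ => F m.1) this
      simpa only [Module.End.mul_apply] using this
    · rw [opT_pos q Q h, opT_pos q Q hj]
      have := affT_comm (a := (⟨i - 1, by omega⟩ : Fin n)) (b := i) (d := ⟨j - 1, by omega⟩) (e := j)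
        (by simp [Fin.ext_iff]; omega) (by simp [Fin.ext_iff]; omega) (by simp [Fin.ext_iff]; omega)
        (by simp [Fin.ext_iff]; omega) (by simp [Fin.ext_iff]; omega) (by simp [Fin.ext_iff]; omega)
        ((q : R) - 1) (regT_comm (q := q) (R := R) h hij j.2)
      have := congrArg (fun F : Module.End R _ => F m.1) this
      simpa only [Module.End.mul_apply] using this

/-- The representation on truncated polynomials. -/
noncomputable def rep (hr : 0 < r) : AK n q Q →ₐ[R] Module.End R (truncated R n r) :=
  (exists_rep q Q hr).choose

theorem rep_T (hr : 0 < r) {i : ℕ} (hi : i < n) (m : truncated R n r) :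
    (rep q Q hr (T i) m : (Fin n → ℕ) →₀ (Equiv.Perm (Fin n) →₀ R)) = opT q Q ⟨i, hi⟩ m := by
  have := (exists_rep (n := n) q Q hr).choose_spec ⟨i, hi⟩
  rw [← coe_resT, ← this]
  rfl

/-- The monomial vectors in the module of truncated polynomials. -/
noncomputable def vec {ν : Fin n → ℕ} (hν : ν ∈ box n r n) (h : Equiv.Perm (Fin n) →₀ R) :
    truncated R n r := ⟨Finsupp.single ν h, single_mem hν h⟩

/-- If the earlier exponents vanish and there is room for one more factor, the recursion for L_{k+1}
never meets the reduction modulo the monic polynomial: L_k acts as the honest variable, and T X T =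
q X' finishes the step. -/
theorem rep_L (hr : 0 < r) {k : ℕ} (hk : k < n) (ν : Fin n → ℕ) (hν : ν ∈ box n r n)
    (h : Equiv.Perm (Fin n) →₀ R) (h0 : ∀ j : Fin n, j.val < k → ν j = 0)
    (hk' : ν ⟨k, hk⟩ + 1 < r) :
    (rep q Q hr (L (k + 1)) (vec hν h) : (Fin n → ℕ) →₀ (Equiv.Perm (Fin n) →₀ R)) =
      Finsupp.single (ν + Pi.single ⟨k, hk⟩ 1) h := by
  induction k generalizing ν h with
  | zero =>
    rw [zero_add, L_one, rep_T q Q hr hk, opT_zero]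
    exact redX_of_ne (by omega) h
  | succ k ih =>
    have hk1 : k < n := by omega
    rw [L_succ (by omega), map_smul, LinearMap.smul_apply, map_mul, map_mul, Module.End.mul_apply,
      Module.End.mul_apply, Submodule.coe_smul, rep_T q Q hr hk]
    have hab : (⟨k, hk1⟩ : Fin n) ≠ ⟨k + 1, hk⟩ := by simp
    have hop : opT q Q ⟨k + 1, hk⟩ = affT ((q : R) - 1) ⟨k, hk1⟩ ⟨k + 1, hk⟩ (regT q n (k + 1)) :=
      opT_pos q Q (i := ⟨k + 1, hk⟩) (by simp)
    have hquad := regT_mul_self (q := q) (R := R) (by omega : 1 ≤ k + 1) hk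
    have key : (rep q Q hr (L (k + 1)) (rep q Q hr (T (k + 1)) (vec hν h)) :
        (Fin n → ℕ) →₀ (Equiv.Perm (Fin n) →₀ R)) =
        mulX (R := R) ⟨k, hk1⟩ (opT q Q ⟨k + 1, hk⟩ (Finsupp.single ν h)) := by
      -- These are the monomials to which the induction hypothesis applies. The operator T_{k+1}
      -- sends the given monomial into their span, since the exponent it moves to position k is at
      -- most the old exponent at k+1.
      set S : Set (Fin n → ℕ) :=
        {μ | μ ∈ box n r n ∧ (∀ j : Fin n, j.val < k → μ j = 0) ∧ μ ⟨k, hk1⟩ + 1 < r} with hS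
      have hSb : S ⊆ box n r n := fun μ hμ => hμ.1
      have h1 : ∀ m (hm : m ∈ Finsupp.supported (Equiv.Perm (Fin n) →₀ R) R S),
          (rep q Q hr (L (k + 1)) (⟨m, Finsupp.supported_mono hSb hm⟩ : truncated R n r) :
            (Fin n → ℕ) →₀ (Equiv.Perm (Fin n) →₀ R)) = mulX (R := R) ⟨k, hk1⟩ m := by
        classical
        have hrd : ∀ m (hm : m ∈ truncated R n r),
            Finsupp.restrictDom (Equiv.Perm (Fin n) →₀ R) R (box n r n) m =
              (⟨m, hm⟩ : truncated R n r) :=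
          fun m hm => LinearMap.congr_fun (Finsupp.restrictDom_comp_subtype (box n r n))
            (⟨m, hm⟩ : truncated R n r)
        intro m hm
        have := eqOn_supported (F := (Submodule.subtype _).comp ((rep q Q hr (L (k + 1))).comp
          (Finsupp.restrictDom _ R (box n r n)))) (G := mulX (R := R) ⟨k, hk1⟩) (fun μ hμ x => ?_) hm
        · rw [← this, LinearMap.comp_apply, LinearMap.comp_apply, hrd m (Finsupp.supported_mono hSb hm)]
          rfl
        · rw [mulX_single, ← ih hk1 μ hμ.1 x hμ.2.1 hμ.2.2, LinearMap.comp_apply,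
            LinearMap.comp_apply, hrd _ (single_mem hμ.1 x)]
          rfl
      have h2 : opT q Q ⟨k + 1, hk⟩ (Finsupp.single ν h) ∈
          Finsupp.supported (Equiv.Perm (Fin n) →₀ R) R S := by
        have hz : ν ⟨k, hk1⟩ = 0 := h0 _ (by simp)
        rw [hop, affT_single, hz, Finset.range_zero, Finset.sum_empty, zero_sub, smul_neg,
          sub_neg_eq_add]
        refine Submodule.add_mem _ (single_mem (S := S) ⟨comp_swap_mem_box hν _ _, fun j hj => ?_, ?_⟩ _)
          (Submodule.smul_mem _ _ (Submodule.sum_mem _ fun j hj => single_mem (S := S)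
            ⟨redistribute_mem_box hν (by simp; omega) (by simp; omega) (Or.inl ⟨by omega, ?_⟩),
              fun i hi => ?_, ?_⟩ _))
        · rw [Function.comp_apply, Equiv.swap_apply_of_ne_of_ne (by rw [ne_eq, Fin.ext_iff]; simp; omega)
            (by rw [ne_eq, Fin.ext_iff]; simp; omega)]
          exact h0 j (by omega)
        · simpa using hk'
        · exact (Finset.mem_range.1 hj).le
        · rw [redistribute, Function.update_of_ne (by rw [ne_eq, Fin.ext_iff]; simp; omega),
            Function.update_of_ne (by rw [ne_eq, Fin.ext_iff]; simp; omega)]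
          exact h0 i (by omega)
        · rw [redistribute, Function.update_of_ne hab, Function.update_self]
          have := Finset.mem_range.1 hj
          omega
      rw [← h1 _ h2]
      congr 2
      exact Subtype.ext (rep_T q Q hr hk _)
    rw [key, hop, ← Module.End.mul_apply, ← Module.End.mul_apply, affT_mulX_affT hab hquad,
      LinearMap.smul_apply, mulX_single, smul_smul]
    simp

theorem rep_mon (hr : 0 < r) (ν : Fin n → ℕ) (hν : ν ∈ box n r n)
    (h : Equiv.Perm (Fin n) →₀ R) :
    rep q Q hr (evL (mon R ν)) (vec ⟨fun _ => hr, fun _ _ => rfl⟩ h) = vec hν h := by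
  induction hN : ∑ j, ν j generalizing ν with
  | zero =>
    have : ν = 0 := by
      funext j
      simpa using (Finset.sum_eq_zero_iff.1 hN) j (Finset.mem_univ j)
    subst this
    simp [mon]
  | succ N ih =>
    have hne : (Finset.univ.filter fun a => ν a ≠ 0).Nonempty := by
      by_contra hc
      rw [Finset.not_nonempty_iff_eq_empty, Finset.filter_eq_empty_iff] at hc
      simp only [Finset.mem_univ, forall_const, not_not] at hc
      simp [hc] at hN
    -- The smallest letter with a nonzero exponent must act last, because `rep_L` requires all
    -- earlier exponents to vanish.
    obtain ⟨a, ha, hmin⟩ := Finset.exists_min_image _ id hne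
    simp only [Finset.mem_filter, Finset.mem_univ, true_and, id] at ha hmin
    have e : ν = Function.update ν a (ν a - 1) + Pi.single a 1 := by
      rw [update_add_single]
      simp [Nat.sub_add_cancel (Nat.pos_of_ne_zero ha)]
    have hμ : Function.update ν a (ν a - 1) ∈ box n r n :=
      update_mem_box hν a (by have := hν.1 a; omega)
    have hs : ∑ j, Function.update ν a (ν a - 1) j = N := by
      have h2 : ∑ j, (Function.update ν a (ν a - 1) + Pi.single a 1 : Fin n → ℕ) j = N + 1 := by rw [← e, hN]
      simp only [Pi.add_apply, Finset.sum_add_distrib, Finset.sum_pi_single', Finset.mem_univ,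
        if_true] at h2
      omega
    have hm : (evL (mon R ν) : AK n q Q) =
        L (a + 1) * evL (mon R (Function.update ν a (ν a - 1))) := by
      rw [← evL_X, ← map_mul]
      congr 1
      conv_lhs => rw [e]
      simp only [mon, Pi.add_apply, pow_add, Finset.prod_mul_distrib]
      rw [mul_comm]
      congr 1
      rw [Finset.prod_eq_single a (fun b _ hb => by simp [hb]) (by simp)]
      simp
    rw [hm, map_mul, Module.End.mul_apply, ih _ hμ hs]
    have h0 : ∀ j : Fin n, j.val < a.val → Function.update ν a (ν a - 1) j = 0 := fun j hj => by
      rw [Function.update_of_ne (by rintro rfl; omega)]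
      by_contra hj'
      have := hmin j hj'
      rw [Fin.le_def] at this
      omega
    have hk' : Function.update ν a (ν a - 1) ⟨a, a.2⟩ + 1 < r := by
      have := hν.1 a
      rw [Fin.eta, Function.update_self]
      omega
    refine Subtype.ext ((rep_L q Q hr a.2 _ hμ h h0 hk').trans ?_)
    show _ = Finsupp.single ν h
    conv_rhs => rw [e]

theorem rep_Tw (hr : 0 < r) (w : Equiv.Perm (Fin n)) (h : Equiv.Perm (Fin n) →₀ R) :
    rep q Q hr (Tw w) (vec ⟨fun _ => hr, fun _ _ => rfl⟩ h) =
      vec ⟨fun _ => hr, fun _ _ => rfl⟩ (regTw q w h) := by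
  induction w using perm_induction with
  | one => simp [regTw_one]
  | mul w i h1 hi hw ih =>
    rw [← T_mul_Tw_of_asc h1 hi hw, map_mul, Module.End.mul_apply, ih, regTw_s_mul h1 hi hw]
    apply Subtype.ext
    rw [rep_T q Q hr hi, opT_pos q Q (i := ⟨i, hi⟩) h1]
    exact affT_single_zero _ _ _ _ _

/-- The action of the algebra on the constant `1`. -/
noncomputable def act (hr : 0 < r) :
    AK n q Q →ₗ[R] (Fin n → ℕ) →₀ (Equiv.Perm (Fin n) →₀ R) where
  toFun x := rep q Q hr x (vec ⟨fun _ => hr, fun _ _ => rfl⟩ (Finsupp.single 1 1))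
  map_add' x y := by simp
  map_smul' c x := by simp

theorem act_apply (hr : 0 < r) (ν : Fin n → ℕ) (hν : ∀ j, ν j < r) (x y : Equiv.Perm (Fin n)) :
    act q Q hr (Lmon 0 ν * Tw x * Tw y) =
      Finsupp.single ν (regTw q x (Finsupp.single y 1)) := by
  have hν' : ν ∈ box n r n := ⟨hν, fun j hj => absurd hj (by omega)⟩
  show ((rep q Q hr (Lmon 0 ν * Tw x * Tw y)) _ : (Fin n → ℕ) →₀ (Equiv.Perm (Fin n) →₀ R)) = _
  rw [map_mul, map_mul, Module.End.mul_apply, Module.End.mul_apply, rep_Tw, rep_Tw, Lmon_zero_eq,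
    rep_mon q Q hr ν hν', regTw_single_one]
  rfl

theorem act_apply' (hr : 0 < r) (ν : Fin n → ℕ) (hν : ∀ j, ν j < r) (x : Equiv.Perm (Fin n)) :
    act q Q hr (Lmon 0 ν * Tw x) = Finsupp.single ν (Finsupp.single x 1) := by
  have := act_apply q Q hr ν hν x 1
  rwa [Tw_one, mul_one, regTw_single_one] at this

/-- The standard elements are a basis: linear maps may be prescribed on them. -/
theorem exists_linearMap (hr : 0 < r) {N : Type*} [AddCommGroup N] [Module R N]
    (f : (Fin n → ℕ) → Equiv.Perm (Fin n) → N) : ∃ F : AK n q Q →ₗ[R] N,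
      ∀ ν : Fin n → ℕ, (∀ j, ν j < r) → ∀ x, F (Lmon 0 ν * Tw x) = f ν x := by
  refine ⟨(Finsupp.lsum R fun ν => Finsupp.lift N R _ (f ν)).comp (act q Q hr), fun ν hν x => ?_⟩
  rw [LinearMap.comp_apply, act_apply' q Q hr ν hν, Finsupp.lsum_single, Finsupp.lift_apply,
    Finsupp.sum_single_index (by simp), one_smul]

/-- The trace is the coefficient of the action on 1 at exponent 0 and the identity permutation. A
nonzero monomial contributes nothing there, and otherwise the value is that of the Iwahori–Hecke
trace. -/
theorem exists_canonicalTrace (hr : 0 < r) : ∃ τ : AK n q Q →ₗ[R] R, IsCanonicalTrace τ := by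
  classical
  refine ⟨(Finsupp.lapply (1 : Equiv.Perm (Fin n))).comp ((Finsupp.lapply 0).comp (act q Q hr)),
    fun ν hν x y => ?_⟩
  rw [LinearMap.comp_apply, LinearMap.comp_apply, act_apply q Q hr ν hν, Finsupp.lapply_apply,
    Finsupp.lapply_apply, Finsupp.single_apply]
  by_cases h : ν = 0
  · subst h
    simp only [if_true, Pi.zero_apply, implies_true, true_and, regTw_single_apply_one]
  · have h' : ¬ ∀ j, ν j = 0 := fun h' => h (funext h')
    simp [h, h']

end Rep

end CycHecke

open scoped TensorProduct
namespace CycHecke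

/-! ### Existence and uniqueness of the linear maps -/

section Existence

variable {R : Type*} [CommRing R] {n r : ℕ} {q : Rˣ} {Q : Fin r → R}

theorem span_std_range (hr : 0 < r) : Submodule.span R (Set.range
    fun z : {ν : Fin n → ℕ // ∀ j, ν j < r} × Equiv.Perm (Fin n) =>
      (Lmon 0 z.1.1 * Tw z.2 : AK n q Q)) = ⊤ := by
  rw [← span_std (n := n) (q := q) (Q := Q) hr]
  congr 1
  ext y
  constructor
  · rintro ⟨⟨ν, x⟩, rfl⟩; exact ⟨ν.1, ν.2, x, rfl⟩
  · rintro ⟨ν, hν, x, rfl⟩; exact ⟨⟨⟨ν, hν⟩, x⟩, rfl⟩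

theorem ext_std (hr : 0 < r) {N : Type*} [AddCommGroup N] [Module R N] {F G : AK n q Q →ₗ[R] N}
    (h : ∀ ν : Fin n → ℕ, (∀ j, ν j < r) → ∀ x, F (Lmon 0 ν * Tw x) = G (Lmon 0 ν * Tw x)) :
    F = G :=
  LinearMap.ext_on_range (span_std_range hr) fun z => h z.1.1 z.1.2 z.2

theorem IsCanonicalTrace.apply_std {τ : AK n q Q →ₗ[R] R} (hτ : IsCanonicalTrace τ)
    {ν : Fin n → ℕ} (hν : ∀ j, ν j < r) (x : Equiv.Perm (Fin n)) [Decidable ((∀ j, ν j = 0) ∧ x = 1)] :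
    τ (Lmon 0 ν * Tw x) = if (∀ j, ν j = 0) ∧ x = 1 then 1 else 0 := by
  have := hτ ν hν x 1
  rw [Tw_one, mul_one, inv_one] at this
  rw [this]
  by_cases h : (∀ j, ν j = 0) ∧ x = 1
  · rw [if_pos h, if_pos h, h.2, len_one, pow_zero]
  · rw [if_neg h, if_neg h]

/-- Uniqueness needs only the values with y = 1, which are prescribed on a spanning set; consistency
with the values for other y is part of existence. -/
theorem existsUnique_canonicalTrace (hr : 0 < r) :
    ∃! τ : AK n q Q →ₗ[R] R, IsCanonicalTrace τ := by
  classical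
  obtain ⟨τ, hτ⟩ := exists_canonicalTrace (n := n) q Q hr
  refine ⟨τ, hτ, fun τ' hτ' => ext_std hr fun ν hν x => ?_⟩
  rw [hτ.apply_std hν, hτ'.apply_std hν]

variable {p d : ℕ} {b : Fin p → ℕ} {ε : Rˣ} {P : Fin d → Rˣ}

theorem ext_stdB (hd : 0 < d) {N : Type*} [AddCommGroup N] [Module R N]
    {F G : Hb b ε q P →ₗ[R] N}
    (h : ∀ (a : ∀ t : Fin p, Fin (b t) → ℕ), (∀ t j, a t j < d) →
      ∀ x : ∀ t : Fin p, Equiv.Perm (Fin (b t)),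
        F (PiTensorProduct.tprod R fun t : Fin p =>
          (Lmon 0 (a t) * Tw (x t) : Hfac (b t) (t.val + 1) ε q P)) =
        G (PiTensorProduct.tprod R fun t : Fin p =>
          (Lmon 0 (a t) * Tw (x t) : Hfac (b t) (t.val + 1) ε q P))) : F = G :=
  PiTensorProduct.ext_of_span_eq_top
    (g := fun (t : Fin p) (z : {ν : Fin (b t) → ℕ // ∀ j, ν j < d} × Equiv.Perm (Fin (b t))) =>
      (Lmon 0 z.1.1 * Tw z.2 : Hfac (b t) (t.val + 1) ε q P))
    (fun _ => span_std_range hd) fun j =>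
      h (fun t => (j t).1.1) (fun t => (j t).1.2) fun t => (j t).2

theorem IsCanonicalTraceB.apply_std {τ : Hb b ε q P →ₗ[R] R} (hτ : IsCanonicalTraceB τ)
    {a : ∀ t : Fin p, Fin (b t) → ℕ} (ha : ∀ t j, a t j < d)
    (x : ∀ t : Fin p, Equiv.Perm (Fin (b t))) [Decidable (∀ t, (∀ j, a t j = 0) ∧ x t = 1)] :
    τ (PiTensorProduct.tprod R fun t : Fin p =>
        (Lmon 0 (a t) * Tw (x t) : Hfac (b t) (t.val + 1) ε q P)) =
      if ∀ t, (∀ j, a t j = 0) ∧ x t = 1 then 1 else 0 := by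
  have := hτ a ha x 1
  simp only [Pi.one_apply, Tw_one, mul_one, inv_one] at this
  rw [this]
  by_cases h : ∀ t, (∀ j, a t j = 0) ∧ x t = 1
  · rw [if_pos h, if_pos h, Finset.sum_eq_zero fun t _ => by rw [(h t).2, len_one], pow_zero]
  · rw [if_neg h, if_neg h]

theorem existsUnique_canonicalTraceB (hd : 0 < d) :
    ∃! τ : Hb b ε q P →ₗ[R] R, IsCanonicalTraceB τ := by
  classical
  have h (t : Fin p) := exists_canonicalTrace (n := b t) q
    (fun i : Fin d => ((ε ^ (t.val + 1) * P i : Rˣ) : R)) hd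
  choose σ hσ using h
  refine ⟨PiTensorProduct.lift
    ((MultilinearMap.mkPiAlgebra R (Fin p) R).compLinearMap σ), fun a ha x y => ?_,
    fun τ' hτ' => ?_⟩
  · rw [PiTensorProduct.lift.tprod, MultilinearMap.compLinearMap_apply,
      MultilinearMap.mkPiAlgebra_apply,
      Finset.prod_congr rfl fun t _ => hσ t (a t) (ha t) (x t) (y t)]
    by_cases h : ∀ t, (∀ j, a t j = 0) ∧ x t = (y t)⁻¹
    · rw [if_pos h, ← Finset.prod_pow_eq_pow_sum]
      exact Finset.prod_congr rfl fun t _ => if_pos (h t)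
    · rw [if_neg h]
      obtain ⟨t, ht⟩ := not_forall.1 h
      exact Finset.prod_eq_zero (Finset.mem_univ t) (if_neg ht)
  · refine ext_stdB hd fun a ha x => ?_
    rw [hτ'.apply_std ha, PiTensorProduct.lift.tprod, MultilinearMap.compLinearMap_apply,
      MultilinearMap.mkPiAlgebra_apply,
      Finset.prod_congr rfl fun t _ => (hσ t).apply_std (ha t) (x t)]
    by_cases h : ∀ t, (∀ j, a t j = 0) ∧ x t = 1
    · rw [if_pos h, Finset.prod_eq_one fun t _ => if_pos (h t)]
    · rw [if_neg h]
      obtain ⟨t, ht⟩ := not_forall.1 h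
      exact (Finset.prod_eq_zero (Finset.mem_univ t) (if_neg ht)).symm

theorem existsUnique_thetaHat (hd : 0 < d) :
    ∃! Θ : Hb b ε q P →ₗ[R] H p n ε q P, IsThetaHat n Θ := by
  have h (t : Fin p) := exists_linearMap (n := b t) q
    (fun i : Fin d => ((ε ^ (t.val + 1) * P i : Rˣ) : R)) hd (N := H p n ε q P)
    fun ν x => Lmon (offset b t) ν * Tw (shift n (offset b t) x)
  choose σ hσ using h
  -- The factors are multiplied in the order t = p,…,1, so the product is formed in the opposite
  -- algebra, where the increasing order becomes the required one. Only linearity in each factor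
  -- matters.
  have key : IsThetaHat n (PiTensorProduct.lift
      ((MulOpposite.opLinearEquiv R (M := H p n ε q P)).symm.toLinearMap.compMultilinearMap
        ((MultilinearMap.mkPiAlgebraFin R p (H p n ε q P)ᵐᵒᵖ).compLinearMap fun t =>
          (MulOpposite.opLinearEquiv R (M := H p n ε q P)).toLinearMap.comp (σ t)))) := by
    intro a ha x
    rw [PiTensorProduct.lift.tprod, LinearMap.compMultilinearMap_apply,
      MultilinearMap.compLinearMap_apply, MultilinearMap.mkPiAlgebraFin_apply]
    simp only [LinearMap.comp_apply, hσ _ _ (ha _)]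
    simp [MulOpposite.unop_list_prod, List.map_ofFn, Function.comp_def]
  exact ⟨_, key, fun Θ' hΘ' => ext_stdB hd fun a ha x => (hΘ' a ha x).trans (key a ha x).symm⟩

end Existence

end CycHecke

open scoped TensorProduct
namespace CycHecke

/-! ### Parabolic subgroups and lengths -/

section Fixing

variable {n : ℕ}

theorem inv_mem_fixing {c : ℕ} {x : Equiv.Perm (Fin n)} (hx : x ∈ fixing n c) :
    x⁻¹ ∈ fixing n c := fun j hj => by rw [Equiv.Perm.inv_eq_iff_eq, hx j hj]

theorem mul_mem_fixing {c : ℕ} {x y : Equiv.Perm (Fin n)} (hx : x ∈ fixing n c)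
    (hy : y ∈ fixing n c) : x * y ∈ fixing n c := fun j hj => by
  rw [Equiv.Perm.mul_apply, hy j hj, hx j hj]

theorem fixing_lt {c : ℕ} {x : Equiv.Perm (Fin n)} (hx : x ∈ fixing n c) {j : Fin n}
    (hj : j.val < c) : (x j).val < c := by
  by_contra h
  have := x.injective (hx (x j) (not_lt.1 h))
  rw [this] at h
  exact h hj

theorem lt_of_not_asc {c : ℕ} {x : Equiv.Perm (Fin n)} (hx : x ∈ fixing n c) {i : ℕ} (h1 : 1 ≤ i)
    (hi : i < n) (h : ¬ Asc x i) : i < c := by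
  by_contra hc
  refine h ⟨hi, ?_⟩
  have hx' := inv_mem_fixing hx
  rw [hx' ⟨i, hi⟩ (not_lt.1 hc)]
  rcases Nat.lt_or_ge (i - 1) c with h' | h'
  · exact Fin.lt_def.2 (lt_of_lt_of_le (fixing_lt hx' (j := ⟨i - 1, by omega⟩) h') (not_lt.1 hc))
  · rw [hx' ⟨i - 1, by omega⟩ h']
    exact Fin.lt_def.2 (show i - 1 < i by omega)

/-- A descent of a permutation of the first c letters is smaller than c, so stripping descents stays
inside the parabolic subgroup. -/
theorem fixing_induction {c : ℕ} (hc : c ≤ n) {P : ∀ y : Equiv.Perm (Fin n), y ∈ fixing n c → Prop}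
    (one : P 1 (one_mem_fixing n c))
    (mul : ∀ y i (h1 : 1 ≤ i) (hi : i < c) (hy : y ∈ fixing n c), Asc y i → P y hy →
      P (s n i * y) (s_mul_mem_fixing h1 hi hc hy))
    {y : Equiv.Perm (Fin n)} (hy : y ∈ fixing n c) : P y hy := by
  induction y using perm_induction with
  | one => exact one
  | mul w i h1 hi hw ih =>
    have hic : i < c := lt_of_not_asc hy h1 hi fun h => (asc_s_mul h1 hi).1 h hw
    have hwc : w ∈ fixing n c := by
      have := s_mul_mem_fixing h1 hic hc hy
      rwa [s_mul_cancel] at this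
    exact mul w i h1 hic hwc hw (ih hwc)

/-- Since v⁻¹ is increasing on the first c letters, v is shortest in its coset 𝔖_c v: every ascent
of y is an ascent of y v. -/
theorem len_fixing_mul {c : ℕ} (hc : c ≤ n) {y v : Equiv.Perm (Fin n)} (hy : y ∈ fixing n c)
    (hv : ∀ j k : Fin n, j < k → k.val < c → v⁻¹ j < v⁻¹ k) : len (y * v) = len y + len v := by
  induction hy using fixing_induction hc with
  | one => simp
  | mul y i h1 hi hy hasc ih =>
    obtain ⟨hin, hlt⟩ := hasc
    have hy' := inv_mem_fixing hy
    have : Asc (y * v) i := ⟨hin, by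
      rw [mul_inv_rev, Equiv.Perm.mul_apply, Equiv.Perm.mul_apply]
      exact hv _ _ hlt (fixing_lt hy' (j := ⟨i, hin⟩) hi)⟩
    rw [mul_assoc, len_of_asc h1 this, ih, len_of_asc h1 ⟨hin, hlt⟩]
    omega

/-- `w` interchanges the first `m` letters with the following `a` letters, preserving the order
within both blocks. -/
structure IsBlockSwap (n a m : ℕ) (w : Equiv.Perm (Fin n)) : Prop where
  le : a + m ≤ n
  left : ∀ x : Fin n, x.val < m → (w x).val = x + a
  right : ∀ x : Fin n, m ≤ x.val → x.val < m + a → (w x).val = x - m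
  rest : ∀ x : Fin n, m + a ≤ x.val → (w x).val = x

namespace IsBlockSwap

variable {a m : ℕ} {w : Equiv.Perm (Fin n)}

theorem inv (h : IsBlockSwap n a m w) : IsBlockSwap n m a w⁻¹ := by
  have key : ∀ x y : Fin n, (w y).val = x → (w⁻¹ x) = y := fun x y e => by
    rw [Equiv.Perm.inv_eq_iff_eq]; exact Fin.ext e.symm
  have hle := h.le
  refine ⟨by omega, fun x hx => ?_, fun x hx hx' => ?_, fun x hx => ?_⟩
  · rw [key x ⟨x + m, by omega⟩ (by rw [h.right _ (by simp) (by simp; omega)]; simp)]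
  · rw [key x ⟨x - a, by omega⟩ (by rw [h.left _ (by simp; omega)]; simp; omega)]
  · rw [key x x (h.rest x (by omega))]

theorem mono (h : IsBlockSwap n a m w) {j k : Fin n} (hjk : j < k) (hk : k.val < m) :
    w j < w k := by
  rw [Fin.lt_def] at *
  rw [h.left j (by omega), h.left k hk]
  omega

/-- An inversion (i, j) of w has i among the first m letters and j among the next a. The elements x
and y only permute letters inside these blocks, so (y⁻¹ i, y⁻¹ j) is an inversion of x w y. Thus w
is shortest in its double coset. -/
theorem le_len_mul_mul (h : IsBlockSwap n a m w) {x y : Equiv.Perm (Fin n)} (hx : x ∈ fixing n a)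
    (hy : y ∈ fixing n m) : len w ≤ len (x * w * y) := by
  rw [len_eq_card, len_eq_card]
  refine Finset.card_le_card_of_injOn (fun z => (y⁻¹ z.1, y⁻¹ z.2)) (fun z hz => ?_)
    fun z _ z' _ e => ?_
  · obtain ⟨i, j⟩ := z
    have hz' : i < j ∧ w j < w i := by simpa [inversions] using hz
    obtain ⟨hij, hw⟩ := hz'
    rw [Fin.lt_def] at hij hw
    have hi : i.val < m := by
      by_contra hi
      rcases Nat.lt_or_ge i.val (m + a) with h1 | h1
      · rcases Nat.lt_or_ge j.val (m + a) with h2 | h2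
        · rw [h.right i (by omega) h1, h.right j (by omega) h2] at hw; omega
        · rw [h.right i (by omega) h1, h.rest j (by omega)] at hw; omega
      · rw [h.rest i h1, h.rest j (by omega)] at hw; omega
    have hj : m ≤ j.val ∧ j.val < m + a := by
      constructor
      · by_contra hj
        rw [h.left i hi, h.left j (by omega)] at hw; omega
      · by_contra hj
        rw [h.left i hi, h.rest j (by omega)] at hw; omega
    have ey : y⁻¹ j = j := inv_mem_fixing hy j hj.1
    have hyi : (y⁻¹ i).val < m := fixing_lt (inv_mem_fixing hy) hi
    have hwj := h.right j hj.1 hj.2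
    have hwi := h.left i hi
    have hxi : x (w i) = w i := hx _ (by omega)
    have hxj : (x (w j)).val < a := fixing_lt hx (by omega)
    have eyj : y j = j := hy j hj.1
    have eyi : y (y⁻¹ i) = i := y.apply_symm_apply i
    simp only [inversions, Finset.coe_filter, Finset.mem_univ, true_and, Set.mem_ofPred_eq,
      Equiv.Perm.mul_apply, Fin.lt_def, ey, eyj, eyi, hxi]
    omega
  · simpa [Prod.ext_iff] using e

theorem len_fixing_mul (h : IsBlockSwap n a m w) {x : Equiv.Perm (Fin n)} (hx : x ∈ fixing n a) :
    len (x * w) = len x + len w :=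
  CycHecke.len_fixing_mul (by have := h.le; omega) hx fun _ _ hjk hk => h.inv.mono hjk hk

/-- The first m letters are sent by w to letters beyond the a-th, which x fixes. Hence 𝔖_a and w 𝔖_m
w⁻¹ intersect trivially. -/
theorem eq_one (h : IsBlockSwap n a m w) {x y : Equiv.Perm (Fin n)} (hx : x ∈ fixing n a)
    (hy : y ∈ fixing n m) (e : x * w = w * y) : x = 1 ∧ y = 1 := by
  have hy1 : y = 1 := by
    ext j
    have e' := congrArg (fun z : Equiv.Perm (Fin n) => z j) e
    simp only [Equiv.Perm.mul_apply] at e'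
    rcases Nat.lt_or_ge j.val m with hj | hj
    · have h1 := h.left j hj
      rw [hx _ (by omega)] at e'
      rw [← w.injective e']; rfl
    · rw [hy j hj]; rfl
  subst hy1
  exact ⟨by simpa using e, rfl⟩

end IsBlockSwap

end Fixing

/-! ### Moving Jucys–Murphy elements through `T_w` -/

section Moving

variable {R : Type*} [CommRing R] {n r : ℕ} {q : Rˣ} {Q : Fin r → R}

theorem mon_add (ν μ : Fin n → ℕ) : mon R (ν + μ) = mon R ν * mon R μ := by
  simp [mon, pow_add, Finset.prod_mul_distrib]

@[simp] theorem mon_zero : mon R (0 : Fin n → ℕ) = 1 := by simp [mon]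

theorem rename_mon (w : Equiv.Perm (Fin n)) (ν : Fin n → ℕ) :
    MvPolynomial.rename w (mon R ν) = mon R (ν ∘ ⇑w⁻¹) := by
  rw [mon, mon, map_prod, ← Equiv.prod_comp w (fun j => MvPolynomial.X j ^ (ν ∘ ⇑w⁻¹) j)]
  simp

variable (n q Q) in
/-- The span of `L^λ T_u` with exponents `< r` and `ℓ(u) < N`. -/
noncomputable def lowR (N : ℕ) : Submodule R (AK n q Q) :=
  Submodule.span R {z | ∃ ν ∈ box n r n, ∃ u, len u < N ∧ z = evL (mon R ν) * Tw u}

variable (n q Q) in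
/-- The span of `T_u L^λ` with exponents `< r` and `ℓ(u) < N`. -/
noncomputable def lowL (N : ℕ) : Submodule R (AK n q Q) :=
  Submodule.span R {z | ∃ ν ∈ box n r n, ∃ u, len u < N ∧ z = Tw u * evL (mon R ν)}

theorem lowR_mono {N N' : ℕ} (h : N ≤ N') : lowR n q Q N ≤ lowR n q Q N' :=
  Submodule.span_mono fun _ ⟨ν, hν, u, hu, e⟩ => ⟨ν, hν, u, by omega, e⟩

theorem lowL_mono {N N' : ℕ} (h : N ≤ N') : lowL n q Q N ≤ lowL n q Q N' :=
  Submodule.span_mono fun _ ⟨ν, hν, u, hu, e⟩ => ⟨ν, hν, u, by omega, e⟩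

/-- A linear map that sends generators into a submodule sends the span into it. -/
theorem map_mem_of_span {M N : Type*} [AddCommGroup M] [Module R M] [AddCommGroup N] [Module R N]
    {S : Set M} {P : Submodule R N} (F : M →ₗ[R] N) (h : ∀ z ∈ S, F z ∈ P) {z : M}
    (hz : z ∈ Submodule.span R S) : F z ∈ P :=
  (Submodule.span_le (p := P.comap F)).2 h hz

theorem span_box_mul_Tw_mem_lowR {N : ℕ} {u : Equiv.Perm (Fin n)} (hu : len u < N) {Z : AK n q Q}
    (hZ : Z ∈ Submodule.span R ((fun μ => evL (mon R μ)) '' box n r n)) :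
    Z * Tw u ∈ lowR n q Q N := by
  refine map_mem_of_span (LinearMap.mulRight R (Tw u)) ?_ hZ
  rintro _ ⟨ν, hν, rfl⟩
  exact Submodule.subset_span ⟨ν, hν, u, hu, rfl⟩

theorem T_mul_mem_lowR {i N : ℕ} (h1 : 1 ≤ i) (hi : i < n) {z : AK n q Q}
    (hz : z ∈ lowR n q Q N) : T i * z ∈ lowR n q Q (N + 1) := by
  refine map_mem_of_span (LinearMap.mulLeft R (T i)) ?_ hz
  rintro _ ⟨ν, hν, u, hu, rfl⟩
  obtain ⟨Z, hZ, e⟩ := bernstein (q := q) (Q := Q) h1 hi le_rfl hν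
  rw [LinearMap.mulLeft_apply, ← mul_assoc, e, add_mul, mul_assoc]
  refine Submodule.add_mem _ ?_ (span_box_mul_Tw_mem_lowR (by omega) hZ)
  refine map_mem_of_span (LinearMap.mulLeft R (evL (mon R (ν ∘ s n i)))) ?_ (T_mul_Tw_mem h1 hi u)
  have := len_s_mul_le u h1 hi
  rintro _ (rfl | rfl)
  · exact Submodule.subset_span ⟨_, comp_s_mem_box hν h1 hi le_rfl, _, by omega, rfl⟩
  · exact Submodule.subset_span ⟨_, comp_s_mem_box hν h1 hi le_rfl, _, by omega, rfl⟩

theorem T_mul_mem_lowL {i N : ℕ} (h1 : 1 ≤ i) (hi : i < n) {z : AK n q Q}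
    (hz : z ∈ lowL n q Q N) : T i * z ∈ lowL n q Q (N + 1) := by
  refine map_mem_of_span (LinearMap.mulLeft R (T i)) ?_ hz
  rintro _ ⟨ν, hν, u, hu, rfl⟩
  rw [LinearMap.mulLeft_apply, ← mul_assoc]
  refine map_mem_of_span (LinearMap.mulRight R (evL (mon R ν))) ?_ (T_mul_Tw_mem h1 hi u)
  have := len_s_mul_le u h1 hi
  rintro _ (rfl | rfl)
  · exact Submodule.subset_span ⟨_, hν, _, by omega, rfl⟩
  · exact Submodule.subset_span ⟨_, hν, _, by omega, rfl⟩

theorem comp_mem_box {ν : Fin n → ℕ} (hν : ν ∈ box n r n) (w : Equiv.Perm (Fin n)) :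
    ν ∘ w ∈ box n r n := ⟨fun _ => hν.1 _, fun j hj => absurd hj (by omega)⟩

/-- Apply the Bernstein relation letter by letter along a reduced word: the leading term carries the
permuted exponents, and each correction loses a letter of w. -/
theorem Tw_mul_evL_mon (w : Equiv.Perm (Fin n)) {ν : Fin n → ℕ} (hν : ν ∈ box n r n) :
    (Tw w * evL (mon R ν) - evL (mon R (ν ∘ ⇑w⁻¹)) * Tw w : AK n q Q) ∈ lowR n q Q (len w) := by
  induction w using perm_induction with
  | one => simp
  | mul w i h1 hi hw ih =>
    obtain ⟨Z, hZ, e⟩ := bernstein (q := q) (Q := Q) h1 hi le_rfl (comp_mem_box hν w⁻¹)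
    have : (Tw (s n i * w) * evL (mon R ν) - evL (mon R (ν ∘ ⇑(s n i * w)⁻¹)) * Tw (s n i * w) :
        AK n q Q) = T i * (Tw w * evL (mon R ν) - evL (mon R (ν ∘ ⇑w⁻¹)) * Tw w) + Z * Tw w := by
      rw [← T_mul_Tw_of_asc h1 hi hw, mul_inv_rev, s_inv, Equiv.Perm.coe_mul, ← Function.comp_assoc,
        mul_sub, ← mul_assoc (T i) (evL _), e]
      noncomm_ring
    rw [this, len_of_asc h1 hw]
    exact Submodule.add_mem _ (T_mul_mem_lowR h1 hi ih) (span_box_mul_Tw_mem_lowR (by omega) hZ)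

theorem evL_mon_mul_Tw (w : Equiv.Perm (Fin n)) {ν : Fin n → ℕ} (hν : ν ∈ box n r n) :
    (evL (mon R (ν ∘ ⇑w⁻¹)) * Tw w - Tw w * evL (mon R ν) : AK n q Q) ∈ lowL n q Q (len w) := by
  induction w using perm_induction generalizing ν with
  | one => simp
  | mul w i h1 hi hw ih =>
    obtain ⟨Z, hZ, e⟩ := bernstein' (q := q) (Q := Q) h1 hi le_rfl
      (comp_mem_box hν (s n i * w)⁻¹)
    have e2 : (ν ∘ ⇑(s n i * w)⁻¹) ∘ s n i = ν ∘ ⇑w⁻¹ := by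
      rw [Function.comp_assoc, ← Equiv.Perm.coe_mul, mul_inv_rev, mul_assoc, s_inv, s_mul_self,
        mul_one]
    rw [e2] at e
    have : (evL (mon R (ν ∘ ⇑(s n i * w)⁻¹)) * Tw (s n i * w) - Tw (s n i * w) * evL (mon R ν) :
        AK n q Q) = T i * (evL (mon R (ν ∘ ⇑w⁻¹)) * Tw w - Tw w * evL (mon R ν)) + Z * Tw w := by
      rw [← T_mul_Tw_of_asc h1 hi hw, ← mul_assoc (evL _), e]
      noncomm_ring
    rw [this, len_of_asc h1 hw]
    refine Submodule.add_mem _ (T_mul_mem_lowL h1 hi (ih hν)) ?_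
    refine map_mem_of_span (LinearMap.mulRight R (Tw w)) ?_ hZ
    rintro _ ⟨μ, hμ, rfl⟩
    -- The correction Z T_w has its monomials on the wrong side. The induction hypothesis, for the
    -- exponents μ ∘ w instead of ν, moves them to the right of T_w.
    have h2 := ih (comp_mem_box hμ w)
    have e3 : (μ ∘ w) ∘ ⇑w⁻¹ = μ := by
      rw [Function.comp_assoc, ← Equiv.Perm.coe_mul, mul_inv_cancel]; rfl
    rw [e3] at h2
    show evL (mon R μ) * Tw w ∈ _
    rw [← sub_add_cancel (evL (mon R μ) * Tw w) (Tw w * evL (mon R (μ ∘ w)))]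
    exact Submodule.add_mem _ (lowL_mono (by omega) h2)
      (Submodule.subset_span ⟨_, comp_mem_box hμ w, w, by omega, rfl⟩)

theorem lowL_le_lowR (N : ℕ) : lowL n q Q N ≤ lowR n q Q N := by
  refine Submodule.span_le.2 ?_
  rintro _ ⟨ν, hν, u, hu, rfl⟩
  show Tw u * evL (mon R ν) ∈ lowR n q Q N
  rw [← sub_add_cancel (Tw u * evL (mon R ν)) (evL (mon R (ν ∘ ⇑u⁻¹)) * Tw u)]
  exact Submodule.add_mem _ (lowR_mono hu.le (Tw_mul_evL_mon u hν))
    (Submodule.subset_span ⟨_, comp_mem_box hν _, u, hu, rfl⟩)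

theorem T_mem_subAK {i c : ℕ} (hi : i < c) : (T i : AK n q Q) ∈ subAK n q Q c :=
  Algebra.subset_adjoin ⟨i, hi, rfl⟩

theorem Tw_mem_subAK {c : ℕ} (hc : c ≤ n) {y : Equiv.Perm (Fin n)} (hy : y ∈ fixing n c) :
    (Tw y : AK n q Q) ∈ subAK n q Q c := by
  induction hy using fixing_induction hc with
  | one => simp
  | mul y i h1 hi hy hasc ih =>
    rw [← T_mul_Tw_of_asc h1 (by omega) hasc]
    exact Subalgebra.mul_mem _ (T_mem_subAK hi) ih

theorem L_mem_subAK {c k : ℕ} (h1 : 1 ≤ k) (hk : k ≤ c) : (L k : AK n q Q) ∈ subAK n q Q c := by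
  induction k, h1 using Nat.le_induction with
  | base => exact T_mem_subAK (by omega)
  | succ k hk' ih =>
    rw [L_succ hk']
    exact Subalgebra.smul_mem _ (Subalgebra.mul_mem _ (Subalgebra.mul_mem _ (T_mem_subAK (by omega))
      (ih (by omega))) (T_mem_subAK (by omega))) _

theorem evL_mon_mem_subAK {c : ℕ} {ν : Fin n → ℕ} (hν : ∀ j : Fin n, c ≤ j → ν j = 0) :
    (evL (mon R ν) : AK n q Q) ∈ subAK n q Q c := by
  refine Subalgebra.prod_mem ((subAK n q Q c).comap evL) fun j _ => ?_
  by_cases hj : c ≤ j.val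
  · rw [hν j hj, pow_zero]; exact Subalgebra.one_mem _
  · refine Subalgebra.pow_mem _ ?_ _
    rw [Subalgebra.mem_comap, evL_X]
    exact L_mem_subAK (by omega) (by omega)

theorem commute_T_evL_mon {i : ℕ} (hi : i < n) {ν : Fin n → ℕ}
    (hν : ∀ j : Fin n, j.val + 1 = i ∨ j.val = i → ν j = 0) :
    Commute (T i : AK n q Q) (evL (mon R ν)) := by
  have : mon R ν = ∏ j ∈ Finset.univ.filter (fun j : Fin n => ν j ≠ 0), MvPolynomial.X j ^ ν j := by
    rw [mon, Finset.prod_filter_of_ne]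
    intro j _ h h'
    simp [h'] at h
  rw [this]
  refine T_comm_evL_prod hi _ _ fun l hl => ?_
  have := (Finset.mem_filter.1 hl).2
  exact ⟨fun h => this (hν l (Or.inl h)), fun h => this (hν l (Or.inr h))⟩

theorem commute_Tw_evL_mon {c : ℕ} (hc : c ≤ n) {y : Equiv.Perm (Fin n)} (hy : y ∈ fixing n c)
    {ν : Fin n → ℕ} (hν : ∀ j : Fin n, j.val < c → ν j = 0) :
    Commute (Tw y : AK n q Q) (evL (mon R ν)) := by
  induction hy using fixing_induction hc with
  | one => simp
  | mul y i h1 hi hy hasc ih =>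
    rw [← T_mul_Tw_of_asc h1 (by omega) hasc]
    exact Commute.mul_left (commute_T_evL_mon (by omega) fun j hj => hν j (by omega)) ih

/-- Left multiplication by T_i with i < c, at an ascent or not, never leaves the coset 𝔖_c u. -/
theorem Tw_mul_Tw_mem_span {c : ℕ} (hc : c ≤ n) {x : Equiv.Perm (Fin n)} (hx : x ∈ fixing n c)
    (u : Equiv.Perm (Fin n)) :
    (Tw x * Tw u : AK n q Q) ∈ Submodule.span R {z | ∃ x' ∈ fixing n c, z = Tw (x' * u)} := by
  induction hx using fixing_induction hc with
  | one => exact Submodule.subset_span ⟨1, one_mem_fixing n c, by simp⟩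
  | mul x i h1 hi hx hasc ih =>
    rw [← T_mul_Tw_of_asc h1 (by omega) hasc, mul_assoc]
    refine map_mem_of_span (LinearMap.mulLeft R (T i)) ?_ ih
    rintro _ ⟨x', hx', rfl⟩
    refine Submodule.span_le.2 ?_ (T_mul_Tw_mem h1 (by omega) (x' * u))
    rintro _ (rfl | rfl)
    · exact Submodule.subset_span ⟨s n i * x', s_mul_mem_fixing h1 hi hc hx', by rw [mul_assoc]⟩
    · exact Submodule.subset_span ⟨x', hx', rfl⟩

end Moving

end CycHecke

open scoped TensorProduct
namespace CycHecke

/-! ### The trace of `A g(L_{a+1}, …, L_{a+m}) T_w B T_{w⁻¹}` for a block interchange `w` -/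

section KeyTrace

variable {R : Type*} [CommRing R] {n r : ℕ} {q : Rˣ} {Q : Fin r → R}

theorem exists_split {ν : Fin n → ℕ} (hν : ν ∈ box n r n) (c : ℕ) :
    ∃ lo ∈ box n r c, ∃ hi ∈ box n r n, (∀ j : Fin n, j.val < c → hi j = 0) ∧ ν = lo + hi := by
  refine ⟨fun j => if j.val < c then ν j else 0, ⟨fun j => ?_, fun j hj => if_neg (by omega)⟩,
    fun j => if j.val < c then 0 else ν j, ⟨fun j => ?_, fun j hj => absurd hj (by omega)⟩,
    fun j hj => if_pos hj, funext fun j => ?_⟩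
  · have := hν.1 j
    dsimp only; split_ifs <;> omega
  · have := hν.1 j
    dsimp only; split_ifs <;> omega
  · simp only [Pi.add_apply]; split_ifs <;> simp

theorem add_mem_box {c : ℕ} {κ μ : Fin n → ℕ} (hκ : κ ∈ box n r c) (hμ : μ ∈ box n r n)
    (h : ∀ j : Fin n, j.val < c → μ j = 0) : κ + μ ∈ box n r n := by
  refine ⟨fun j => ?_, fun j hj => absurd hj (by omega)⟩
  rcases Nat.lt_or_ge j.val c with hj | hj
  · simpa [h j hj] using hκ.1 j
  · simpa [hκ.2 j hj] using hμ.1 j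

theorem box_mono {c : ℕ} {κ : Fin n → ℕ} (hκ : κ ∈ box n r c) : κ ∈ box n r n :=
  ⟨hκ.1, fun j hj => absurd hj (by omega)⟩

variable {τ : AK n q Q →ₗ[R] R}

open Classical in
theorem IsCanonicalTrace.apply_mon (hτ : IsCanonicalTrace τ) {ν : Fin n → ℕ} (hν : ν ∈ box n r n)
    (x y : Equiv.Perm (Fin n)) : τ (evL (mon R ν) * (Tw x * Tw y)) =
      if ν = 0 ∧ x = y⁻¹ then (q : R) ^ len x else 0 := by
  have := hτ ν hν.1 x y
  rw [Lmon_zero_eq, mul_assoc] at this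
  rw [this]
  exact if_congr (and_congr_left' ⟨fun h => funext h, fun h => congrFun h⟩) rfl rfl

/-- Linear identities on the subalgebra generated by `T_0, …, T_{a-1}` may be checked on standard
elements. -/
theorem eq_of_subAK (hr : 0 < r) {a : ℕ} (ha : a ≤ n) {N : Type*} [AddCommGroup N] [Module R N]
    {F G : AK n q Q →ₗ[R] N}
    (h : ∀ κ ∈ box n r a, ∀ x ∈ fixing n a, F (evL (mon R κ) * Tw x) = G (evL (mon R κ) * Tw x))
    {A : AK n q Q} (hA : A ∈ subAK n q Q a) : F A = G A := by
  refine LinearMap.eqOn_span (s := {y | ∃ ν ∈ box n r a, ∃ x ∈ fixing n a,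
    y = evL (mon R ν) * Tw x}) ?_ (subAK_le_stdSpan hr ha hA)
  rintro _ ⟨κ, hκ, x, hx, rfl⟩
  exact h κ hκ x hx

/-- Expanding A together with the part of the monomial in the first a letters leaves terms L^ν
T_{x'u} T_{y w⁻¹} with x' in 𝔖_a. A nonzero trace would force u = x'⁻¹ w y⁻¹, an element of the
double coset of w, which cannot be shorter than w. -/
theorem trace_mul_lowR (hr : 0 < r) (hτ : IsCanonicalTrace τ) {a m : ℕ} {w : Equiv.Perm (Fin n)}
    (hw : IsBlockSwap n a m w) {A : AK n q Q} (hA : A ∈ subAK n q Q a) {y : Equiv.Perm (Fin n)}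
    (hy : y ∈ fixing n m) {Z : AK n q Q} (hZ : Z ∈ lowR n q Q (len w)) :
    τ (A * Z * (Tw y * Tw w⁻¹)) = 0 := by
  have ha : a ≤ n := by have := hw.le; omega
  have hyw : (Tw y * Tw w⁻¹ : AK n q Q) = Tw (y * w⁻¹) := (Tw_mul (hw.inv.len_fixing_mul hy)).symm
  rw [hyw]
  refine (Submodule.mem_bot R).1 (map_mem_of_span
    (τ ∘ₗ LinearMap.mulRight R (Tw (y * w⁻¹)) ∘ₗ LinearMap.mulLeft R A) ?_ hZ)
  rintro _ ⟨ν, hν, u, hu, rfl⟩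
  rw [Submodule.mem_bot]
  obtain ⟨lo, hlo, hi, hhi, hhi0, rfl⟩ := exists_split hν a
  simp only [LinearMap.comp_apply, LinearMap.mulRight_apply, LinearMap.mulLeft_apply]
  rw [mon_add, map_mul evL, ← mul_assoc, ← mul_assoc]
  refine eq_of_subAK (F := τ ∘ₗ LinearMap.mulRight R (Tw (y * w⁻¹)) ∘ₗ LinearMap.mulRight R (Tw u) ∘ₗ
    LinearMap.mulRight R (evL (mon R hi))) (G := 0) hr ha (fun κ hκ x hx => ?_)
    (Subalgebra.mul_mem _ hA (evL_mon_mem_subAK hlo.2))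
  simp only [LinearMap.comp_apply, LinearMap.mulRight_apply, LinearMap.zero_apply]
  rw [mul_assoc (evL _), (commute_Tw_evL_mon ha hx hhi0).eq, ← mul_assoc, ← map_mul, ← mon_add,
    mul_assoc _ (Tw x), mul_assoc (evL _)]
  refine (Submodule.mem_bot R).1 (map_mem_of_span
    (τ ∘ₗ LinearMap.mulLeft R (evL (mon R (κ + hi))) ∘ₗ LinearMap.mulRight R (Tw (y * w⁻¹))) ?_
    (Tw_mul_Tw_mem_span ha hx u))
  rintro _ ⟨x', hx', rfl⟩
  rw [Submodule.mem_bot]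
  simp only [LinearMap.comp_apply, LinearMap.mulRight_apply, LinearMap.mulLeft_apply]
  rw [hτ.apply_mon (add_mem_box hκ hhi hhi0), if_neg]
  rintro ⟨-, e⟩
  have h1 := hw.le_len_mul_mul (inv_mem_fixing hx') (inv_mem_fixing hy)
  have h2 : u = x'⁻¹ * w * y⁻¹ := by
    rw [mul_assoc, eq_inv_mul_iff_mul_eq, e, mul_inv_rev, inv_inv]
  rw [← h2] at h1
  omega

/-- The part of the monomial in the first m letters is absorbed into B, which is expanded in the
standard basis of its own subalgebra; this reduces to `trace_mul_lowR`. -/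
theorem trace_mul_lowL (hr : 0 < r) (hτ : IsCanonicalTrace τ) {a m : ℕ} {w : Equiv.Perm (Fin n)}
    (hw : IsBlockSwap n a m w) {A B : AK n q Q} (hA : A ∈ subAK n q Q a)
    (hB : B ∈ subAK n q Q m) {Z : AK n q Q} (hZ : Z ∈ lowL n q Q (len w)) :
    τ (A * Z * B * Tw w⁻¹) = 0 := by
  have hm : m ≤ n := by have := hw.le; omega
  refine (Submodule.mem_bot R).1 (map_mem_of_span
    (τ ∘ₗ LinearMap.mulRight R (Tw w⁻¹) ∘ₗ LinearMap.mulRight R B ∘ₗ LinearMap.mulLeft R A) ?_ hZ)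
  rintro _ ⟨ν, hν, u, hu, rfl⟩
  rw [Submodule.mem_bot]
  obtain ⟨lo, hlo, hi, hhi, hhi0, rfl⟩ := exists_split hν m
  simp only [LinearMap.comp_apply, LinearMap.mulRight_apply, LinearMap.mulLeft_apply]
  rw [add_comm, mon_add, map_mul evL, ← mul_assoc, ← mul_assoc, mul_assoc _ (evL (mon R lo)) B]
  refine eq_of_subAK (F := τ ∘ₗ LinearMap.mulRight R (Tw w⁻¹) ∘ₗ
    LinearMap.mulLeft R (A * Tw u * evL (mon R hi))) (G := 0) hr hm (fun μ hμ y hy => ?_)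
    (Subalgebra.mul_mem _ (evL_mon_mem_subAK hlo.2) hB)
  simp only [LinearMap.comp_apply, LinearMap.mulRight_apply, LinearMap.mulLeft_apply,
    LinearMap.zero_apply]
  rw [← trace_mul_lowR hr hτ hw hA hy (lowL_le_lowR _ (Submodule.subset_span
    ⟨μ + hi, add_mem_box hμ hhi hhi0, u, hu, rfl⟩)), mon_add, mul_comm (mon R μ), map_mul evL]
  simp only [mul_assoc]

/-- The lengths add, so everything collapses to a single L^ν T_{xw} T_{y w⁻¹}. The exponents from κ
and from μ occupy disjoint letters, and x w = w y⁻¹ forces x = y = 1. -/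
theorem trace_blockSwap_mon (hτ : IsCanonicalTrace τ) {a m : ℕ}
    {w : Equiv.Perm (Fin n)} (hw : IsBlockSwap n a m w) {κ μ : Fin n → ℕ} (hκ : κ ∈ box n r a)
    (hμ : μ ∈ box n r m) {x y : Equiv.Perm (Fin n)} (hx : x ∈ fixing n a) (hy : y ∈ fixing n m) :
    τ (evL (mon R κ) * Tw x * evL (mon R (μ ∘ ⇑w⁻¹)) * Tw w * (Tw y * Tw w⁻¹)) =
      (q : R) ^ len w * τ (evL (mon R κ) * Tw x) * τ (evL (mon R μ) * Tw y) := by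
  classical
  have hle := hw.le
  have hμ0 : ∀ j : Fin n, j.val < a → (μ ∘ ⇑w⁻¹) j = 0 := fun j hj =>
    hμ.2 _ (by rw [hw.inv.left j hj]; omega)
  rw [mul_assoc (evL _), (commute_Tw_evL_mon (by omega) hx hμ0).eq, ← mul_assoc (evL _),
    ← map_mul evL, ← mon_add, mul_assoc _ (Tw x), ← Tw_mul (hw.len_fixing_mul hx),
    ← Tw_mul (hw.inv.len_fixing_mul hy), mul_assoc,
    hτ.apply_mon (add_mem_box hκ (comp_mem_box (box_mono hμ) _) hμ0)]
  have e1 := hτ.apply_mon (box_mono hκ) x 1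
  have e2 := hτ.apply_mon (box_mono hμ) y 1
  rw [Tw_one, mul_one, inv_one] at e1 e2
  rw [e1, e2, mul_inv_rev, inv_inv]
  have hsum : κ + μ ∘ ⇑w⁻¹ = 0 ↔ κ = 0 ∧ μ = 0 := by
    have h2 : μ ∘ ⇑w⁻¹ = 0 ↔ μ = 0 :=
      ⟨fun h => funext fun j => by simpa using congrFun h (w j), fun h => by rw [h]; rfl⟩
    rw [← h2]
    constructor
    · intro h
      constructor <;> funext j <;> have := congrFun h j <;> simp at this ⊢ <;> omega
    · rintro ⟨h, h'⟩
      rw [h, h', add_zero]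
  have hxy : x * w = w * y⁻¹ ↔ x = 1 ∧ y = 1 :=
    ⟨fun h => by simpa using hw.eq_one hx (inv_mem_fixing hy) h, fun ⟨h, h'⟩ => by simp [h, h']⟩
  simp only [hsum, hxy]
  by_cases h : κ = 0 ∧ x = 1
  · by_cases h' : μ = 0 ∧ y = 1
    · simp [h, h', len_one]
    · rw [if_neg h', if_neg (by tauto), mul_zero]
  · rw [if_neg h, if_neg (by tauto), mul_zero, zero_mul]

/-- Move g through T_w to the right, expand its product with B in the standard basis, and move the
new monomials back to the left. Both passages are exact up to terms of zero trace, and what remains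
is `trace_blockSwap_mon`. The exponent bound on g is what allows the first passage. -/
theorem trace_blockSwap (hr : 0 < r) (hτ : IsCanonicalTrace τ) {a m : ℕ} {w : Equiv.Perm (Fin n)}
    (hw : IsBlockSwap n a m w) {A B : AK n q Q} (hA : A ∈ subAK n q Q a)
    (hB : B ∈ subAK n q Q m) {g : MvPolynomial (Fin n) R}
    (hg : g ∈ Submodule.span R (mon R '' box n r m)) :
    τ (A * evL (MvPolynomial.rename w g) * Tw w * B * Tw w⁻¹) =
      (q : R) ^ len w * τ A * τ (evL g * B) := by
  have hle := hw.le
  refine LinearMap.eqOn_span (s := mon R '' box n r m)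
    (f := τ ∘ₗ LinearMap.mulRight R (Tw w⁻¹) ∘ₗ LinearMap.mulRight R B ∘ₗ
      LinearMap.mulRight R (Tw w) ∘ₗ LinearMap.mulLeft R A ∘ₗ
      (evL.comp (MvPolynomial.rename w) : MvPolynomial (Fin n) R →ₐ[R] AK n q Q).toLinearMap)
    (g := ((q : R) ^ len w * τ A) • (τ ∘ₗ LinearMap.mulRight R B ∘ₗ
      (evL : MvPolynomial (Fin n) R →ₐ[R] AK n q Q).toLinearMap)) ?_ hg
  rintro _ ⟨ν, hν, rfl⟩
  simp only [LinearMap.comp_apply, LinearMap.mulRight_apply, LinearMap.mulLeft_apply,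
    LinearMap.smul_apply, AlgHom.toLinearMap_apply, AlgHom.comp_apply, smul_eq_mul, rename_mon]
  have h1 := trace_mul_lowL hr hτ hw hA hB (evL_mon_mul_Tw w (box_mono hν))
  rw [mul_sub, sub_mul, sub_mul, map_sub, sub_eq_zero] at h1
  rw [mul_assoc A, h1, ← mul_assoc, mul_assoc _ (evL (mon R ν)) B]
  refine eq_of_subAK (F := τ ∘ₗ LinearMap.mulRight R (Tw w⁻¹) ∘ₗ LinearMap.mulLeft R (A * Tw w))
    (G := ((q : R) ^ len w * τ A) • τ) hr (by omega) (fun μ hμ y hy => ?_)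
    (Subalgebra.mul_mem _ (evL_mon_mem_subAK hν.2) hB)
  simp only [LinearMap.comp_apply, LinearMap.mulRight_apply, LinearMap.mulLeft_apply,
    LinearMap.smul_apply, smul_eq_mul]
  have h2 := trace_mul_lowR hr hτ hw hA hy (Tw_mul_evL_mon w (box_mono hμ))
  rw [mul_sub, sub_mul, map_sub, sub_eq_zero] at h2
  rw [show A * Tw w * (evL (mon R μ) * Tw y) * Tw w⁻¹ =
    A * (Tw w * evL (mon R μ)) * (Tw y * Tw w⁻¹) by simp only [mul_assoc], h2]
  refine eq_of_subAK (F := τ ∘ₗ LinearMap.mulRight R (Tw y * Tw w⁻¹) ∘ₗ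
    LinearMap.mulRight R (evL (mon R (μ ∘ ⇑w⁻¹)) * Tw w))
    (G := ((q : R) ^ len w * τ (evL (mon R μ) * Tw y)) • τ) hr (by omega) (fun κ hκ x hx => ?_)
    hA |>.trans ?_
  · simp only [LinearMap.comp_apply, LinearMap.mulRight_apply, LinearMap.smul_apply, smul_eq_mul]
    rw [← mul_assoc _ (evL _) (Tw w), trace_blockSwap_mon hτ hw hκ hμ hx hy]
    ring
  · simp only [LinearMap.smul_apply, smul_eq_mul]
    ring

end KeyTrace

end CycHecke

open scoped TensorProduct
namespace CycHecke

/-! ### The permutations `w_{a,b}^⟨k⟩` and `w_b` -/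

section Wab

variable {n : ℕ}

theorem prod_range'_val {k M : ℕ} (h : k + M < n) (x : Fin n) :
    ((((List.range' (k + 1) M).reverse.map (s n)).prod x : Fin n) : ℕ) =
      if x.val = k then k + M else if k < x.val ∧ x.val ≤ k + M then x - 1 else x := by
  induction M with
  | zero => simp; split_ifs <;> omega
  | succ M ih =>
    rw [List.range'_concat, List.reverse_append, List.reverse_singleton, List.singleton_append,
      List.map_cons, List.prod_cons, Equiv.Perm.mul_apply, s_val (by omega), ih (by omega)]
    split_ifs <;> omega

theorem prod_range'_pow_val {k M : ℕ} (h : k + M < n) {j : ℕ} (hj : j ≤ M + 1) (x : Fin n) :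
    (((((List.range' (k + 1) M).reverse.map (s n)).prod ^ j) x : Fin n) : ℕ) =
      if k ≤ x.val ∧ x.val < k + j then x + (M + 1 - j)
      else if k + j ≤ x.val ∧ x.val ≤ k + M then x - j else x := by
  induction j with
  | zero => simp
  | succ j ih =>
    rw [pow_succ', Equiv.Perm.mul_apply, prod_range'_val h, ih (by omega)]
    split_ifs <;> omega

theorem wab_val {a b k : ℕ} (h : k + a + b ≤ n) (x : Fin n) :
    (wab n a b k x : ℕ) = if k ≤ x.val ∧ x.val < k + b then x + a
      else if k + b ≤ x.val ∧ x.val < k + a + b then x - b else x := by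
  rcases Nat.eq_zero_or_pos (a + b) with h0 | h0
  · obtain ⟨rfl, rfl⟩ : a = 0 ∧ b = 0 := by omega
    simp [wab]
  · rw [wab, prod_range'_pow_val (by omega) (by omega)]
    split_ifs <;> omega

/-- Both sides turn consecutive blocks of sizes c, b, a into blocks of sizes a, b, c, keeping the
order inside each block. -/
theorem wab_mul_wab {a b c k : ℕ} (h : k + a + b + c ≤ n) :
    wab n b c (k + a) * wab n a (b + c) k = wab n a b k * wab n (a + b) c k := by
  ext x
  rw [Equiv.Perm.mul_apply, Equiv.Perm.mul_apply, wab_val (by omega), wab_val (by omega),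
    wab_val (by omega), wab_val (by omega)]
  split_ifs <;> omega

theorem wab_zero_left {c k : ℕ} (h : k + c ≤ n) : wab n 0 c k = 1 := by
  ext x
  rw [wab_val (by omega), Equiv.Perm.one_apply]
  split_ifs <;> omega

theorem wab_zero_right (a k : ℕ) : wab n a 0 k = 1 := by simp [wab]

theorem isBlockSwap_wab {a m : ℕ} (h : a + m ≤ n) : IsBlockSwap n a m (wab n a m 0) := by
  refine ⟨h, fun x hx => ?_, fun x hx hx' => ?_, fun x hx => ?_⟩ <;>
  · rw [wab_val (by omega)]
    split_ifs <;> omega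

theorem IsBlockSwap.unique {a m : ℕ} {w w' : Equiv.Perm (Fin n)} (h : IsBlockSwap n a m w)
    (h' : IsBlockSwap n a m w') : w = w' := by
  ext x
  rcases Nat.lt_or_ge x.val m with h1 | h1
  · rw [h.left x h1, h'.left x h1]
  · rcases Nat.lt_or_ge x.val (m + a) with h2 | h2
    · rw [h.right x h1 h2, h'.right x h1 h2]
    · rw [h.rest x h2, h'.rest x h2]

theorem wab_inv {a m : ℕ} (h : a + m ≤ n) : (wab n a m 0)⁻¹ = wab n m a 0 :=
  (isBlockSwap_wab h).inv.unique (isBlockSwap_wab (by omega))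

theorem wab_mem_fixing {a m : ℕ} (h : a + m ≤ n) : wab n a m 0 ∈ fixing n (a + m) :=
  fun j hj => Fin.ext ((isBlockSwap_wab h).rest j (by omega))

theorem fixing_mono {c c' : ℕ} (h : c ≤ c') {x : Equiv.Perm (Fin n)} (hx : x ∈ fixing n c) :
    x ∈ fixing n c' := fun j hj => hx j (by omega)

variable {p : ℕ} (b : Fin p → ℕ)

theorem psum_succ_right {i j : ℕ} (h : i ≤ j + 1) :
    psum b i (j + 1) = psum b i j + part b (j + 1) := Finset.sum_Icc_succ_top h _

theorem psum_eq_zero {i j : ℕ} (h : j < i) : psum b i j = 0 := by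
  rw [psum, Finset.Icc_eq_empty (by omega), Finset.sum_empty]

theorem psum_succ_left {i j : ℕ} (h : i ≤ j) :
    psum b i j = part b i + psum b (i + 1) j := by
  rw [psum, psum, ← Finset.insert_Icc_succ_left_eq_Icc h, Finset.sum_insert (by simp)]
  rfl

theorem psum_split {j t : ℕ} (h : j ≤ t) : psum b 1 j + psum b (j + 1) t = psum b 1 t := by
  induction j with
  | zero => rw [psum_eq_zero b (by omega), zero_add]
  | succ j ih =>
    rw [← ih (by omega), psum_succ_right b (by omega), psum_succ_left b (i := j + 1) (by omega)]
    ring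

/-- The partial products of the permutation `w_b`. -/
def wpart (n j t : ℕ) : Equiv.Perm (Fin n) :=
  ((List.range' 1 j).reverse.map fun k =>
    wab n (part b k) (psum b (k + 1) t) (psum b 1 (k - 1))).prod

theorem wpart_succ (j t : ℕ) : wpart b n (j + 1) t =
    wab n (part b (j + 1)) (psum b (j + 2) t) (psum b 1 j) * wpart b n j t := by
  rw [wpart, List.range'_concat, List.reverse_append, List.reverse_singleton, List.singleton_append,
    List.map_cons, List.prod_cons, wpart]
  simp [add_comm 1 j]

/-- The new block is carried past the parts one at a time, each time by `wab_mul_wab`. -/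
theorem wab_mul_wpart {t : ℕ} (h : psum b 1 (t + 1) ≤ n) {j : ℕ} (hj : j ≤ t) :
    wab n (psum b (j + 1) t) (part b (t + 1)) (psum b 1 j) * wpart b n j (t + 1) =
      wpart b n j t * wab n (psum b 1 t) (part b (t + 1)) 0 := by
  induction j with
  | zero => simp [wpart, psum_eq_zero b (i := 1) (j := 0) (by omega)]
  | succ j ih =>
    rw [psum_succ_right b (by omega)] at h
    have h1 := psum_split b hj
    have h2 := psum_succ_right b (i := 1) (j := j) (by omega)
    rw [wpart_succ, wpart_succ, psum_succ_right b (i := j + 2) (j := t) (by omega), ← mul_assoc, h2,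
      show j + 1 + 1 = j + 2 from rfl, wab_mul_wab (by
        rw [h2] at h1; change _ + psum b (j + 2) t = _ at h1; omega),
      ← psum_succ_left b (i := j + 1) hj, mul_assoc, ih (by omega), mul_assoc]

/-- The permutation `w_b` for the first `t` parts of `b`. -/
def wpre (n t : ℕ) : Equiv.Perm (Fin n) := wpart b n (t - 1) t

/-- The case j = t of `wab_mul_wpart`, where the left factor is trivial. In this form a new last
part contributes a block interchange on the right, matching the recursion for v_b. -/
theorem wpre_succ {t : ℕ} (h : psum b 1 (t + 1) ≤ n) :
    wpre b n (t + 1) = wpre b n t * wab n (psum b 1 t) (part b (t + 1)) 0 := by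
  have h2 := psum_succ_right b (i := 1) (j := t) (by omega)
  have := wab_mul_wpart b h le_rfl
  rw [psum_eq_zero b (by omega), wab_zero_left (by omega), one_mul] at this
  rw [wpre, Nat.add_sub_cancel, this]
  cases t with
  | zero => rfl
  | succ t =>
    rw [wpart_succ, psum_eq_zero b (by omega), wab_zero_right, one_mul, wpre, Nat.add_sub_cancel]

theorem wpre_mem_fixing {t : ℕ} (h : psum b 1 t ≤ n) : wpre b n t ∈ fixing n (psum b 1 t) := by
  induction t with
  | zero => exact one_mem_fixing _ _
  | succ t ih =>
    have h2 := psum_succ_right b (i := 1) (j := t) (by omega)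
    rw [wpre_succ b h]
    refine mul_mem_fixing (fixing_mono (by omega) (ih (by omega))) ?_
    rw [h2]
    exact wab_mem_fixing (by omega)

end Wab

/-! ### The permutations `w^⟨c⟩` -/

section Shift

variable {n m c : ℕ}

theorem shift_val_of_lt (h : c + m ≤ n) (w : Equiv.Perm (Fin m)) (j : Fin m) :
    shift n c w ⟨c + j, by omega⟩ = ⟨c + w j, by omega⟩ := by
  rw [shift, dif_pos h]
  exact Equiv.Perm.viaEmbedding_apply w ((Fin.natAddEmb c).trans (Fin.castLEEmb h)) j

theorem shift_val_of_notMem (h : c + m ≤ n) (w : Equiv.Perm (Fin m)) (x : Fin n)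
    (hx : x.val < c ∨ c + m ≤ x.val) : shift n c w x = x := by
  rw [shift, dif_pos h]
  refine Equiv.Perm.viaEmbedding_apply_of_notMem w _ x ?_
  rintro ⟨j, rfl⟩
  simp at hx
  omega

theorem shift_mem_fixing (h : m ≤ n) (w : Equiv.Perm (Fin m)) : shift n 0 w ∈ fixing n m :=
  fun j hj => shift_val_of_notMem (by omega) w j (Or.inr (by omega))

theorem shift_one (c : ℕ) : shift n c (1 : Equiv.Perm (Fin m)) = 1 := by
  by_cases h : c + m ≤ n
  · ext x
    by_cases hx : c ≤ x.val ∧ x.val < c + m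
    · have := shift_val_of_lt h 1 ⟨x - c, by omega⟩
      simp only [Nat.add_sub_cancel' hx.1] at this
      rw [this]
      simp [Nat.add_sub_cancel' hx.1]
    · rw [shift_val_of_notMem h 1 x (by omega)]; rfl
  · exact dif_neg h

theorem shift_mul (h : c + m ≤ n) (v w : Equiv.Perm (Fin m)) :
    shift n c (v * w) = shift n c v * shift n c w := by
  simp only [shift, dif_pos h]
  exact map_mul (Equiv.Perm.viaEmbeddingHom _) v w

theorem shift_inv (h : c + m ≤ n) (w : Equiv.Perm (Fin m)) :
    shift n c w⁻¹ = (shift n c w)⁻¹ :=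
  eq_inv_of_mul_eq_one_left (by rw [← shift_mul h, inv_mul_cancel, shift_one])

theorem shift_s (h : c + m ≤ n) {i : ℕ} (h1 : 1 ≤ i) (hi : i < m) :
    shift n c (s m i) = s n (i + c) := by
  ext x
  rw [s_val (by omega)]
  by_cases hx : c ≤ x.val ∧ x.val < c + m
  · have := shift_val_of_lt h (s m i) ⟨x - c, by omega⟩
    simp only [Nat.add_sub_cancel' hx.1] at this
    rw [this]
    show c + _ = _
    rw [s_val hi]
    dsimp only
    split_ifs <;> omega
  · rw [shift_val_of_notMem h _ x (by omega)]
    split_ifs <;> omega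

theorem shift_zero_eq_one (h : m ≤ n) (w : Equiv.Perm (Fin m)) : shift n 0 w = 1 ↔ w = 1 := by
  refine ⟨fun e => ?_, fun e => e ▸ shift_one 0⟩
  ext j
  have := shift_val_of_lt (c := 0) (by omega : 0 + m ≤ n) w j
  rw [e] at this
  simpa using (congrArg Fin.val this).symm

theorem Asc.shift (h : c + m ≤ n) {w : Equiv.Perm (Fin m)} {i : ℕ} (h1 : 1 ≤ i)
    (hw : Asc w i) : Asc (CycHecke.shift n c w) (i + c) := by
  obtain ⟨hi, hlt⟩ := hw
  refine ⟨by omega, ?_⟩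
  rw [← shift_inv h]
  have e1 := shift_val_of_lt h w⁻¹ ⟨i - 1, by omega⟩
  have e2 := shift_val_of_lt h w⁻¹ ⟨i, hi⟩
  simp only [show c + (i - 1) = i + c - 1 by omega, show c + i = i + c by omega] at e1 e2
  rw [e1, e2]
  rw [Fin.lt_def] at hlt ⊢
  simpa using hlt

variable {R : Type*} [CommRing R] {r : ℕ} {q : Rˣ} {Q : Fin r → R}

-- One word serves every shift c at once, so the same list of letters can be used before and after
-- passing T_w.
variable (n q Q) in
theorem exists_word_shift (w : Equiv.Perm (Fin m)) : ∃ l : List ℕ, (∀ i ∈ l, 1 ≤ i ∧ i < m) ∧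
    ∀ c, c + m ≤ n → (Tw (shift n c w) : AK n q Q) = (l.map fun i => T (i + c)).prod := by
  induction w using perm_induction with
  | one => exact ⟨[], by simp, fun c _ => by simp [shift_one]⟩
  | mul w i h1 hi hw ih =>
    obtain ⟨l, hl, e⟩ := ih
    refine ⟨i :: l, by simpa [h1, hi] using hl, fun c hc => ?_⟩
    rw [List.map_cons, List.prod_cons, ← e c hc, shift_mul hc, shift_s hc h1 hi,
      T_mul_Tw_of_asc (by omega) (by omega) (hw.shift hc h1)]

end Shift

end CycHecke

open scoped TensorProduct
namespace CycHecke

/-! ### Polynomials in the Jucys–Murphy elements -/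

section Polynomials

open MvPolynomial

variable {R : Type*} [CommRing R] {n r d : ℕ} {q : Rˣ} {Q : Fin r → R}

variable (n q Q) in
/-- The polynomials in the Jucys–Murphy elements that commute with `T_i`. -/
noncomputable def cen (i : ℕ) : Subalgebra R (MvPolynomial (Fin n) R) :=
  (Subalgebra.centralizer R {(T i : AK n q Q)}).comap evL

theorem mem_cen {i : ℕ} {f : MvPolynomial (Fin n) R} :
    f ∈ cen n q Q i ↔ Commute (T i : AK n q Q) (evL f) := by
  rw [cen, Subalgebra.mem_comap, Subalgebra.mem_centralizer_iff]
  simp [Commute, SemiconjBy]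

theorem X_mem_cen {i : ℕ} (hi : i < n) {x : Fin n} (h : x.val + 1 ≠ i) (h' : x.val ≠ i) :
    X x ∈ cen n q Q i := by
  rw [mem_cen, evL_X]
  exact T_comm_L hi (by omega) (by omega) (by omega) (by omega)

theorem mem_cen_zero (hn : 0 < n) (f : MvPolynomial (Fin n) R) : f ∈ cen n q Q 0 := by
  have : (T 0 : AK n q Q) = evL (X ⟨0, hn⟩) := by rw [evL_X]; rfl
  rw [mem_cen, this, Commute, SemiconjBy, ← map_mul, ← map_mul, mul_comm]

/-- By the Bernstein relations T_i commutes with L_i + L_{i+1} and L_i L_{i+1}, of which this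
product is a polynomial. -/
theorem pair_mem_cen {i : ℕ} (h1 : 1 ≤ i) (hi : i < n) (c : R) :
    (X ⟨i - 1, by omega⟩ - C c) * (X ⟨i, hi⟩ - C c) ∈ cen n q Q i := by
  have e0 : i - 1 + 1 = i := by omega
  have hsum : X ⟨i - 1, by omega⟩ + X ⟨i, hi⟩ ∈ cen n q Q i := by
    rw [mem_cen, map_add, evL_X, evL_X, Commute, SemiconjBy]
    simp only [e0]
    rw [mul_add, add_mul, T_mul_L h1 hi, T_mul_L_succ h1 hi]
    abel
  have hprod : X ⟨i - 1, by omega⟩ * X ⟨i, hi⟩ ∈ cen n q Q i := by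
    rw [mem_cen, map_mul, evL_X, evL_X, Commute, SemiconjBy]
    simp only [e0]
    have hc := L_comm (q := q) (Q := Q) h1 hi.le (by omega : 1 ≤ i + 1) hi
    rw [← mul_assoc, T_mul_L h1 hi, sub_mul, mul_assoc, T_mul_L_succ h1 hi, hc.eq, mul_add,
      smul_mul_assoc, mul_smul_comm, mul_assoc]
    abel
  have : (X (⟨i - 1, by omega⟩ : Fin n) - C c) * (X ⟨i, hi⟩ - C c) =
      X (⟨i - 1, by omega⟩ : Fin n) * X ⟨i, hi⟩ -
        C c * (X (⟨i - 1, by omega⟩ : Fin n) + X ⟨i, hi⟩) + C c * C c := by ring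
  rw [this]
  have hC : C c ∈ cen n q Q i := Subalgebra.algebraMap_mem _ c
  exact Subalgebra.add_mem _ (Subalgebra.sub_mem _ hprod (Subalgebra.mul_mem _ hC hsum))
    (Subalgebra.mul_mem _ hC hC)

/-- The product of the factors `L_{x+1} - c_{k,i}` for `x` among the `m` letters after the first
`o`, and for `k ∈ S`. -/
noncomputable def blk (n : ℕ) (c : ℕ → Fin d → R) (S : Finset ℕ) (o m : ℕ) :
    MvPolynomial (Fin n) R :=
  ∏ x ∈ Finset.univ.filter (fun x : Fin n => o ≤ x.val ∧ x.val < o + m),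
    ∏ k ∈ S, ∏ i : Fin d, (X x - C (c k i))

/-- The monomial with exponents `e` in the `m` letters after the first `o`. -/
noncomputable def shiftMon (R : Type*) [CommRing R] (n o m : ℕ) (e : ℕ → ℕ) :
    MvPolynomial (Fin n) R :=
  mon R fun x => if o ≤ x.val ∧ x.val < o + m then e (x - o) else 0

variable {c : ℕ → Fin d → R} {S : Finset ℕ} {o m : ℕ} {e : ℕ → ℕ}

theorem blk_mem_cen_of_le {i : ℕ} (hi : i < n) (h : i < o ∨ o + m < i) :
    blk n c S o m ∈ cen n q Q i := by
  refine Subalgebra.prod_mem _ fun x hx => Subalgebra.prod_mem _ fun k _ =>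
    Subalgebra.prod_mem _ fun j _ => Subalgebra.sub_mem _ ?_ (Subalgebra.algebraMap_mem _ _)
  have := (Finset.mem_filter.1 hx).2
  exact X_mem_cen hi (by omega) (by omega)

theorem shiftMon_mem_cen {i : ℕ} (hi : i < n) (h : i < o ∨ o + m < i) :
    shiftMon R n o m e ∈ cen n q Q i := by
  rw [mem_cen]
  refine commute_T_evL_mon hi fun j hj => if_neg ?_
  omega

/-- T_0 is itself L_1. For i ≥ 1, pair the factors at the letters i and i+1 that have the same
parameter; all other factors commute with T_i individually. -/
theorem blk_mem_cen {i : ℕ} (hi : i < m) (hm : m ≤ n) : blk n c S 0 m ∈ cen n q Q i := by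
  rcases Nat.eq_zero_or_pos i with rfl | h1
  · exact mem_cen_zero (by omega) _
  have hin : i < n := by omega
  rw [blk, Finset.prod_comm]
  refine Subalgebra.prod_mem _ fun k _ => ?_
  rw [Finset.prod_comm]
  refine Subalgebra.prod_mem _ fun j _ => ?_
  have hne : (⟨i - 1, by omega⟩ : Fin n) ≠ ⟨i, hin⟩ := by simp [Fin.ext_iff]; omega
  have hsub : ({⟨i - 1, by omega⟩, ⟨i, hin⟩} : Finset (Fin n)) ⊆
      Finset.univ.filter fun x : Fin n => 0 ≤ x.val ∧ x.val < 0 + m := by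
    intro x hx
    simp only [Finset.mem_insert, Finset.mem_singleton] at hx
    rcases hx with rfl | rfl <;> simp <;> omega
  rw [← Finset.prod_sdiff hsub, Finset.prod_pair hne]
  refine Subalgebra.mul_mem _ (Subalgebra.prod_mem _ fun x hx =>
    Subalgebra.sub_mem _ ?_ (Subalgebra.algebraMap_mem _ _)) (pair_mem_cen h1 hin _)
  simp only [Finset.mem_sdiff, Finset.mem_insert, Finset.mem_singleton, not_or, Fin.ext_iff] at hx
  exact X_mem_cen hin (by omega) (by omega)

/-- Symmetric products are central. -/
theorem commute_blk (hm : m ≤ n) {A : AK n q Q} (hA : A ∈ subAK n q Q m) :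
    Commute A (evL (blk n c S 0 m)) := by
  have : subAK n q Q m ≤ Subalgebra.centralizer R {evL (blk n c S 0 m)} := by
    refine Algebra.adjoin_le ?_
    rintro _ ⟨i, hi, rfl⟩
    refine (Subalgebra.mem_centralizer_iff R).2 ?_
    rintro _ rfl
    exact (mem_cen.1 (blk_mem_cen hi hm)).eq.symm
  exact ((Subalgebra.mem_centralizer_iff R).1 (this hA) _ rfl).symm

theorem commute_Tw_evL {a : ℕ} (ha : a ≤ n) {x : Equiv.Perm (Fin n)} (hx : x ∈ fixing n a)
    {f : MvPolynomial (Fin n) R} (hf : ∀ i < a, f ∈ cen n q Q i) :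
    Commute (Tw x : AK n q Q) (evL f) := by
  induction hx using fixing_induction ha with
  | one => simp
  | mul x i h1 hi hx hasc ih =>
    rw [← T_mul_Tw_of_asc h1 (by omega) hasc]
    exact Commute.mul_left (mem_cen.1 (hf i hi)) ih

theorem commute_word_evL {l : List ℕ} {f : MvPolynomial (Fin n) R}
    (hf : ∀ i ∈ l, f ∈ cen n q Q i) : Commute (l.map T).prod (evL f : AK n q Q) := by
  refine Commute.list_prod_left _ _ fun z hz => ?_
  obtain ⟨i, hi, rfl⟩ := List.mem_map.1 hz
  exact mem_cen.1 (hf i hi)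

theorem blk_add (a b : ℕ) : blk n c S o (a + b) = blk n c S o a * blk n c S (o + a) b := by
  rw [blk, blk, blk, ← Finset.prod_union]
  · congr 1
    ext x
    simp only [Finset.mem_filter, Finset.mem_univ, true_and, Finset.mem_union]
    omega
  · refine Finset.disjoint_left.2 fun x hx hx' => ?_
    simp only [Finset.mem_filter, Finset.mem_univ, true_and] at hx hx'
    omega

theorem blk_union {S' : Finset ℕ} (h : Disjoint S S') :
    blk n c (S ∪ S') o m = blk n c S o m * blk n c S' o m := by
  simp only [blk, ← Finset.prod_mul_distrib, Finset.prod_union h]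

theorem rename_blk {a : ℕ} {w : Equiv.Perm (Fin n)} (hw : IsBlockSwap n a m w) :
    rename w (blk n c S 0 m) = blk n c S a m := by
  rw [blk, blk, map_prod]
  refine Finset.prod_bij (fun x _ => w x) (fun x hx => ?_) (fun x _ y _ h => w.injective h)
    (fun y hy => ⟨w⁻¹ y, ?_, w.apply_symm_apply y⟩) fun x _ => by simp [map_prod]
  · simp only [Finset.mem_filter, Finset.mem_univ, true_and] at hx ⊢
    rw [hw.left x (by omega)]
    omega
  · simp only [Finset.mem_filter, Finset.mem_univ, true_and] at hy ⊢
    rw [hw.inv.right y hy.1 (by omega)]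
    omega

theorem rename_shiftMon {a : ℕ} {w : Equiv.Perm (Fin n)} (hw : IsBlockSwap n a m w) :
    rename w (shiftMon R n 0 m e) = shiftMon R n a m e := by
  rw [shiftMon, shiftMon, rename_mon]
  congr 1
  funext x
  simp only [Function.comp_apply]
  have hle := hw.le
  rcases Nat.lt_or_ge x.val a with h | h
  · rw [hw.inv.left x h, if_neg (by omega), if_neg (by omega)]
  · rcases Nat.lt_or_ge x.val (a + m) with h' | h'
    · rw [hw.inv.right x h h', if_pos (by omega), if_pos (by omega), Nat.sub_zero]
    · rw [hw.inv.rest x h', if_neg (by omega), if_neg (by omega)]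

theorem mem_span_mon_of_degreeOf {f : MvPolynomial (Fin n) R} (h : ∀ j, degreeOf j f < r)
    (h0 : ∀ j : Fin n, m ≤ j.val → degreeOf j f = 0) :
    f ∈ Submodule.span R (mon R '' box n r m) := by
  rw [f.as_sum]
  refine Submodule.sum_mem _ fun ν hν => ?_
  have hle : ∀ j, ν j ≤ degreeOf j f := fun j => by
    rw [degreeOf_eq_sup]; exact Finset.le_sup (f := fun m : Fin n →₀ ℕ => m j) hν
  have : monomial ν (coeff ν f) = coeff ν f • mon R ν := by
    rw [monomial_eq, C_mul', mon, Finsupp.prod_fintype _ _ fun _ => pow_zero _]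
  rw [this]
  exact Submodule.smul_mem _ _ (Submodule.subset_span ⟨ν, ⟨fun j => (hle j).trans_lt (h j),
    fun j hj => Nat.eq_zero_of_le_zero ((hle j).trans (h0 j hj).le)⟩, rfl⟩)

theorem degreeOf_X_sub_C_le (j x : Fin n) (a : R) :
    degreeOf j (X x - C a) ≤ if x = j then 1 else 0 := by
  rcases subsingleton_or_nontrivial R with h | h
  · rw [Subsingleton.elim (X x - C a) 0, degreeOf_zero]; exact Nat.zero_le _
  · refine (degreeOf_sub_le _ _ _).trans ?_
    rw [degreeOf_X, degreeOf_C, Nat.max_zero]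
    simp only [eq_comm, le_refl]

theorem degreeOf_blk_le (j : Fin n) :
    degreeOf j (blk n c S o m) ≤ if o ≤ j.val ∧ j.val < o + m then S.card * d else 0 := by
  have h1 : ∀ x : Fin n, degreeOf j (∏ k ∈ S, ∏ i : Fin d, (X x - C (c k i))) ≤
      if x = j then S.card * d else 0 := fun x => by
    refine (degreeOf_prod_le _ _ _).trans ((Finset.sum_le_sum fun k _ =>
      (degreeOf_prod_le _ _ _).trans (Finset.sum_le_sum fun i _ =>
        degreeOf_X_sub_C_le j x (c k i))).trans ?_)
    split_ifs <;> simp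
  refine (degreeOf_prod_le _ _ _).trans ((Finset.sum_le_sum fun x _ => h1 x).trans ?_)
  rw [Finset.sum_ite_eq']
  simp

theorem degreeOf_mon_le (j : Fin n) (ν : Fin n → ℕ) : degreeOf j (mon R ν) ≤ ν j := by
  have h : ∀ x : Fin n, degreeOf j (X x ^ ν x : MvPolynomial (Fin n) R) ≤
      if x = j then ν j else 0 := fun x => by
    split_ifs with h
    · subst h
      have := degreeOf_X_sub_C_le x x (0 : R)
      rw [C_0, sub_zero, if_pos rfl] at this
      exact (degreeOf_pow_le _ _ _).trans (by nlinarith)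
    · rw [degreeOf_X_pow_of_ne _ (Ne.symm h)]
  refine (degreeOf_prod_le _ _ _).trans ((Finset.sum_le_sum fun x _ => h x).trans ?_)
  simp

/-- Each variable has degree at most |S|d + (d-1) < r. With r = pd this leaves room for p-1 of the p
parameter groups, exactly what occurs in the application. -/
theorem blk_mul_shiftMon_mem {e : ℕ → ℕ} (he : ∀ k, e k < d) (hS : (S.card + 1) * d ≤ r) :
    blk n c S 0 m * shiftMon R n 0 m e ∈ Submodule.span R (mon R '' box n r m) := by
  have key : ∀ j : Fin n, degreeOf j (blk n c S 0 m * shiftMon R n 0 m e) ≤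
      if j.val < m then S.card * d + e j else 0 := fun j => by
    refine (degreeOf_mul_le _ _ _).trans ((add_le_add (degreeOf_blk_le j)
      (degreeOf_mon_le j _)).trans ?_)
    simp only [zero_add, Nat.zero_le, true_and, Nat.sub_zero]
    split_ifs <;> simp
  have hd : 0 < d := (Nat.zero_le _).trans_lt (he 0)
  refine mem_span_mon_of_degreeOf (fun j => (key j).trans_lt ?_) fun j hj => ?_
  · have := he j
    rw [add_mul, one_mul] at hS
    split_ifs <;> omega
  · have := key j
    rw [if_neg (by omega)] at this
    omega

-- Below degree r in every variable no reduction takes place, so the trace sees only the constant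
-- term.
open Classical in
theorem IsCanonicalTrace.apply_evL {τ : AK n q Q →ₗ[R] R} (hτ : IsCanonicalTrace τ)
    {f : MvPolynomial (Fin n) R} (hf : f ∈ Submodule.span R (mon R '' box n r m))
    (x : Equiv.Perm (Fin n)) : τ (evL f * Tw x) = if x = 1 then constantCoeff f else 0 := by
  have : ∀ f ∈ Submodule.span R (mon R '' box n r m), (τ ∘ₗ LinearMap.mulRight R (Tw x) ∘ₗ
      (evL : MvPolynomial (Fin n) R →ₐ[R] AK n q Q).toLinearMap) f =
        ((if x = 1 then (1 : R) else 0) • lcoeff R 0) f := by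
    refine LinearMap.eqOn_span (s := mon R '' box n r m) ?_
    rintro _ ⟨ν, hν, rfl⟩
    have := hτ.apply_mon (box_mono hν) x 1
    rw [Tw_one, mul_one, inv_one] at this
    show τ (evL (mon R ν) * Tw x) = _
    rw [this, LinearMap.smul_apply, lcoeff_apply, ← constantCoeff_eq, mon, map_prod]
    simp only [map_pow, constantCoeff_X]
    by_cases h : ν = 0
    · subst h
      by_cases hx : x = 1
      · simp [hx, len_one]
      · simp [hx]
    · obtain ⟨j, hj⟩ := Function.ne_iff.1 h
      rw [if_neg (fun h' => h h'.1), Finset.prod_eq_zero (Finset.mem_univ j) (zero_pow hj),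
        smul_zero]
  rw [constantCoeff_eq]
  refine (this f hf).trans ?_
  rw [LinearMap.smul_apply, lcoeff_apply, smul_eq_mul, ite_mul, one_mul, zero_mul]

end Polynomials

end CycHecke

open scoped TensorProduct
namespace CycHecke

/-! ### Splitting off one block -/

section Step

open MvPolynomial

variable {R : Type*} [CommRing R] {n r d : ℕ} {q : Rˣ} {Q : Fin r → R} {c : ℕ → Fin d → R}

/-- Interchanging blocks conjugates s_i to s_{i+a}, and both products have length ℓ(w) + 1. -/
theorem T_mul_Tw_blockSwap {a m : ℕ} {w : Equiv.Perm (Fin n)} (hw : IsBlockSwap n a m w) {i : ℕ}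
    (h1 : 1 ≤ i) (hi : i < m) : (T (i + a) * Tw w : AK n q Q) = Tw w * T i := by
  have hle := hw.le
  have e : s n (i + a) * w = w * s n i := by
    ext x
    rw [Equiv.Perm.mul_apply, Equiv.Perm.mul_apply, s_val (by omega)]
    have hx := s_val (by omega : i < n) x
    rcases Nat.lt_or_ge x.val m with h | h
    · rw [hw.left x h, hw.left (s n i x) (by rw [hx]; split_ifs <;> omega), hx]
      split_ifs <;> omega
    · have e2 : s n i x = x := Fin.ext (by rw [hx]; split_ifs <;> omega)
      rw [e2]
      rcases Nat.lt_or_ge x.val (m + a) with h' | h'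
      · rw [hw.right x h h']; split_ifs <;> omega
      · rw [hw.rest x h']; split_ifs <;> omega
  have hasc : Asc w (i + a) := by
    refine ⟨by omega, Fin.lt_def.2 ?_⟩
    rw [hw.inv.right _ (by simp; omega) (by simp; omega),
      hw.inv.right _ (by simp) (by simp; omega)]
    simp only
    omega
  rw [T_mul_Tw_of_asc (by omega) (by omega) hasc, e, Tw_mul_T_of_len h1 (by omega)]
  rw [← e, len_of_asc (by omega) hasc]

theorem word_mul_Tw_blockSwap {a m : ℕ} {w : Equiv.Perm (Fin n)} (hw : IsBlockSwap n a m w)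
    {l : List ℕ} (hl : ∀ i ∈ l, 1 ≤ i ∧ i < m) :
    ((l.map fun i => T (i + a)).prod * Tw w : AK n q Q) = Tw w * (l.map T).prod := by
  induction l with
  | nil => simp
  | cons i l ih =>
    have h := hl i (by simp)
    rw [List.map_cons, List.prod_cons, mul_assoc, ih fun j hj => hl j (by simp [hj]), ← mul_assoc,
      T_mul_Tw_blockSwap hw h.1 h.2, List.map_cons, List.prod_cons, mul_assoc]

theorem word_mem_subAK {m : ℕ} {l : List ℕ} (hl : ∀ i ∈ l, 1 ≤ i ∧ i < m) :
    ((l.map T).prod : AK n q Q) ∈ subAK n q Q m :=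
  Subalgebra.list_prod_mem _ fun z hz => by
    obtain ⟨i, hi, rfl⟩ := List.mem_map.1 hz
    exact T_mem_subAK (hl i hi).2

theorem evL_blk_mem_subAK {S : Finset ℕ} {m : ℕ} :
    (evL (blk n c S 0 m) : AK n q Q) ∈ subAK n q Q m := by
  refine Subalgebra.prod_mem ((subAK n q Q m).comap evL) fun y hy =>
    Subalgebra.prod_mem _ fun k _ => Subalgebra.prod_mem _ fun i _ =>
      Subalgebra.sub_mem _ ?_ (Subalgebra.algebraMap_mem _ _)
  rw [Subalgebra.mem_comap, evL_X]
  have := (Finset.mem_filter.1 hy).2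
  exact L_mem_subAK (by omega) (by omega)

theorem constantCoeff_blk {S : Finset ℕ} {m : ℕ} (hm : m ≤ n) :
    constantCoeff (blk n c S 0 m) = (∏ k ∈ S, ∏ i, -c k i) ^ m := by
  have hcard : (Finset.univ.filter fun x : Fin n => 0 ≤ x.val ∧ x.val < 0 + m).card = m := by
    simp only [Nat.zero_le, true_and, zero_add]
    rw [Fin.card_filter_val_lt, min_eq_right hm]
  rw [blk, map_prod, ← hcard, ← Finset.prod_const, hcard]
  simp [map_prod]

theorem constantCoeff_shiftMon {m : ℕ} (hm : m ≤ n) (e : ℕ → ℕ) [Decidable (∀ k < m, e k = 0)] :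
    constantCoeff (shiftMon R n 0 m e) = if ∀ k < m, e k = 0 then 1 else 0 := by
  simp only [shiftMon, mon, map_prod, map_pow, constantCoeff_X]
  split_ifs with h
  · refine Finset.prod_eq_one fun x _ => ?_
    split_ifs with hx
    · rw [h _ (by omega), pow_zero]
    · rw [pow_zero]
  · push Not at h
    obtain ⟨k, hk, hk'⟩ := h
    refine Finset.prod_eq_zero (Finset.mem_univ ⟨k, by omega⟩) ?_
    rw [if_pos (by simpa using hk), Nat.sub_zero, zero_pow hk']

-- One block is split off. The letters of the block see the groups S from the left factor and S'
-- from v; the other m letters keep S and gain u. The remaining trace has the original shape with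
-- one block fewer.
open Classical in
theorem trace_step (hr : 0 < r) {τ : AK n q Q →ₗ[R] R} (hτ : IsCanonicalTrace τ) {a m : ℕ}
    {w : Equiv.Perm (Fin n)} (hw : IsBlockSwap n a m w) {S S' : Finset ℕ} {u : ℕ}
    (hSS' : Disjoint S S') (hu : u ∉ S) (hS : (S.card + S'.card + 1) * d ≤ r)
    {α e : ℕ → ℕ} (hα : ∀ k, α k < d) (he : ∀ k, e k < d) {x : Equiv.Perm (Fin n)}
    (hx : x ∈ fixing n a) {l : List ℕ} (hl : ∀ i ∈ l, 1 ≤ i ∧ i < m) {V Y : AK n q Q}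
    (hV : V ∈ subAK n q Q m) (hY : Y ∈ subAK n q Q m) :
    τ (evL (blk n c S 0 (a + m)) *
        (evL (shiftMon R n 0 a α) * Tw x *
          (evL (shiftMon R n a m e) * (l.map fun i => T (i + a)).prod)) *
        (evL (blk n c S' 0 a) * Tw w * V * evL (blk n c {u} 0 m)) * (Y * Tw w⁻¹)) =
      (q : R) ^ len w * (if (∀ k < a, α k = 0) ∧ x = 1 then
        (∏ k ∈ S ∪ S', ∏ i, -c k i) ^ a else 0) *
      τ (evL (blk n c (insert u S) 0 m) * (evL (shiftMon R n 0 m e) * (l.map T).prod) * V * Y) := by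
  have hle := hw.le
  have hlm : ((l.map T).prod : AK n q Q) ∈ subAK n q Q m := word_mem_subAK hl
  set A : AK n q Q := evL (blk n c (S ∪ S') 0 a * shiftMon R n 0 a α) * Tw x with hA
  set g : MvPolynomial (Fin n) R := blk n c S 0 m * shiftMon R n 0 m e with hg
  set B : AK n q Q := (l.map T).prod * V * evL (blk n c {u} 0 m) * Y with hB
  have hAm : A ∈ subAK n q Q a := by
    rw [hA, map_mul]
    exact Subalgebra.mul_mem _ (Subalgebra.mul_mem _ evL_blk_mem_subAK
      (evL_mon_mem_subAK fun j hj => if_neg (by omega)))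
      (Tw_mem_subAK (by omega) hx)
  have hBm : B ∈ subAK n q Q m :=
    Subalgebra.mul_mem _ (Subalgebra.mul_mem _ (Subalgebra.mul_mem _ hlm hV) evL_blk_mem_subAK) hY
  have hgm : g ∈ Submodule.span R (mon R '' box n r m) :=
    blk_mul_shiftMon_mem he (le_trans (Nat.mul_le_mul_right _ (by omega)) hS)
  have hcard : (S ∪ S').card = S.card + S'.card := Finset.card_union_of_disjoint hSS'
  have hτA : τ A = if (∀ k < a, α k = 0) ∧ x = 1 then
      (∏ k ∈ S ∪ S', ∏ i, -c k i) ^ a else 0 := by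
    rw [hA, hτ.apply_evL (blk_mul_shiftMon_mem hα (by rw [hcard]; exact hS)), map_mul,
      constantCoeff_blk (by omega), constantCoeff_shiftMon (by omega)]
    by_cases h : x = 1 <;> by_cases h' : ∀ k < a, α k = 0 <;> simp [h, h']
  have hlhs : evL (blk n c S 0 (a + m)) *
        (evL (shiftMon R n 0 a α) * Tw x *
          (evL (shiftMon R n a m e) * (l.map fun i => T (i + a)).prod)) *
        (evL (blk n c S' 0 a) * Tw w * V * evL (blk n c {u} 0 m)) * (Y * Tw w⁻¹) =
      A * evL (rename w g) * Tw w * B * Tw w⁻¹ := by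
    have c1 : Commute ((l.map fun i => T (i + a)).prod : AK n q Q) (evL (blk n c S' 0 a)) := by
      have := commute_word_evL (q := q) (Q := Q) (l := l.map (· + a)) (f := blk n c S' 0 a)
        fun i hi => by
          obtain ⟨j, hj, rfl⟩ := List.mem_map.1 hi
          have := hl j hj
          exact blk_mem_cen_of_le (by omega) (Or.inr (by omega))
      rwa [List.map_map] at this
    have c2 : Commute (Tw x : AK n q Q) (evL (shiftMon R n a m e)) :=
      commute_Tw_evL (by omega) hx fun i hi => shiftMon_mem_cen (by omega) (Or.inl hi)
    have c3 : Commute (Tw x : AK n q Q) (evL (blk n c S' 0 a)) :=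
      commute_Tw_evL (by omega) hx fun i hi => blk_mem_cen hi (by omega)
    have c4 : Commute (Tw x : AK n q Q) (evL (blk n c S a m)) :=
      commute_Tw_evL (by omega) hx fun i hi => blk_mem_cen_of_le (by omega) (Or.inl hi)
    have e1 := word_mul_Tw_blockSwap (q := q) (Q := Q) hw hl
    rw [hA, hg, hB, map_mul (rename w), rename_blk hw, rename_shiftMon hw, blk_union hSS']
    calc _ = evL (blk n c S 0 (a + m)) * evL (shiftMon R n 0 a α) * (Tw x *
          evL (shiftMon R n a m e)) * ((l.map fun i => T (i + a)).prod *
          evL (blk n c S' 0 a)) * Tw w * V * evL (blk n c {u} 0 m) * (Y * Tw w⁻¹) := by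
          simp only [mul_assoc]
      _ = evL (blk n c S 0 (a + m)) * evL (shiftMon R n 0 a α) * (evL (shiftMon R n a m e) *
          (Tw x * evL (blk n c S' 0 a))) * ((l.map fun i => T (i + a)).prod * Tw w) * V *
          evL (blk n c {u} 0 m) * (Y * Tw w⁻¹) := by
          rw [c2.eq, c1.eq]; simp only [mul_assoc]
      _ = evL (blk n c S 0 (a + m) * shiftMon R n 0 a α * shiftMon R n a m e *
          blk n c S' 0 a) * Tw x * (Tw w * (l.map T).prod) * V *
          evL (blk n c {u} 0 m) * (Y * Tw w⁻¹) := by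
          rw [c3.eq, e1]; simp only [map_mul, mul_assoc]
      _ = evL (blk n c S 0 a * blk n c S' 0 a * shiftMon R n 0 a α) *
          (evL (blk n c S a m * shiftMon R n a m e) * Tw x) * (Tw w * (l.map T).prod) * V *
          evL (blk n c {u} 0 m) * (Y * Tw w⁻¹) := by
          rw [← mul_assoc (evL _) (evL _) (Tw x), ← map_mul, blk_add, zero_add]
          congr 6
          ring
      _ = _ := by
          rw [map_mul evL (blk n c S a m), ← (c4.mul_right c2).eq]
          simp only [mul_assoc]
  rw [hlhs, trace_blockSwap hr hτ hw hAm hBm hgm, hτA]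
  congr 2
  -- The factor for u is symmetric in L_1,…,L_m, so it commutes with the subalgebra on the first m
  -- letters and can travel left to join the factor for S.
  have c5 : Commute ((l.map T).prod * V : AK n q Q) (evL (blk n c {u} 0 m)) :=
    commute_blk (by omega) (Subalgebra.mul_mem _ hlm hV)
  rw [hB, c5.eq, hg, Finset.insert_eq, Finset.union_comm, blk_union (by simpa using hu)]
  simp only [← mul_assoc]
  rw [← map_mul, ← map_mul]
  congr 4
  ring

end Step

end CycHecke

open scoped TensorProduct
namespace CycHecke

/-! ### The element `v_b` and the trace of `h · v_b T_b` -/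

section Main

open MvPolynomial

variable {R : Type*} [CommRing R] {p n d : ℕ} (ε q : Rˣ) (Q : Fin d → Rˣ)

/-- The parameters `ε^k Q_i`. -/
def epsQ (k : ℕ) (i : Fin d) : R := ((ε ^ k * Q i : Rˣ) : R)

theorem prod_map_range' {M : Type*} [CommMonoid M] (f : ℕ → M) (i N : ℕ) :
    ((List.range' i N).map f).prod = ∏ t ∈ Finset.Ico i (i + N), f t := by
  induction N with
  | zero => simp
  | succ N ih =>
    rw [List.range'_concat, List.map_append, List.prod_append, ih, ← add_assoc,
      Finset.prod_Ico_succ_top (by omega)]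
    simp

theorem LL1_eq (t : ℕ) {k : ℕ} (hk : k < n) : (LL1 ε q Q t (k + 1) : H p n ε q Q) =
    evL (∏ i : Fin d, (X ⟨k, hk⟩ - C (epsQ ε Q t i))) := by
  rw [LL1, ← List.prod_ofFn, map_list_prod, List.map_ofFn]
  congr 2
  funext i
  rw [Function.comp_apply, map_sub, evL_X]
  congr 1
  exact ((evL : MvPolynomial (Fin n) R →ₐ[R] H p n ε q Q).commutes _).symm

theorem blk_one (c : ℕ → Fin d → R) (S : Finset ℕ) {m : ℕ} (hm : m < n) :
    blk n c S m 1 = ∏ k ∈ S, ∏ i : Fin d, (X ⟨m, hm⟩ - C (c k i)) := by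
  have : (Finset.univ.filter fun x : Fin n => m ≤ x.val ∧ x.val < m + 1) = {⟨m, hm⟩} := by
    ext x
    simp only [Finset.mem_filter, Finset.mem_univ, true_and, Finset.mem_singleton, Fin.ext_iff]
    omega
  rw [blk, this, Finset.prod_singleton]

theorem LL_eq {i j : ℕ} (hij : i ≤ j + 1) {m : ℕ} (hm : m ≤ n) :
    (LL ε q Q i j 1 m : H p n ε q Q) = evL (blk n (epsQ ε Q) (Finset.Icc i j) 0 m) := by
  induction m with
  | zero => simp [LL, blk]
  | succ m ih =>
    rw [blk_add, map_mul, ← ih (by omega), zero_add, blk_one _ _ (by omega), LL, LL,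
      show m + 1 + 1 - 1 = m + 1 by omega, show m + 1 - 1 = m by omega, List.range'_concat,
      List.map_append, List.prod_append]
    congr 1
    rw [List.map_singleton, List.prod_singleton, one_mul, add_comm 1 m]
    have e : Finset.Icc i j = Finset.Ico i (i + (j + 1 - i)) := by
      rw [Nat.add_sub_cancel' hij]; rfl
    rw [e, ← prod_map_range', map_list_prod, List.map_map]
    congr 1
    refine List.map_congr_left fun t _ => ?_
    rw [Function.comp_apply]
    exact LL1_eq ε q Q t (by omega)

variable (b : Fin p → ℕ)

/-- The element `v_b` for the first `t` parts of `b`. -/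
noncomputable def vpre (n t : ℕ) : H p n ε q Q :=
  ((List.range' 1 (t - 1)).reverse.map fun k =>
      (LL ε q Q 1 k 1 (part b (k + 1)) * Tw (wab n (part b (k + 1)) (psum b 1 k) 0) :
        H p n ε q Q)).prod *
    ((List.range' 2 (t - 1)).map fun k =>
      (LL ε q Q k k 1 (psum b 1 (k - 1)) : H p n ε q Q)).prod

theorem psum_zero : psum b 1 0 = 0 := psum_eq_zero b (by omega)

/-- The factor of the new block stands leftmost in the first product and rightmost in the second, so
v_b grows on the outside. -/
theorem vpre_succ (t : ℕ) : vpre ε q Q b n (t + 1) = LL ε q Q 1 t 1 (part b (t + 1)) *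
    Tw (wab n (part b (t + 1)) (psum b 1 t) 0) * vpre ε q Q b n t *
      LL ε q Q (t + 1) (t + 1) 1 (psum b 1 t) := by
  cases t with
  | zero => simp [vpre, LL, psum_zero, wab_zero_right]
  | succ t =>
    rw [vpre, vpre, Nat.add_sub_cancel, Nat.add_sub_cancel, List.range'_concat, List.range'_concat,
      List.reverse_append, List.reverse_singleton, List.singleton_append, List.map_cons,
      List.prod_cons, List.map_append, List.prod_append, List.map_singleton, List.prod_singleton]
    simp only [one_mul, mul_assoc]
    rw [show 1 + t = t + 1 by omega, show 2 + t = t + 1 + 1 by omega, Nat.add_sub_cancel]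

theorem vpre_mem_subAK {t : ℕ} (h : psum b 1 t ≤ n) :
    vpre ε q Q b n t ∈ subAK n q (Qeps p ε Q) (psum b 1 t) := by
  induction t with
  | zero => simp only [vpre]; simp
  | succ t ih =>
    have h2 := psum_succ_right b (i := 1) (j := t) (by omega)
    have hmono : ∀ {i j : ℕ}, i ≤ j → subAK n q (Qeps p ε Q) i ≤ subAK n q (Qeps p ε Q) j :=
      fun hij => Algebra.adjoin_mono (Set.image_mono (Set.Iio_subset_Iio hij))
    rw [vpre_succ, LL_eq _ _ _ (by omega) (by omega), LL_eq _ _ _ (by omega) (by omega)]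
    refine Subalgebra.mul_mem _ (Subalgebra.mul_mem _ (Subalgebra.mul_mem _
      (hmono (by omega) evL_blk_mem_subAK) (Tw_mem_subAK h ?_)) (hmono (by omega) (ih (by omega))))
      (hmono (by omega) evL_blk_mem_subAK)
    rw [h2, add_comm]
    exact wab_mem_fixing (by omega)

theorem Lmon_eq_shiftMon {m c : ℕ} (h : c + m ≤ n) (a : Fin m → ℕ) :
    (Lmon c a : H p n ε q Q) =
      evL (shiftMon R n c m fun k => if h : k < m then a ⟨k, h⟩ else 0) := by
  rw [Lmon_eq h, shiftMon, mon]
  congr 1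
  refine Fintype.prod_of_injective (fun j : Fin m => (⟨c + j, by omega⟩ : Fin n))
    (fun i j hij => Fin.ext (by simpa using hij)) _ _ (fun x hx => ?_) fun j => ?_
  · rw [if_neg, pow_zero]
    intro hx'
    exact hx ⟨⟨x - c, by omega⟩, Fin.ext (by simp; omega)⟩
  · simp

variable {b} (a : ∀ t : Fin p, Fin (b t) → ℕ) (x : ∀ t : Fin p, Equiv.Perm (Fin (b t)))

/-- The image of a standard basis element of the factor `t + 1`, placed after the first `c`
letters. -/
noncomputable def blockElt (n c t : ℕ) : H p n ε q Q :=
  if h : t < p then Lmon c (a ⟨t, h⟩) * Tw (shift n c (x ⟨t, h⟩)) else 1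

/-- The image of a standard basis element of the product of the first `t` factors, placed after
the first `c` letters. -/
noncomputable def prefixElt (n : ℕ) : ℕ → ℕ → H p n ε q Q
  | 0, _ => 1
  | t + 1, c => blockElt ε q Q a x n c t * prefixElt n t (c + part b (t + 1))

theorem part_succ {t : ℕ} (h : t < p) : part b (t + 1) = b ⟨t, h⟩ := dif_pos ⟨by omega, by omega⟩

/-- The exponents of a block, as a function on `ℕ`. -/
def blockExp (t k : ℕ) : ℕ := if h : ∃ h : t < p, k < b ⟨t, h⟩ then a ⟨t, h.1⟩ ⟨k, h.2⟩ else 0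

theorem blockExp_lt (hd : 0 < d) (ha : ∀ t j, a t j < d) (t k : ℕ) : blockExp a t k < d := by
  rw [blockExp]; split_ifs
  exacts [ha _ _, hd]

theorem blockElt_eq {t : ℕ} (ht : t < p) {c : ℕ} (hc : c + part b (t + 1) ≤ n) :
    blockElt ε q Q a x n c t = evL (shiftMon R n c (part b (t + 1)) (blockExp a t)) *
      Tw (shift n c (x ⟨t, ht⟩)) := by
  rw [part_succ ht] at hc ⊢
  rw [blockElt, dif_pos ht, Lmon_eq_shiftMon ε q Q hc]
  congr 3
  funext k
  simp [blockExp, ht]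

theorem shiftMon_add (o m m' : ℕ) (e e' : ℕ → ℕ) :
    shiftMon R n o m e * shiftMon R n (o + m) m' e' =
      shiftMon R n o (m + m') fun k => if k < m then e k else e' (k - m) := by
  rw [shiftMon, shiftMon, shiftMon, ← mon_add]
  congr 1
  funext x
  simp only [Pi.add_apply]
  rcases Nat.lt_or_ge x.val o with h | h
  · simp [show ¬ o ≤ x.val by omega, show ¬ o + m ≤ x.val by omega]
  · rcases Nat.lt_or_ge x.val (o + m) with h' | h'
    · rw [if_pos ⟨h, h'⟩, if_neg (by omega), if_pos ⟨h, by omega⟩, if_pos (by omega), add_zero]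
    · rw [if_neg (by omega), zero_add]
      split_ifs <;> first | omega | rfl | (congr 1; omega)

/-- The exponents and the word do not depend on the position c. The step relates the same element
placed after the new block (c = b_{t+1}) and at the beginning (c = 0), and needs a common
description of both. -/
theorem prefixElt_form (hd : 0 < d) (ha : ∀ t j, a t j < d) {t : ℕ} (ht : t ≤ p) :
    ∃ (e : ℕ → ℕ) (l : List ℕ), (∀ k, e k < d) ∧ (∀ i ∈ l, 1 ≤ i ∧ i < psum b 1 t) ∧
      ∀ c, c + psum b 1 t ≤ n → prefixElt ε q Q a x n t c =
        evL (shiftMon R n c (psum b 1 t) e) * (l.map fun i => T (i + c)).prod := by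
  induction t with
  | zero =>
    refine ⟨fun _ => 0, [], fun _ => hd, by simp, fun c _ => ?_⟩
    simp [prefixElt, shiftMon, psum_zero, mon]
  | succ t ih =>
    obtain ⟨e, l, he, hl, hform⟩ := ih (by omega)
    obtain ⟨k, hk, hword⟩ := exists_word_shift n q (Qeps p ε Q) (x ⟨t, ht⟩)
    have hps := psum_succ_right b (i := 1) (j := t) (by omega)
    have hpart := part_succ (b := b) ht
    refine ⟨fun j => if j < part b (t + 1) then blockExp a t j else e (j - part b (t + 1)),
      k ++ l.map (· + part b (t + 1)), fun j => ?_, fun i hi => ?_, fun c hc => ?_⟩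
    · dsimp only
      split_ifs
      exacts [blockExp_lt a hd ha t j, he _]
    · rcases List.mem_append.1 hi with h | h
      · have := hk i h; omega
      · obtain ⟨j, hj, rfl⟩ := List.mem_map.1 h
        have := hl j hj
        omega
    · rw [prefixElt, blockElt_eq ε q Q a x ht (by omega), hform _ (by omega), hps,
        add_comm (psum b 1 t), ← shiftMon_add, map_mul, List.map_append, List.prod_append,
        ← hword c (by omega), List.map_map]
      have c1 : Commute (Tw (shift n c (x ⟨t, ht⟩)) : H p n ε q Q)
          (evL (shiftMon R n (c + part b (t + 1)) (psum b 1 t) e)) := by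
        have := commute_word_evL (q := q) (Q := Qeps p ε Q) (l := k.map (· + c))
          (f := shiftMon R n (c + part b (t + 1)) (psum b 1 t) e) fun i hi => by
            obtain ⟨j, hj, rfl⟩ := List.mem_map.1 hi
            have := hk j hj
            exact shiftMon_mem_cen (by omega) (Or.inl (by omega))
        rwa [List.map_map, Function.comp_def, ← hword c (by omega)] at this
      have e2 : (fun i => (T (i + (c + part b (t + 1))) : H p n ε q Q)) =
          (fun i => T (i + c)) ∘ fun i => i + part b (t + 1) := by
        funext i
        simp only [Function.comp_apply]
        congr 1
        omega
      rw [← e2]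
      simp only [mul_assoc]
      rw [← mul_assoc (Tw _) (evL _), c1.eq]
      simp only [mul_assoc]

-- The extra left factor carries the groups k > t that the blocks treated so far still lack; it is
-- empty at t = p. In the step its restriction to the new block, together with ℒ^{(1,t)} from v,
-- supplies every group except t+1, while the factor ℒ^{(t+1)} completes the one needed for t.
open Classical in
theorem trace_prefix (hd : 0 < d) (hp : 0 < p) {τ : H p n ε q Q →ₗ[R] R} (hτ : IsCanonicalTrace τ)
    (ha : ∀ t j, a t j < d) {t : ℕ} (ht : t ≤ p) (hn : psum b 1 t ≤ n) :
    τ (evL (blk n (epsQ ε Q) (Finset.Icc (t + 1) p) 0 (psum b 1 t)) * prefixElt ε q Q a x n t 0 *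
        vpre ε q Q b n t * Tw (wpre b n t)) =
      (q : R) ^ len (wpre b n t) * ∏ s ∈ Finset.range t,
        if ∀ h : s < p, (∀ j, a ⟨s, h⟩ j = 0) ∧ x ⟨s, h⟩ = 1 then
          (∏ k ∈ Finset.Icc (s + 2) p ∪ Finset.Icc 1 s, ∏ i, -epsQ ε Q k i) ^ part b (s + 1)
        else 0 := by
  induction t with
  | zero =>
    have h1 := hτ.apply_mon (n := n) (ν := 0) ⟨fun _ => Nat.mul_pos hp hd, fun _ _ => rfl⟩ 1 1
    simp only [mon_zero, map_one, Tw_one, mul_one, inv_one, and_self, if_true, len_one,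
      pow_zero] at h1
    have hw : wpre b n 0 = 1 := rfl
    simp [prefixElt, vpre, hw, h1, len_one, psum_zero, blk]
  | succ t ih =>
    have hps := psum_succ_right b (i := 1) (j := t) (by omega)
    have hpart := part_succ (b := b) ht
    obtain ⟨e, l, he, hl, hform⟩ := prefixElt_form (n := n) ε q Q a x hd ha (t := t) (by omega)
    have hsw : IsBlockSwap n (part b (t + 1)) (psum b 1 t)
        (wab n (part b (t + 1)) (psum b 1 t) 0) := isBlockSwap_wab (by omega)
    have hinv := wab_inv (n := n) (a := part b (t + 1)) (m := psum b 1 t) (by omega)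
    have hfix := wpre_mem_fixing (n := n) b (t := t) (by omega)
    have step := trace_step (c := epsQ ε Q) (S := Finset.Icc (t + 2) p) (S' := Finset.Icc 1 t)
      (u := t + 1) (Nat.mul_pos hp hd) hτ hsw
      (Finset.disjoint_left.2 fun y hy hy' => by
        rw [Finset.mem_Icc] at hy hy'; omega)
      -- The two sets have p-t-1 and t elements, so with the omitted group the count is p and the
      -- degree bound of `trace_step` is met with equality.
      (by simp) (by
        rw [Nat.card_Icc, Nat.card_Icc, show p + 1 - (t + 2) + (t + 1 - 1) + 1 = p by omega])
      (blockExp_lt a hd ha t) he (x := shift n 0 (x ⟨t, ht⟩))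
      (by rw [hpart]; exact shift_mem_fixing (by omega) _) hl
      (vpre_mem_subAK ε q Q b (by omega)) (Tw_mem_subAK (by omega) hfix)
    have hform0 := hform 0 (by omega)
    simp only [add_zero] at hform0
    have hins : insert (t + 1) (Finset.Icc (t + 2) p) = Finset.Icc (t + 1) p :=
      Finset.insert_Icc_succ_left_eq_Icc (by omega)
    rw [hins, ← hform0,
      ih (by omega) (by omega)] at step
    rw [prefixElt, zero_add, blockElt_eq ε q Q a x ht (by omega), hform _ (by omega), hps,
      add_comm (psum b 1 t), vpre_succ, LL_eq _ _ _ (by omega) (by omega),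
      LL_eq _ _ _ (by omega) (by omega), Finset.Icc_self, wpre_succ b hn, ← hinv,
      Tw_mul (hsw.inv.len_fixing_mul hfix), hsw.inv.len_fixing_mul hfix, len_inv, pow_add,
      Finset.prod_range_succ]
    refine step.trans ?_
    have hcond : ((∀ k < part b (t + 1), blockExp a t k = 0) ∧ shift n 0 (x ⟨t, ht⟩) = 1) ↔
        ∀ h : t < p, (∀ j, a ⟨t, h⟩ j = 0) ∧ x ⟨t, h⟩ = 1 := by
      rw [shift_zero_eq_one (by omega), hpart]
      constructor
      · rintro ⟨h1, h2⟩ h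
        refine ⟨fun j => ?_, h2⟩
        have := h1 j j.2
        rwa [blockExp, dif_pos ⟨h, j.2⟩] at this
      · intro h
        refine ⟨fun k hk => ?_, (h ht).2⟩
        rw [blockExp, dif_pos ⟨ht, hk⟩]
        exact (h ht).1 _
    simp only [hcond]
    ring

end Main

end CycHecke

open scoped TensorProduct
namespace CycHecke

/-! ### Block products in closed form -/

section Value

variable {R : Type*} [CommRing R] {p n d : ℕ} {ε : Rˣ} (q : Rˣ) (Q : Fin d → Rˣ) {b : Fin p → ℕ}

theorem psum_one_eq : psum b 1 p = ∑ t, b t := by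
  rw [psum, ← Finset.sum_congr rfl fun t _ => part_succ t.2,
    Fin.sum_univ_eq_sum_range (fun s => part b (s + 1)) p]
  show ∑ k ∈ Finset.Ico 1 (p + 1), part b k = _
  rw [Finset.sum_Ico_eq_sum_range]
  exact Finset.sum_congr rfl fun s _ => by rw [add_comm]

theorem prod_range_part {M : Type*} [CommMonoid M] (f : ℕ → ℕ → M) :
    ∏ s ∈ Finset.range p, f s (part b (s + 1)) = ∏ t : Fin p, f t (b t) := by
  rw [← Fin.prod_univ_eq_prod_range (fun s => f s (part b (s + 1)))]
  exact Finset.prod_congr rfl fun t _ => by rw [part_succ t.2]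

theorem prefixElt_one (t c : ℕ) :
    prefixElt ε q Q (b := b) (fun _ _ => 0) (fun _ => 1) n t c = 1 := by
  induction t generalizing c with
  | zero => rfl
  | succ t ih =>
    rw [prefixElt, ih, mul_one, blockElt]
    split_ifs
    · simp [Lmon, shift_one, List.ofFn_const]
    · rfl

theorem prefixElt_eq_prod (a : ∀ t : Fin p, Fin (b t) → ℕ)
    (x : ∀ t : Fin p, Equiv.Perm (Fin (b t))) {t c : ℕ} (ht : t ≤ p) :
    prefixElt ε q Q a x n t c = ((List.range t).map fun s =>
      blockElt ε q Q a x n (c + psum b (s + 2) t) s).reverse.prod := by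
  induction t generalizing c with
  | zero => rfl
  | succ t ih =>
    rw [prefixElt, ih (by omega), List.range_succ, List.map_append, List.reverse_append,
      List.map_singleton, List.reverse_singleton, List.prod_append, List.prod_singleton,
      psum_eq_zero b (by omega), add_zero]
    congr 3
    refine List.map_congr_left fun s hs => ?_
    have := List.mem_range.1 hs
    rw [psum_succ_right b (by omega), add_assoc, add_comm (part b _)]

/-- The product of the values `-ε^k Q_i` over all `k` outside the blocks. -/
theorem prod_blocks (hε : ε ^ p = 1) (hp : 0 < p) (hb : ∑ t, b t = n) :
    (∏ s ∈ Finset.range p, (∏ k ∈ Finset.Icc (s + 2) p ∪ Finset.Icc 1 s,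
      ∏ i, -epsQ ε Q k i) ^ part b (s + 1) : R) =
      (-1) ^ (d * n * (p - 1)) *
        ((ε ^ (((p * d * n * (p - 1) / 2 : ℕ) : ℤ) - ((d * alpha b : ℕ) : ℤ)) : Rˣ) : R) *
        (∏ i, (Q i : R)) ^ (n * (p - 1)) := by
  -- Everything is a unit, so it pays to compute in the unit group: the product over all groups but
  -- one is the full product divided by the missing one.
  set P : Rˣ := (-1) ^ d * ∏ i, Q i with hP
  set U : ℕ → Rˣ := fun k => P * ε ^ (d * k) with hU
  have hUk : ∀ k, (∏ i, -epsQ ε Q k i : R) = (U k : R) := fun k => by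
    simp only [epsQ, hU, hP, Units.val_mul, Units.val_pow_eq_pow_val, Units.val_neg, Units.val_one,
      Units.coe_prod, ← neg_one_mul (_ * _)]
    rw [Finset.prod_mul_distrib, Finset.prod_mul_distrib, Finset.prod_const, Finset.prod_const,
      Finset.card_univ, Fintype.card_fin, ← pow_mul]
    ring
  have hgoal : (∏ s ∈ Finset.range p, (∏ k ∈ Finset.Icc (s + 2) p ∪ Finset.Icc 1 s, U k) ^
      part b (s + 1)) = P ^ (n * (p - 1)) *
        ε ^ (((p * d * n * (p - 1) / 2 : ℕ) : ℤ) - ((d * alpha b : ℕ) : ℤ)) := by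
    have hsplit : ∀ s ∈ Finset.range p, (∏ k ∈ Finset.Icc (s + 2) p ∪ Finset.Icc 1 s, U k) =
        (∏ k ∈ Finset.range p, U (k + 1)) * (U (s + 1))⁻¹ := fun s hs => by
      have hs' := Finset.mem_range.1 hs
      have hall : ∏ k ∈ Finset.range p, U (k + 1) = ∏ k ∈ Finset.Icc 1 p, U k := by
        show _ = ∏ k ∈ Finset.Ico 1 (p + 1), U k
        rw [Finset.prod_Ico_eq_prod_range]
        exact Finset.prod_congr rfl fun s _ => by rw [add_comm]
      have hins : Finset.Icc 1 p = insert (s + 1) (Finset.Icc (s + 2) p ∪ Finset.Icc 1 s) := by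
        ext k
        simp only [Finset.mem_Icc, Finset.mem_insert, Finset.mem_union]
        omega
      rw [eq_mul_inv_iff_mul_eq, hall, hins, Finset.prod_insert (by simp), mul_comm]
    have hsum : ∑ k ∈ Finset.range p, (k + 1) = ∑ k ∈ Finset.range p, k + p := by
      simp [Finset.sum_add_distrib]
    -- The division by two is exact, since p(p-1)/2 is the sum of the numbers below p.
    have hdiv : p * d * n * (p - 1) / 2 = d * n * ∑ k ∈ Finset.range p, k := by
      refine Nat.div_eq_of_eq_mul_left (by omega) ?_
      rw [mul_assoc (d * n), Finset.sum_range_id_mul_two]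
      ring
    -- The exponents k run from 1 to p, not from 0 to p-1; the surplus factor ε^{dp} is 1.
    have hall : ∏ k ∈ Finset.range p, U (k + 1) =
        P ^ p * ε ^ (d * ∑ k ∈ Finset.range p, k) := by
      simp only [hU]
      rw [Finset.prod_mul_distrib, Finset.prod_const, Finset.card_range, Finset.prod_pow_eq_pow_sum,
        ← Finset.mul_sum, hsum, mul_add, pow_add, mul_comm d p, pow_mul ε p, hε, one_pow, mul_one]
    have hown : ∏ t : Fin p, U (t.val + 1) ^ b t = P ^ n * ε ^ (d * alpha b) := by
      simp only [hU, mul_pow]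
      rw [Finset.prod_mul_distrib, Finset.prod_pow_eq_pow_sum, hb, alpha, Finset.mul_sum,
        ← Finset.prod_pow_eq_pow_sum]
      simp only [← pow_mul, mul_assoc]
    rw [Finset.prod_congr rfl fun s hs => by rw [hsplit s hs],
      prod_range_part fun s k => ((∏ k ∈ Finset.range p, U (k + 1)) * (U (s + 1))⁻¹) ^ k]
    simp only [mul_pow, inv_pow]
    rw [Finset.prod_mul_distrib, Finset.prod_pow_eq_pow_sum, hb, Finset.prod_inv_distrib, hown, hall,
      hdiv, zpow_sub, zpow_natCast, zpow_natCast, mul_pow, ← pow_mul, ← pow_mul, mul_inv,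
      show p * n = n * (p - 1) + n by
        obtain ⟨m, rfl⟩ := Nat.exists_eq_add_of_le' hp; simp; ring, pow_add,
      show d * (∑ k ∈ Finset.range p, k) * n = d * n * ∑ k ∈ Finset.range p, k by ring]
    rw [mul_comm (P ^ (n * (p - 1))), mul_assoc, mul_assoc, mul_left_comm (P ^ n), mul_comm (P ^ n)]
    simp [mul_comm, mul_left_comm, mul_assoc]
  simp only [hUk, ← Units.coe_prod, ← Units.val_pow_eq_pow_val]
  rw [hgoal, hP]
  push_cast
  rw [mul_pow, ← pow_mul, ← mul_assoc d n]
  ring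

end Value

end CycHecke

/-! ### The trace formula -/

open CycHecke in
theorem mainTheorem8 {R : Type*} [CommRing R] (n p d : ℕ) (hn : 3 ≤ n) (hp : 1 < p) (hd : 0 < d)
    (ε : Rˣ) (hε : IsPrimitiveRoot (ε : R) p) (q : Rˣ) (Q : Fin d → Rˣ)
    (b : Fin p → ℕ) (hb : ∑ t, b t = n) :
    (∃! Tr : H p n ε q Q →ₗ[R] R, IsCanonicalTrace Tr) ∧
    (∃! Trb : Hb b ε q Q →ₗ[R] R, IsCanonicalTraceB Trb) ∧
    (∃! Θ : Hb b ε q Q →ₗ[R] H p n ε q Q, IsThetaHat n Θ) ∧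
    ∀ (Tr : H p n ε q Q →ₗ[R] R) (Trb : Hb b ε q Q →ₗ[R] R) (Θ : Hb b ε q Q →ₗ[R] H p n ε q Q),
      IsCanonicalTrace Tr → IsCanonicalTraceB Trb → IsThetaHat n Θ →
        (∀ h : Hb b ε q Q,
          Tr (Θ h * vb ε q Q b * Tb ε q Q b) = Trb h * Tr (vb ε q Q b * Tb ε q Q b)) ∧
        Tr (vb ε q Q b * Tb ε q Q b) =
          (-1) ^ (d * n * (p - 1)) * (q : R) ^ len (wb n b) *
            ((ε ^ (((p * d * n * (p - 1) / 2 : ℕ) : ℤ) - ((d * alpha b : ℕ) : ℤ)) : Rˣ) : R) *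
            (∏ i, (Q i : R)) ^ (n * (p - 1)) := by
  classical
  have hr : 0 < p * d := Nat.mul_pos (by omega) hd
  refine ⟨existsUnique_canonicalTrace hr, existsUnique_canonicalTraceB hd,
    existsUnique_thetaHat hd, fun Tr Trb Θ hTr hTrb hΘ => ?_⟩
  have hps : psum b 1 p = n := by rw [psum_one_eq, hb]
  set K : R := (q : R) ^ len (wb n b) *
    ∏ s ∈ Finset.range p, (∏ k ∈ Finset.Icc (s + 2) p ∪ Finset.Icc 1 s,
      ∏ i, -epsQ ε Q k i) ^ part b (s + 1) with hK
  have key : ∀ (a : ∀ t : Fin p, Fin (b t) → ℕ), (∀ t j, a t j < d) →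
      ∀ x : ∀ t : Fin p, Equiv.Perm (Fin (b t)),
        Tr (prefixElt ε q Q a x n p 0 * vb ε q Q b * Tb ε q Q b) =
          if ∀ t, (∀ j, a t j = 0) ∧ x t = 1 then K else 0 := by
    intro a ha x
    have := trace_prefix ε q Q a x hd (by omega) hTr ha le_rfl hps.le
    rw [Finset.Icc_eq_empty (by omega : ¬ p + 1 ≤ p)] at this
    rw [show blk n (epsQ ε Q) ∅ 0 (psum b 1 p) = 1 by simp [blk], map_one, one_mul] at this
    refine this.trans ?_
    split_ifs with h
    · rw [hK]
      congr 1
      exact Finset.prod_congr rfl fun s _ => if_pos fun hs => h ⟨s, hs⟩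
    · obtain ⟨t, ht⟩ := not_forall.1 h
      rw [Finset.prod_eq_zero (Finset.mem_range.2 t.2) (if_neg fun h' => ht (h' t.2)), mul_zero]
  have hone : prefixElt ε q Q (b := b) (fun _ _ => 0) (fun _ => 1) n p 0 = 1 := by
    rw [prefixElt_one]
  -- The standard tensor with zero exponents and identity permutations maps to 1, so it yields the
  -- trace of v_b T_b itself.
  have hv : Tr (vb ε q Q b * Tb ε q Q b) = K := by
    have := key (fun _ _ => 0) (fun _ _ => hd) fun _ => 1
    rwa [hone, one_mul, if_pos fun _ => ⟨fun _ => rfl, rfl⟩] at this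
  have hpre : ∀ (a : ∀ t : Fin p, Fin (b t) → ℕ) (x : ∀ t : Fin p, Equiv.Perm (Fin (b t))),
      ((List.ofFn fun t : Fin p => (Lmon (offset b t) (a t) * Tw (shift n (offset b t) (x t)) :
        H p n ε q Q)).reverse).prod = prefixElt ε q Q a x n p 0 := by
    intro a x
    rw [prefixElt_eq_prod q Q a x le_rfl]
    congr 2
    refine List.ext_getElem (by simp) fun t h1 h2 => ?_
    rw [List.length_ofFn] at h1
    rw [List.getElem_ofFn, List.getElem_map, List.getElem_range, zero_add, blockElt, dif_pos h1]
    rfl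
  refine ⟨fun h => ?_, ?_⟩
  -- Both sides are linear in h, so they are compared on the standard tensors, where `key` gives the
  -- value of the left side.
  · have : Tr ∘ₗ LinearMap.mulRight R (vb ε q Q b * Tb ε q Q b) ∘ₗ Θ =
        Tr (vb ε q Q b * Tb ε q Q b) • Trb := ext_stdB hd fun a ha x => by
      simp only [LinearMap.comp_apply, LinearMap.mulRight_apply, LinearMap.smul_apply, smul_eq_mul]
      rw [hΘ a ha x, hTrb.apply_std ha, hpre, hv, ← mul_assoc, key a ha]
      split_ifs <;> simp
    have := LinearMap.congr_fun this h
    simp only [LinearMap.comp_apply, LinearMap.mulRight_apply, LinearMap.smul_apply, smul_eq_mul]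
      at this
    rw [mul_assoc, this, mul_comm]
  · rw [hv, hK, prod_blocks Q (Units.ext (by simpa using hε.pow_eq_one)) (by omega) hb]
    ring
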